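/- **Setting.** Let $d\in\{3,4,5,6\}$, $a,\alpha\in\mathbb R$ satisfy one of the following: * $d=3$, $\tfrac43<\alpha\le 2$ and $a>-\bigl(\tfrac{d-2}{2}\bigr)^2$; * $3\le d\le 6$, $\max\{\tfrac{2}{d-2},\tfrac4d\}<\alpha<\tfrac{4}{d-2}$ and $a>-\bigl(\tfrac{d-2}{2}\bigr)^2+\bigl(\tfrac{d-2}{2}-\tfrac1\alpha\bigr)^2$. Let $\mu\in\{1,-1\}$ ($\mu=1$ defocusing, $\mu=-1$ focusing). Let $\mathcal L_a=-\Delta+\tfrac{a}{|x|^2}$ be the Friedrichs extension of the quadratic form $Q(f)=\int_{\mathbb R^d}|\nabla f|^2+\tfrac{a}{|x|^2}|f|^2\,dx$ on $C_c^\infty(\mathbb R^d\setminus\{0\})$; put $\|f\|_{\dot H^1_a}=Q(f)^{1/2}$ for $f\in H^1(\mathbb R^d)$, and $\|f\|_{H^{1,r}_a}=\|(1+\mathcal L_a)^{1/2}f\|_{L^r}$, $H^1_a=H^{1,2}_a$. A global solution of $$(i\partial_t-\mathcal L_a)u=\mu|u|^\alpha u \qquad(\mathrm{NLS}_a)$$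 is a function $u:\mathbb R\times\mathbb R^d\to\mathbb C$ that belongs to $C_tH^1_a\cap L^2_tH_a^{1,\frac{2d}{d-2}}(K\times\mathbb R^d)$ for every compact $K\subset\mathbb R$ and satisfies $u(t)=e^{-it\mathcal L_a}u(0)-i\mu\int_0^te^{-i(t-s)\mathcal L_a}(|u|^\alpha u)(s)\,ds$ for all $t\in\mathbb R$. Write $$M(f)=\int|f|^2\,dx,\qquad E_a(f)=\int\tfrac12|\nabla f|^2+\tfrac{a}{2|x|^2}|f|^2+\tfrac{\mu}{\alpha+2}|f|^{\alpha+2}\,dx,\qquad q_0=\tfrac{\alpha(d+2)}2 .$$ Let $C_a$ be the sharp constant in $\|f\|_{L^{\alpha+2}}^{\alpha+2}\le C_a\|f\|_{L^2}^{\frac{4-(d-2)\alpha}{2}}\|f\|_{\dot H^1_a}^{\frac{d\alpha}{2}}$, $f\in H^1$, and set $$\mathcal E_a=\frac{(\alpha d-4)(\alpha d)^{\frac{d\alpha}{4-d\alpha}}}{2\,(2(\alpha+2))^{\frac{4}{4-d\alpha}}}\,C_a^{\frac{4}{4-d\alpha}},\qquad \mathcal K_a=\Bigl(\tfrac{2(\alpha+2)}{\alpha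 d}\Bigr)^{\frac{2}{d\alpha-4}}C_a^{\frac{2}{4-d\alpha}} .$$ **Theorem 5.1.** Let $\mathcal E_c\in(0,\infty)$, and assume $\mathcal E_c<\mathcal E_a$ if $\mu=-1$. (This covers in particular the critical level at which scattering would first fail.) Then there is no global solution $v$ of $(\mathrm{NLS}_a)$ with all of the following properties: * $M(v(t))=1$ and $E_a(v(t))=\mathcal E_c$ for all $t\in\mathbb R$; * $\|v\|_{L^{q_0}_{t,x}((-\infty,0)\times\mathbb R^d)}=\|v\|_{L^{q_0}_{t,x}((0,\infty)\times\mathbb R^d)}=\infty$; * the orbit $\{v(t):t\in\mathbb R\}$ is precompact in $H^1(\mathbb R^d)$; * if $\mu=-1$, then $\|v(0)\|_{\dot H^1_a}<\mathcal K_a$. -/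

import Mathlib

noncomputable section

namespace NLSInvSq

open MeasureTheory Filter Topology TopologicalSpace
open scoped ENNReal Distributions

set_option linter.unusedSectionVars false

/-- Euclidean space `ℝ^d`. -/
abbrev Space (d : ℕ) : Type := EuclideanSpace ℝ (Fin d)

/-- `ℂ^d` with its Hermitian inner product, where gradients take their values. -/
abbrev CSpace (d : ℕ) : Type := EuclideanSpace ℂ (Fin d)

/-- The Hilbert space `L²(ℝ^d; ℂ)`. -/
abbrev L2 (d : ℕ) : Type := Lp ℂ 2 (volume : Measure (Space d))

/-- The Hilbert space `L²(ℝ^d; ℂ^d)`. -/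
abbrev L2Vec (d : ℕ) : Type := Lp (CSpace d) 2 (volume : Measure (Space d))

/-- The open set `ℝ^d ∖ {0}`. -/
def puncturedSpace (d : ℕ) : Opens (Space d) := ⟨{0}ᶜ, isOpen_compl_singleton⟩

/-- The space `C_c^∞(ℝ^d ∖ {0}; ℂ)`. -/
abbrev PTest (d : ℕ) : Type := 𝓓(puncturedSpace d, ℂ)

/-- The `i`-th (classical) partial derivative. -/
def pd {d : ℕ} (i : Fin d) (φ : Space d → ℂ) (x : Space d) : ℂ :=
  fderiv ℝ φ x (EuclideanSpace.single i 1)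

/-- The (classical) gradient. -/
def grad {d : ℕ} (φ : Space d → ℂ) (x : Space d) : CSpace d :=
  WithLp.toLp 2 fun i => pd i φ x

/-! ### The operator `L_a = -Δ + a/|x|²` -/

/-- The sesquilinear form `∫ conj(∇φ)·∇ψ + a/|x|² conj(φ) ψ`, whose quadratic form is
`Q(φ) = ∫ |∇φ|² + a/|x|² |φ|²`. -/
def sesqForm {d : ℕ} (a : ℝ) (φ ψ : Space d → ℂ) : ℂ :=
  ∫ x, (inner ℂ (grad φ x) (grad ψ x) + ((a / ‖x‖ ^ 2 : ℝ) : ℂ) * inner ℂ (φ x) (ψ x))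

/-- The graph of the Friedrichs extension `L_a` of the quadratic form `Q` on
`C_c^∞(ℝ^d ∖ {0})`: `FriedrichsGraph a f h` says that `f` lies in the domain of `L_a` and
`L_a f = h`. That is, `f` lies in the form domain (it is the `L²` limit of test functions `φ n` that
are Cauchy for `Q`), and the closed form satisfies `Q(ψ, f) = ⟨ψ, h⟩` for all test functions `ψ`. -/
def FriedrichsGraph {d : ℕ} (a : ℝ) (f h : L2 d) : Prop :=
  ∃ φ : ℕ → PTest d,
    Tendsto (fun n => eLpNorm (fun x => φ n x - f x) 2 volume) atTop (𝓝 0) ∧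
    Tendsto (fun p : ℕ × ℕ => sesqForm a ⇑(φ p.1 - φ p.2) ⇑(φ p.1 - φ p.2)) atTop (𝓝 0) ∧
    ∀ ψ : PTest d, Tendsto (fun n => sesqForm a ⇑ψ ⇑(φ n)) atTop
      (𝓝 (∫ x, inner ℂ (ψ x) (h x)))

/-- `U` is the strongly continuous unitary group on `L²` generated by `-i L_a`. -/
structure IsSchrodingerGroup {d : ℕ} (a : ℝ) (U : ℝ → L2 d →L[ℂ] L2 d) : Prop where
  map_zero : U 0 = 1
  map_add : ∀ s t, U (s + t) = U s * U t
  norm_map : ∀ t f, ‖U t f‖ = ‖f‖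
  continuous : ∀ f, Continuous fun t => U t f
  generator : ∀ f h, FriedrichsGraph a f h → HasDerivAt (fun t => U t f) (-(Complex.I • h)) 0

/-! ### Existence of `(1 + L_a)⁻¹` and of `e^{-itL_a}`

The declarations of this part only serve to show that the two operators defined in the next part
exist: the form is `⟨Dφ, Dψ⟩` for `D = ∇ + ρ x/|x|²` with a suitable `ρ`, the inverse of `1 + L_a`
is obtained by projecting onto the closed graph of `D`, and the group by functional calculus. -/

section existence

variable {d : ℕ}

theorem ptest_smooth (φ : PTest d) : ContDiff ℝ (⊤ : ℕ∞) φ := φ.contDiff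

theorem pd_smooth (φ : PTest d) (i : Fin d) : ContDiff ℝ (⊤ : ℕ∞) (pd i φ) := by
  unfold pd
  exact ((ptest_smooth φ).fderiv_right (m := (⊤ : ℕ∞)) (by simp)).clm_apply contDiff_const

theorem pd_support (φ : PTest d) (i : Fin d) : tsupport (pd i φ) ⊆ tsupport φ :=
  tsupport_fderiv_apply_subset ℝ _

theorem not_mem_tsupport (φ : PTest d) : (0 : Space d) ∉ tsupport φ := fun h => by
  have := φ.tsupport_subset h
  simp [puncturedSpace] at this

/-- A singular multiple of a function supported away from the origin is continuous. -/
theorem continuous_mul_of {g : Space d → ℂ} (w : Space d → ℂ) (hw : ∀ x, x ≠ 0 → ContinuousAt w x)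
    (hg : Continuous g) (h0 : (0 : Space d) ∉ tsupport g) : Continuous fun x => w x * g x := by
  rw [continuous_iff_continuousAt]
  intro x
  by_cases hx : x = 0
  · subst hx
    have : (fun x => w x * g x) =ᶠ[𝓝 0] fun _ => 0 := by
      filter_upwards [(isClosed_tsupport g).isOpen_compl.mem_nhds h0] with y hy
      simp [image_eq_zero_of_notMem_tsupport hy]
    exact (continuousAt_const).congr this.symm
  · exact (hw x hx).mul hg.continuousAt

theorem integrable_mul_of {g : Space d → ℂ} (w : Space d → ℂ)
    (hw : ∀ x, x ≠ 0 → ContinuousAt w x)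
    (hg : Continuous g) (hc : HasCompactSupport g) (h0 : (0 : Space d) ∉ tsupport g) :
    Integrable fun x => w x * g x :=
  (continuous_mul_of w hw hg h0).integrable_of_hasCompactSupport hc.mul_left

/-- The weight x_i / |x|². -/
def wt (i : Fin d) (x : Space d) : ℝ := x i / ‖x‖ ^ 2

theorem hasFDerivAt_wt (i : Fin d) {x : Space d} (hx : x ≠ 0) :
    DifferentiableAt ℝ (wt i) x ∧ fderiv ℝ (wt i) x (EuclideanSpace.single i 1) =
      1 / ‖x‖ ^ 2 - 2 * (x i) ^ 2 / (‖x‖ ^ 2) ^ 2 := by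
  have hn : ‖x‖ ^ 2 ≠ 0 := by positivity
  have h1 : HasFDerivAt (fun y : Space d => y i) (EuclideanSpace.proj i : Space d →L[ℝ] ℝ) x :=
    (EuclideanSpace.proj i : Space d →L[ℝ] ℝ).hasFDerivAt
  have h2 : HasFDerivAt (fun y : Space d => ‖y‖ ^ 2) (2 • (innerSL ℝ x)) x :=
    (hasStrictFDerivAt_norm_sq x).hasFDerivAt
  have h3 := (hasDerivAt_inv hn).comp_hasFDerivAt x h2
  have h4 : HasFDerivAt (wt i) _ x := h1.mul h3
  refine ⟨h4.differentiableAt, ?_⟩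
  rw [h4.fderiv]
  simp [EuclideanSpace.inner_single_right]
  field_simp
  ring

theorem sum_pd_wt {x : Space d} (hx : x ≠ 0) :
    ∑ i, fderiv ℝ (wt i) x (EuclideanSpace.single i 1) = ((d : ℝ) - 2) / ‖x‖ ^ 2 := by
  have hn : ‖x‖ ^ 2 ≠ 0 := by positivity
  simp_rw [(hasFDerivAt_wt _ hx).2]
  rw [Finset.sum_sub_distrib, ← Finset.sum_div, ← Finset.sum_div, ← Finset.mul_sum]
  have : ∑ i, x i ^ 2 = ‖x‖ ^ 2 := by
    rw [EuclideanSpace.norm_sq_eq]; simp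
  rw [this]
  simp
  field_simp

theorem wt_contAt (i : Fin d) (x : Space d) (hx : x ≠ 0) :
    ContinuousAt (fun x => (wt i x : ℂ)) x :=
  Complex.continuous_ofReal.continuousAt.comp (hasFDerivAt_wt i hx).1.continuousAt

theorem ibp_wt (g : Space d → ℂ) (hg : ContDiff ℝ 1 g) (hc : HasCompactSupport g)
    (h0 : (0 : Space d) ∉ tsupport g) :
    ∫ x, ∑ i, (wt i x : ℂ) * pd i g x = - ∫ x, ((((d : ℝ) - 2) / ‖x‖ ^ 2 : ℝ) : ℂ) * g x := by
  have hcd : ∀ i, Continuous (pd i g) := fun i =>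
    (hg.continuous_fderiv (by simp)).clm_apply continuous_const
  have hts : ∀ i, tsupport (pd i g) ⊆ tsupport g := fun i => tsupport_fderiv_apply_subset ℝ _
  have hcs : ∀ i, HasCompactSupport (pd i g) := fun i =>
    hc.mono' ((subset_tsupport _).trans (hts i))
  have hI : ∀ i, Integrable fun x => (wt i x : ℂ) * pd i g x := fun i =>
    integrable_mul_of _ (wt_contAt i) (hcd i) (hcs i) (fun h => h0 (hts i h))
  have hne : ∀ x ∈ tsupport g, x ≠ 0 := fun x hx h => h0 (h ▸ hx)
  have hwd : ∀ i, ∀ x : Space d, x ≠ 0 → HasFDerivAt (fun x => (wt i x : ℂ))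
      (Complex.ofRealCLM ∘L fderiv ℝ (wt i) x) x := fun i x hx =>
    Complex.ofRealCLM.hasFDerivAt.comp x (hasFDerivAt_wt i hx).1.hasFDerivAt
  have hdc : ∀ i, ∀ x : Space d, x ≠ 0 →
      ContinuousAt (fun x => fderiv ℝ (fun x => (wt i x : ℂ)) x (EuclideanSpace.single i 1)) x := by
    intro i x hx
    have : (fun x : Space d => ((1 / ‖x‖ ^ 2 - 2 * (x i) ^ 2 / (‖x‖ ^ 2) ^ 2 : ℝ) : ℂ)) =ᶠ[𝓝 x]
        (fun x => fderiv ℝ (fun x => (wt i x : ℂ)) x (EuclideanSpace.single i 1)) := by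
      filter_upwards [isOpen_ne.mem_nhds hx] with y hy
      rw [(hwd i y hy).fderiv, ← (hasFDerivAt_wt i hy).2]
      simp
    refine ContinuousAt.congr ?_ this
    have hn : ‖x‖ ^ 2 ≠ 0 := by positivity
    have hn2 : (‖x‖ ^ 2) ^ 2 ≠ 0 := by positivity
    refine Complex.continuous_ofReal.continuousAt.comp ?_
    fun_prop (disch := assumption)
  have hI2 : ∀ i, Integrable fun x =>
      fderiv ℝ (fun x => (wt i x : ℂ)) x (EuclideanSpace.single i 1) * g x := fun i =>
    integrable_mul_of _ (hdc i) hg.continuous hc h0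
  rw [integral_finsetSum _ (fun i _ => hI i)]
  have : ∀ i, ∫ x, (wt i x : ℂ) * pd i g x =
      - ∫ x, fderiv ℝ (fun x => (wt i x : ℂ)) x (EuclideanSpace.single i 1) * g x := by
    intro i
    refine integral_mul_fderiv_eq_neg_fderiv_mul_of_integrable (hI2 i) (hI i)
      (integrable_mul_of _ (wt_contAt i) hg.continuous hc h0)
      (fun x hx => (hwd i x (hne x hx)).differentiableAt)
      (fun x _ => hg.differentiable (by simp) x)
  simp_rw [this]
  rw [Finset.sum_neg_distrib, ← integral_finsetSum _ (fun i _ => hI2 i)]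
  congr 1
  refine integral_congr_ae (Eventually.of_forall fun x => ?_)
  by_cases hx : x ∈ tsupport g
  · have hx0 := hne x hx
    simp only
    rw [← Finset.sum_mul, ← sum_pd_wt hx0]
    congr 1
    push_cast
    refine Finset.sum_congr rfl fun i _ => ?_
    rw [(hwd i x hx0).fderiv]; simp
  · simp [image_eq_zero_of_notMem_tsupport hx]

/-- The smaller root `ρ` of `ρ² - (d-2)ρ = a`. -/
def rho (d : ℕ) (a : ℝ) : ℝ := ((d : ℝ) - 2) / 2 - √((((d : ℝ) - 2) / 2) ^ 2 + a)

/-- The first-order operator `D φ = ∇φ + ρ x/|x|² φ`. -/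
def dop (a : ℝ) (φ : Space d → ℂ) (x : Space d) : CSpace d :=
  WithLp.toLp 2 fun i => pd i φ x + (rho d a : ℂ) * ((wt i x : ℂ) * φ x)

theorem dop_continuous (a : ℝ) (φ : PTest d) : Continuous (dop a φ) := by
  refine (PiLp.continuous_toLp 2 _).comp (continuous_pi fun i => ?_)
  exact (pd_smooth φ i).continuous.add (continuous_const.mul
    (continuous_mul_of _ (wt_contAt i) φ.continuous (not_mem_tsupport φ)))

theorem dop_support (a : ℝ) (φ : PTest d) : HasCompactSupport (dop a φ) := by
  refine HasCompactSupport.intro φ.hasCompactSupport fun x hx => ?_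
  ext i
  have h1 : pd i φ x = 0 := image_eq_zero_of_notMem_tsupport (fun h => hx (pd_support φ i h))
  simp [dop, h1, image_eq_zero_of_notMem_tsupport hx]

theorem dop_memLp (a : ℝ) (φ : PTest d) : MemLp (dop a φ) 2 volume :=
  (dop_continuous a φ).memLp_of_hasCompactSupport (dop_support a φ)

theorem ptest_memLp (φ : PTest d) : MemLp φ 2 (volume : Measure (Space d)) :=
  φ.continuous.memLp_of_hasCompactSupport φ.hasCompactSupport

theorem dop_inner {a : ℝ} (ha : -(((d : ℝ) - 2) / 2) ^ 2 ≤ a) (φ ψ : PTest d) :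
    ∫ x, inner ℂ (dop a φ x) (dop a ψ x) = sesqForm a φ ψ := by
  obtain ⟨g, hg⟩ : ∃ g : Space d → ℂ, g = fun x => (starRingEnd ℂ) (φ x) * ψ x := ⟨_, rfl⟩
  have hφs : ContDiff ℝ (⊤ : ℕ∞) fun x => (starRingEnd ℂ) (φ x) :=
    Complex.conjCLE.contDiff.comp (ptest_smooth φ)
  have hgs : ContDiff ℝ 1 g := hg ▸ (hφs.mul (ptest_smooth ψ)).of_le (by exact_mod_cast le_top)
  have hgt : tsupport g ⊆ tsupport ψ := hg ▸ tsupport_mul_subset_right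
  have hgc : HasCompactSupport g := hg ▸ ψ.hasCompactSupport.mul_left
  have hg0 : (0 : Space d) ∉ tsupport g := fun h => not_mem_tsupport ψ (hgt h)
  have hpd : ∀ i x, pd i g x = (starRingEnd ℂ) (pd i φ x) * ψ x +
      (starRingEnd ℂ) (φ x) * pd i ψ x := by
    intro i x
    have h1 : HasFDerivAt (fun x => (starRingEnd ℂ) (φ x))
        ((Complex.conjCLE : ℂ →L[ℝ] ℂ) ∘L fderiv ℝ φ x) x :=
      (Complex.conjCLE : ℂ →L[ℝ] ℂ).hasFDerivAt.comp x
        ((ptest_smooth φ).differentiable (by simp) x).hasFDerivAt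
    have h2 := ((ptest_smooth ψ).differentiable (by simp) x).hasFDerivAt
    have h3 := h1.mul h2
    have hg' : g = (fun x => (starRingEnd ℂ) (φ x)) * ψ := hg
    simp only [pd]
    rw [hg', h3.fderiv]
    simp
    ring
  have key := ibp_wt g hgs hgc hg0
  have hcp : ∀ i, Continuous (pd i g) := fun i =>
    (hgs.continuous_fderiv (by simp)).clm_apply continuous_const
  have hts : ∀ i, tsupport (pd i g) ⊆ tsupport g := fun i => tsupport_fderiv_apply_subset ℝ _
  have I1 : Integrable fun x => ∑ i, (wt i x : ℂ) * pd i g x :=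
    integrable_finsetSum _ fun i _ => integrable_mul_of _ (wt_contAt i) (hcp i)
      (hgc.mono' ((subset_tsupport _).trans (hts i))) (fun h => hg0 (hts i h))
  have hrad : ∀ c : ℝ, ∀ x : Space d, x ≠ 0 →
      ContinuousAt (fun x : Space d => ((c / ‖x‖ ^ 2 : ℝ) : ℂ)) x := by
    intro c x hx
    have hn : ‖x‖ ^ 2 ≠ 0 := by positivity
    refine Complex.continuous_ofReal.continuousAt.comp ?_
    fun_prop (disch := assumption)
  have I2 : ∀ c : ℝ, Integrable fun x : Space d => ((c / ‖x‖ ^ 2 : ℝ) : ℂ) * g x := fun c =>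
    integrable_mul_of _ (hrad c) hgs.continuous hgc hg0
  have I0 : Integrable fun x => inner ℂ (grad φ x) (grad ψ x) := by
    have : (fun x => inner ℂ (grad φ x) (grad ψ x)) =
        fun x => ∑ i, pd i ψ x * (starRingEnd ℂ) (pd i φ x) := by
      ext x; simp [grad, PiLp.inner_apply]
    rw [this]
    refine integrable_finsetSum _ fun i _ => ?_
    refine Continuous.integrable_of_hasCompactSupport ?_ ?_
    · exact (pd_smooth ψ i).continuous.mul (Complex.continuous_conj.comp (pd_smooth φ i).continuous)
    · exact (ψ.hasCompactSupport.mono' ((subset_tsupport _).trans (pd_support ψ i))).mul_right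
  have hpt : ∀ x, inner ℂ (dop a φ x) (dop a ψ x) = inner ℂ (grad φ x) (grad ψ x) +
      (((rho d a) ^ 2 / ‖x‖ ^ 2 : ℝ) : ℂ) * g x +
      (rho d a : ℂ) * ∑ i, (wt i x : ℂ) * pd i g x := by
    intro x
    by_cases hx : x = 0
    · have hx' : x ∉ tsupport ψ := hx ▸ not_mem_tsupport ψ
      have h1 : ∀ i, pd i ψ x = 0 := fun i =>
        image_eq_zero_of_notMem_tsupport (fun h => hx' (pd_support ψ i h))
      have h2 : g x = 0 := by simp [hg, image_eq_zero_of_notMem_tsupport hx']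
      simp [dop, grad, PiLp.inner_apply, hpd, h1, h2, image_eq_zero_of_notMem_tsupport hx']
    · have hs : ∑ i, (wt i x) ^ 2 = 1 / ‖x‖ ^ 2 := by
        have : ∑ i, x i ^ 2 = ‖x‖ ^ 2 := by
          rw [EuclideanSpace.norm_sq_eq]; simp
        simp only [wt, div_pow]
        rw [← Finset.sum_div, this]
        have hn : ‖x‖ ^ 2 ≠ 0 := by positivity
        field_simp
      have hs' : ((rho d a ^ 2 / ‖x‖ ^ 2 : ℝ) : ℂ) = (rho d a : ℂ) ^ 2 * ∑ i, (wt i x : ℂ) ^ 2 := by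
        have : (rho d a ^ 2 / ‖x‖ ^ 2 : ℝ) = rho d a ^ 2 * ∑ i, (wt i x) ^ 2 := by rw [hs]; ring
        rw [this]; push_cast; rfl
      rw [hs', show g x = (starRingEnd ℂ) (φ x) * ψ x by rw [hg]]
      simp only [dop, grad, PiLp.inner_apply, hpd, RCLike.inner_apply, map_add, map_mul,
        Complex.conj_ofReal]
      rw [Finset.mul_sum, Finset.mul_sum, Finset.sum_mul, ← Finset.sum_add_distrib,
        ← Finset.sum_add_distrib]
      refine Finset.sum_congr rfl fun i _ => ?_
      ring
  simp_rw [hpt]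
  rw [integral_add (f := fun x => inner ℂ (grad φ x) (grad ψ x) +
      (((rho d a) ^ 2 / ‖x‖ ^ 2 : ℝ) : ℂ) * g x) (I0.add (I2 _)) (I1.const_mul _), integral_const_mul, key,
    integral_add I0 (I2 _)]
  have hsf : sesqForm a φ ψ = ∫ x, (inner ℂ (grad φ x) (grad ψ x) +
      ((a / ‖x‖ ^ 2 : ℝ) : ℂ) * g x) := by
    unfold sesqForm
    congr 1; ext x; simp [hg, RCLike.inner_apply]; ring_nf; simp
  rw [hsf, integral_add I0 (I2 _)]
  have hr : rho d a ^ 2 - rho d a * ((d : ℝ) - 2) = a := by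
    have := Real.sq_sqrt (show 0 ≤ (((d : ℝ) - 2) / 2) ^ 2 + a by linarith)
    unfold rho
    nlinarith
  have e : ∀ c : ℝ, ∫ x : Space d, ((c / ‖x‖ ^ 2 : ℝ) : ℂ) * g x =
      (c : ℂ) * ∫ x : Space d, ((1 / ‖x‖ ^ 2 : ℝ) : ℂ) * g x := by
    intro c
    rw [← integral_const_mul]
    congr 1; ext x; push_cast; ring
  rw [e (rho d a ^ 2), e ((d : ℝ) - 2), e a]
  have hr' : (a : ℂ) = (rho d a : ℂ) ^ 2 - (rho d a : ℂ) * ((d : ℂ) - 2) := by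
    exact_mod_cast hr.symm
  rw [hr']; push_cast; ring



section abstract_form
variable {V H K : Type*} [AddCommGroup V] [Module ℂ V]
  [NormedAddCommGroup H] [InnerProductSpace ℂ H] [CompleteSpace H]
  [NormedAddCommGroup K] [InnerProductSpace ℂ K] [CompleteSpace K]

/-- The Friedrichs graph for an abstract form `⟨Dφ, Dψ⟩`. -/
def AGraph (j : V →ₗ[ℂ] H) (D : V →ₗ[ℂ] K) (f h : H) : Prop :=
  ∃ φ : ℕ → V, Tendsto (fun n => j (φ n)) atTop (𝓝 f) ∧
    Tendsto (fun p : ℕ × ℕ => inner ℂ (D (φ p.1 - φ p.2)) (D (φ p.1 - φ p.2))) atTop (𝓝 0) ∧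
    ∀ ψ, Tendsto (fun n => inner ℂ (D ψ) (D (φ n))) atTop (𝓝 (inner ℂ (j ψ) h))

/-- `φ ↦ (j φ, D φ)`. -/
def graphMap (j : V →ₗ[ℂ] H) (D : V →ₗ[ℂ] K) : V →ₗ[ℂ] WithLp 2 (H × K) :=
  (WithLp.linearEquiv 2 ℂ (H × K)).symm.toLinearMap ∘ₗ j.prod D

/-- The closed graph. -/
def graphCl (j : V →ₗ[ℂ] H) (D : V →ₗ[ℂ] K) : Submodule ℂ (WithLp 2 (H × K)) :=
  (LinearMap.range (graphMap j D)).topologicalClosure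

instance (j : V →ₗ[ℂ] H) (D : V →ₗ[ℂ] K) : CompleteSpace (graphCl j D) :=
  (Submodule.isClosed_topologicalClosure _).completeSpace_coe

/-- `f ↦ (f, 0)`. -/
def inlC : H →L[ℂ] WithLp 2 (H × K) :=
  (WithLp.prodContinuousLinearEquiv 2 ℂ H K).symm.toContinuousLinearMap ∘L
    ContinuousLinearMap.inl ℂ H K

/-- The first component of the projection of `(f, 0)` onto the closed graph. -/
def aRes (j : V →ₗ[ℂ] H) (D : V →ₗ[ℂ] K) : H →L[ℂ] H :=
  ContinuousLinearMap.fst ℂ H K ∘L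
    (WithLp.prodContinuousLinearEquiv 2 ℂ H K).toContinuousLinearMap ∘L
    (graphCl j D).starProjection ∘L inlC

theorem inner_inlC (w : WithLp 2 (H × K)) (g : H) :
    inner ℂ w (inlC g) = inner ℂ w.fst g := by
  simp [inlC, WithLp.prod_inner_apply]

theorem inner_inlC' (w : WithLp 2 (H × K)) (g : H) :
    inner ℂ (inlC g) w = inner ℂ g w.fst := by
  simp [inlC, WithLp.prod_inner_apply]

theorem aRes_apply (j : V →ₗ[ℂ] H) (D : V →ₗ[ℂ] K) (f : H) :
    aRes j D f = ((graphCl j D).starProjection (inlC f)).fst := rfl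

theorem aRes_symm (j : V →ₗ[ℂ] H) (D : V →ₗ[ℂ] K) (f g : H) :
    inner ℂ (aRes j D f) g = inner ℂ f (aRes j D g) := by
  rw [aRes_apply, aRes_apply, ← inner_inlC, ← inner_inlC',
    Submodule.inner_starProjection_left_eq_right]


theorem aRes_pos (j : V →ₗ[ℂ] H) (D : V →ₗ[ℂ] K) : 0 ≤ aRes j D := by
  rw [ContinuousLinearMap.nonneg_iff_isPositive, ContinuousLinearMap.isPositive_iff]
  refine ⟨fun f g => aRes_symm j D f g, fun f => ?_⟩
  rw [aRes_apply, ← inner_inlC]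
  rw [← aux_pos]
  exact Complex.zero_le_real.2 (sq_nonneg _)
where
  aux_pos {f : H} : ((‖(graphCl j D).starProjection (inlC f)‖ ^ 2 : ℝ) : ℂ) =
      inner ℂ ((graphCl j D).starProjection (inlC f)) (inlC f : WithLp 2 (H × K)) := by
    have h := Submodule.starProjection_inner_eq_zero (K := graphCl j D) (inlC f)
      ((graphCl j D).starProjection (inlC f)) (Submodule.starProjection_apply_mem _ _)
    have h2 := inner_eq_zero_symm.1 h
    rw [inner_sub_right, sub_eq_zero] at h2
    rw [h2, inner_self_eq_norm_sq_to_K]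
    push_cast; rfl

theorem aRes_norm (j : V →ₗ[ℂ] H) (D : V →ₗ[ℂ] K) : ‖aRes j D‖ ≤ 1 := by
  refine ContinuousLinearMap.opNorm_le_bound _ zero_le_one fun f => ?_
  rw [aRes_apply, one_mul]
  calc _ ≤ ‖(graphCl j D).starProjection (inlC f)‖ := WithLp.norm_fst_le _ _
    _ ≤ ‖(inlC f : WithLp 2 (H × K))‖ := Submodule.norm_starProjection_apply_le _ _
    _ = ‖f‖ := by simp [inlC]

theorem mem_graphCl_seq (j : V →ₗ[ℂ] H) (D : V →ₗ[ℂ] K) (w : WithLp 2 (H × K)) :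
    w ∈ graphCl j D ↔ ∃ φ : ℕ → V, Tendsto (fun n => j (φ n)) atTop (𝓝 w.fst) ∧
      Tendsto (fun n => D (φ n)) atTop (𝓝 w.snd) := by
  have e : ∀ φ : ℕ → V, Tendsto (fun n => graphMap j D (φ n)) atTop (𝓝 w) ↔
      Tendsto (fun n => j (φ n)) atTop (𝓝 w.fst) ∧
      Tendsto (fun n => D (φ n)) atTop (𝓝 w.snd) := by
    intro φ
    rw [(WithLp.homeomorphProd 2 H K).isInducing.tendsto_nhds_iff, Prod.tendsto_iff]
    rfl
  constructor
  · intro h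
    obtain ⟨x, hx, hlim⟩ := mem_closure_iff_seq_limit.1 h
    choose φ hφ using hx
    refine ⟨φ, (e φ).1 ?_⟩
    simpa only [hφ] using hlim
  · rintro ⟨φ, h⟩
    exact mem_closure_iff_seq_limit.2 ⟨_, fun n => ⟨φ n, rfl⟩, (e φ).2 h⟩

theorem aRes_orth (j : V →ₗ[ℂ] H) (D : V →ₗ[ℂ] K) (f : H) (ψ : V) :
    inner ℂ (D ψ) ((graphCl j D).starProjection (inlC f)).snd =
      inner ℂ (j ψ) (f - aRes j D f) := by
  have h := Submodule.starProjection_inner_eq_zero (K := graphCl j D) (inlC f) (graphMap j D ψ)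
    (Submodule.le_topologicalClosure _ ⟨ψ, rfl⟩)
  have h2 := inner_eq_zero_symm.1 h
  rw [inner_sub_right, sub_eq_zero, inner_inlC, WithLp.prod_inner_apply] at h2
  rw [inner_sub_right, aRes_apply]
  have : (graphMap j D ψ).fst = j ψ := rfl
  have h3 : (graphMap j D ψ).snd = D ψ := rfl
  change inner ℂ (j ψ) f = inner ℂ (j ψ) _ + inner ℂ (D ψ) _ at h2
  rw [h2]
  exact (add_sub_cancel_left _ _).symm

theorem aGraph_aRes (j : V →ₗ[ℂ] H) (D : V →ₗ[ℂ] K) (f : H) :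
    AGraph j D (aRes j D f) (f - aRes j D f) := by
  obtain ⟨φ, h1, h2⟩ := (mem_graphCl_seq j D _).1
    (Submodule.starProjection_apply_mem (graphCl j D) (inlC f))
  refine ⟨φ, h1, ?_, fun ψ => ?_⟩
  · simp_rw [map_sub]
    have h3 : Tendsto (fun p : ℕ × ℕ => D (φ p.1) - D (φ p.2)) atTop (𝓝 0) := by
      rw [← prod_atTop_atTop_eq, ← sub_self (((graphCl j D).starProjection (inlC f)).snd)]
      exact (h2.comp tendsto_fst).sub (h2.comp tendsto_snd)
    simpa using h3.inner (𝕜 := ℂ) h3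
  · rw [← aRes_orth]
    exact tendsto_const_nhds.inner h2

theorem eq_aRes_of_aGraph (j : V →ₗ[ℂ] H) (D : V →ₗ[ℂ] K) {f h : H} (hg : AGraph j D f h) :
    f = aRes j D (f + h) := by
  obtain ⟨φ, h1, h2, h3⟩ := hg
  have hc : CauchySeq fun n => D (φ n) := by
    rw [Metric.cauchySeq_iff']
    intro ε hε
    rw [← prod_atTop_atTop_eq, Metric.tendsto_nhds] at h2
    have h4 := h2 (ε ^ 2) (by positivity)
    rw [prod_atTop_atTop_eq] at h4
    obtain ⟨⟨N, M⟩, hN⟩ := eventually_atTop.1 h4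
    refine ⟨max N M, fun n hn => ?_⟩
    have h5 := hN (n, max N M) ⟨(le_max_left _ _).trans hn, le_max_right _ _⟩
    rw [inner_self_eq_norm_sq_to_K, dist_zero_right, norm_pow] at h5
    simp only [map_sub, RCLike.norm_ofReal, abs_norm] at h5
    rw [dist_eq_norm]
    simpa using lt_of_pow_lt_pow_left₀ 2 hε.le (by simpa using h5)
  obtain ⟨w, hw⟩ := cauchySeq_tendsto_of_complete hc
  have hmem : (WithLp.toLp 2 (f, w) : WithLp 2 (H × K)) ∈ graphCl j D :=
    (mem_graphCl_seq j D _).2 ⟨φ, h1, hw⟩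
  have horth : ∀ ψ, inner ℂ (D ψ) w = inner ℂ (j ψ) h := fun ψ =>
    tendsto_nhds_unique (tendsto_const_nhds.inner hw) (h3 ψ)
  have hproj : (graphCl j D).starProjection (inlC (f + h)) = WithLp.toLp 2 (f, w) := by
    refine Submodule.eq_starProjection_of_mem_of_inner_eq_zero hmem fun x hx => ?_
    obtain ⟨χ, k1, k2⟩ := (mem_graphCl_seq j D _).1 hx
    have : inner ℂ x (inlC (f + h) - WithLp.toLp 2 (f, w) : WithLp 2 (H × K)) =
        inner ℂ x.fst h - inner ℂ x.snd w := by
      rw [inner_sub_right, inner_inlC, WithLp.prod_inner_apply, inner_add_right]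
      change _ - (inner ℂ x.fst f + inner ℂ x.snd w) = _
      ring
    rw [← inner_eq_zero_symm, this, sub_eq_zero]
    have l1 := k1.inner (𝕜 := ℂ) (tendsto_const_nhds (x := h))
    have l2 := k2.inner (𝕜 := ℂ) (tendsto_const_nhds (x := w))
    simp_rw [horth] at l2
    exact tendsto_nhds_unique l1 l2
  rw [aRes_apply, hproj]
  rfl

theorem aRes_injective (j : V →ₗ[ℂ] H) (D : V →ₗ[ℂ] K)
    (hj : ∀ f : H, (∀ ψ, inner ℂ (j ψ) f = 0) → f = 0) (f : H) (hf : aRes j D f = 0) : f = 0 := by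
  obtain ⟨φ, h1, h2⟩ := (mem_graphCl_seq j D _).1
    (Submodule.starProjection_apply_mem (graphCl j D) (inlC f))
  have ho := aRes_orth j D f
  rw [← aRes_apply, hf] at h1
  simp_rw [hf, sub_zero] at ho
  set w := ((graphCl j D).starProjection (inlC f)).snd with hw
  have l1 := h2.inner (𝕜 := ℂ) (tendsto_const_nhds (x := w))
  simp_rw [ho] at l1
  have l2 := h1.inner (𝕜 := ℂ) (tendsto_const_nhds (x := f))
  have h3 := tendsto_nhds_unique l1 l2
  rw [inner_zero_left, inner_self_eq_zero] at h3
  refine hj f fun ψ => ?_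
  rw [← ho, h3, inner_zero_right]

end abstract_form


section abstract_group
variable {H : Type*} [NormedAddCommGroup H] [InnerProductSpace ℂ H] [CompleteSpace H]

/-- The symbol `s e^{-it(1/s-1)}`. -/
def sym (t : ℝ) (z : ℂ) : ℂ := (z.re : ℂ) * Complex.exp (((-t * (z.re⁻¹ - 1) : ℝ) : ℂ) * Complex.I)

theorem norm_sym (t : ℝ) (z : ℂ) : ‖sym t z‖ = |z.re| := by
  rw [sym, norm_mul, Complex.norm_exp_ofReal_mul_I, mul_one, Complex.norm_real, Real.norm_eq_abs]

theorem continuous_sym (t : ℝ) : Continuous (sym t) := by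
  rw [continuous_iff_continuousAt]
  intro z
  by_cases hz : z.re = 0
  · have h0 : sym t z = 0 := by simp [sym, hz]
    rw [ContinuousAt, h0, tendsto_zero_iff_norm_tendsto_zero]
    simp_rw [norm_sym]
    have : Continuous fun z : ℂ => |z.re| := by fun_prop
    simpa [hz] using this.tendsto z
  · unfold sym
    fun_prop (disch := assumption)

variable (R : H →L[ℂ] H)

theorem spec_R (hpos : 0 ≤ R) (hn : ‖R‖ ≤ 1) {z : ℂ} (hz : z ∈ spectrum ℂ R) :
    z = (z.re : ℂ) ∧ 0 ≤ z.re ∧ z.re ≤ 1 := by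
  have hsa : IsSelfAdjoint R := .of_nonneg hpos
  have h1 := hsa.mem_spectrum_eq_re hz
  refine ⟨h1, ?_, ?_⟩
  · have : z.re ∈ spectrum ℝ R := by
      rw [← spectrum.algebraMap_mem_iff ℂ]
      change ((z.re : ℂ)) ∈ _
      rw [← h1]; exact hz
    exact spectrum_nonneg_of_nonneg hpos this
  · rcases subsingleton_or_nontrivial H with hs | hs
    · have : Subsingleton (H →L[ℂ] H) := inferInstance
      rw [spectrum.of_subsingleton] at hz
      exact absurd hz (Set.notMem_empty _)
    · exact (Complex.re_le_norm z).trans ((spectrum.norm_le_norm_of_mem hz).trans hn)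

/-- The operator `R e^{-it(1/R - 1)}`. -/
def W (t : ℝ) : H →L[ℂ] H := cfc (sym t) R

variable {R}

theorem star_W_mul (hpos : 0 ≤ R) (hn : ‖R‖ ≤ 1) (t : ℝ) : star (W R t) * W R t = R * R := by
  have hsn : IsStarNormal R := (IsSelfAdjoint.of_nonneg hpos).isStarNormal
  have hR : R = cfc (fun z : ℂ => z) R := (cfc_id' ℂ R).symm
  rw [W, ← cfc_star, ← cfc_mul (fun x => star (sym t x)) _ R ((continuous_star.comp (continuous_sym t)).continuousOn)
    (continuous_sym t).continuousOn]
  conv_rhs => rw [hR, ← cfc_mul (fun z : ℂ => z) (fun z => z) R continuous_id.continuousOn continuous_id.continuousOn]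
  refine cfc_congr fun z hz => ?_
  obtain ⟨h1, h2, h3⟩ := spec_R R hpos hn hz
  have : star (sym t z) * sym t z = ((‖sym t z‖ ^ 2 : ℝ) : ℂ) := by
    rw [← Complex.normSq_eq_norm_sq, Complex.normSq_eq_conj_mul_self]; rfl
  rw [this, norm_sym, sq_abs]
  conv_rhs => rw [h1]
  push_cast; ring

theorem norm_W (hpos : 0 ≤ R) (hn : ‖R‖ ≤ 1) (t : ℝ) (g : H) : ‖W R t g‖ = ‖R g‖ := by
  have hsa : IsSelfAdjoint R := .of_nonneg hpos
  have h := congrArg (fun T : H →L[ℂ] H => inner ℂ (T g) g) (star_W_mul hpos hn t)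
  simp only [mul_apply_eq_comp, ContinuousLinearMap.star_eq_adjoint,
    ContinuousLinearMap.adjoint_inner_left] at h
  have h2 : inner ℂ (R (R g)) g = inner ℂ (R g) (R g) := by
    rw [← ContinuousLinearMap.adjoint_inner_right, ← ContinuousLinearMap.star_eq_adjoint, hsa.star_eq]
  rw [h2, inner_self_eq_norm_sq_to_K, inner_self_eq_norm_sq_to_K] at h
  have h3 : ‖W R t g‖ ^ 2 = ‖R g‖ ^ 2 := by exact_mod_cast h
  exact (sq_eq_sq₀ (norm_nonneg _) (norm_nonneg _)).1 h3

theorem W_zero (hpos : 0 ≤ R) (hn : ‖R‖ ≤ 1) : W R 0 = R := by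
  have hsn : IsStarNormal R := (IsSelfAdjoint.of_nonneg hpos).isStarNormal
  conv_rhs => rw [← cfc_id' ℂ R]
  refine cfc_congr fun z hz => ?_
  simp [sym, (spec_R R hpos hn hz).1.symm]

theorem W_comm (hpos : 0 ≤ R) (t : ℝ) : W R t * R = R * W R t := by
  have hsn : IsStarNormal R := (IsSelfAdjoint.of_nonneg hpos).isStarNormal
  have := cfc_commute_cfc (sym t) (fun z : ℂ => z) R
  rw [cfc_id' ℂ R] at this
  exact this

theorem W_mul (hpos : 0 ≤ R) (hn : ‖R‖ ≤ 1) (s t : ℝ) : W R s * W R t = W R (s + t) * R := by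
  have hsn : IsStarNormal R := (IsSelfAdjoint.of_nonneg hpos).isStarNormal
  have h : W R (s + t) * R = W R (s + t) * cfc (fun z : ℂ => z) R := by rw [cfc_id' ℂ R]
  rw [h, W, W, W, ← cfc_mul _ _ R (continuous_sym s).continuousOn (continuous_sym t).continuousOn,
    ← cfc_mul _ (fun z : ℂ => z) R (continuous_sym _).continuousOn continuous_id.continuousOn]
  refine cfc_congr fun z hz => ?_
  obtain ⟨h1, -, -⟩ := spec_R R hpos hn hz
  have e : sym (s + t) z * z = sym (s + t) z * (z.re : ℂ) := by rw [← h1]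
  rw [e]
  simp only [sym]
  have : Complex.exp (((-(s + t) * (z.re⁻¹ - 1) : ℝ) : ℂ) * Complex.I) =
      Complex.exp (((-s * (z.re⁻¹ - 1) : ℝ) : ℂ) * Complex.I) *
      Complex.exp (((-t * (z.re⁻¹ - 1) : ℝ) : ℂ) * Complex.I) := by
    rw [← Complex.exp_add]; congr 1; push_cast; ring
  rw [this]; ring

theorem exp_sub_one_le (y : ℝ) : ‖Complex.exp ((y : ℂ) * Complex.I) - 1‖ ≤ |y| := by
  have := Real.norm_exp_I_mul_ofReal_sub_one_le (x := y)
  rwa [mul_comm, Real.norm_eq_abs] at this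

theorem norm_W_sub (hpos : 0 ≤ R) (hn : ‖R‖ ≤ 1) (s t : ℝ) : ‖W R t - W R s‖ ≤ |t - s| := by
  have hsn : IsStarNormal R := (IsSelfAdjoint.of_nonneg hpos).isStarNormal
  rw [W, W, ← cfc_sub _ _ R (continuous_sym t).continuousOn (continuous_sym s).continuousOn]
  refine norm_cfc_le (abs_nonneg _) fun z hz => ?_
  obtain ⟨h1, h2, h3⟩ := spec_R R hpos hn hz
  have e : sym t z - sym s z = sym s z *
      (Complex.exp (((-(t - s) * (z.re⁻¹ - 1) : ℝ) : ℂ) * Complex.I) - 1) := by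
    simp only [sym]
    have : Complex.exp (((-t * (z.re⁻¹ - 1) : ℝ) : ℂ) * Complex.I) =
        Complex.exp (((-s * (z.re⁻¹ - 1) : ℝ) : ℂ) * Complex.I) *
        Complex.exp (((-(t - s) * (z.re⁻¹ - 1) : ℝ) : ℂ) * Complex.I) := by
      rw [← Complex.exp_add]; congr 1; push_cast; ring
    rw [this]; ring
  rw [e, norm_mul, norm_sym]
  calc _ ≤ |z.re| * |(-(t - s) * (z.re⁻¹ - 1))| := by gcongr; exact exp_sub_one_le _
    _ = |t - s| * |z.re * (z.re⁻¹ - 1)| := by rw [abs_mul, abs_mul, abs_neg]; ring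
    _ ≤ |t - s| * 1 := by
      gcongr
      by_cases h0 : z.re = 0
      · simp [h0]
      · rw [mul_sub, mul_inv_cancel₀ h0, abs_le]; constructor <;> linarith
    _ = _ := mul_one _


theorem exp_taylor (y : ℝ) :
    ‖Complex.exp ((y : ℂ) * Complex.I) - 1 - (y : ℂ) * Complex.I‖ ≤ 2 * y ^ 2 := by
  by_cases hy : |y| ≤ 1
  · have := Complex.norm_exp_sub_one_sub_id_le (x := (y : ℂ) * Complex.I) (by simpa using hy)
    have h2 : ‖(y : ℂ) * Complex.I‖ ^ 2 = y ^ 2 := by simp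
    rw [h2] at this
    nlinarith [sq_nonneg y]
  · push Not at hy
    have h1 : ‖Complex.exp ((y : ℂ) * Complex.I) - 1 - (y : ℂ) * Complex.I‖ ≤ |y| + |y| :=
      (norm_sub_le _ _).trans (add_le_add (exp_sub_one_le y) (by simp))
    nlinarith [sq_abs y]

theorem W_taylor (hpos : 0 ≤ R) (hn : ‖R‖ ≤ 1) (t : ℝ) :
    ‖(W R t - R + (Complex.I * t) • (1 - R)) * R‖ ≤ 2 * t ^ 2 := by
  have hsn : IsStarNormal R := (IsSelfAdjoint.of_nonneg hpos).isStarNormal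
  have c1 := continuous_sym t
  have e : (W R t - R + (Complex.I * t) • (1 - R)) * R =
      cfc (fun z : ℂ => (sym t z - z + (Complex.I * t) * (1 - z)) * z) R := by
    rw [cfc_mul (fun z : ℂ => (sym t z - z + (Complex.I * t) * (1 - z))) (fun z => z) R
        (by fun_prop) (by fun_prop),
      cfc_add _ (fun z : ℂ => sym t z - z) _ (by fun_prop) (by fun_prop),
      cfc_sub _ _ _ (by fun_prop) (by fun_prop),
      cfc_const_mul _ _ _ (by fun_prop),
      cfc_sub _ _ _ (by fun_prop) (by fun_prop), cfc_id' ℂ R, cfc_const_one ℂ R, W]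
  rw [e]
  refine norm_cfc_le (by positivity) fun z hz => ?_
  obtain ⟨h1, h2, h3⟩ := spec_R R hpos hn hz
  by_cases h0 : z.re = 0
  · have : z = 0 := by rw [h1, h0]; simp
    simp [this]; positivity
  set y : ℝ := -t * (z.re⁻¹ - 1) with hy
  have hzy : z.re * y = -t * (1 - z.re) := by rw [hy]; field_simp
  have e2 : (sym t z - z + (Complex.I * t) * (1 - z)) * z =
      (z.re : ℂ) ^ 2 * (Complex.exp ((y : ℂ) * Complex.I) - 1 - (y : ℂ) * Complex.I) := by
    have hzc : (z.re : ℂ) * (y : ℂ) = -t * (1 - z.re) := by exact_mod_cast hzy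
    have : sym t z = (z.re : ℂ) * Complex.exp ((y : ℂ) * Complex.I) := rfl
    rw [this]
    rw [h1]
    simp only [Complex.ofReal_re]
    linear_combination ((z.re : ℂ) * Complex.I) * hzc
  rw [e2, norm_mul]
  calc _ ≤ z.re ^ 2 * (2 * y ^ 2) := by
        gcongr
        · simp
        · exact exp_taylor y
    _ = 2 * (z.re * y) ^ 2 := by ring
    _ = 2 * t ^ 2 * (1 - z.re) ^ 2 := by rw [hzy]; ring
    _ ≤ 2 * t ^ 2 * 1 := by gcongr; nlinarith
    _ = _ := mul_one _

theorem hasDerivAt_W (hpos : 0 ≤ R) (hn : ‖R‖ ≤ 1) (hd : DenseRange R) (g : H) :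
    HasDerivAt (fun t => W R t g) (-(Complex.I • (g - R g))) 0 := by
  have hW0 := W_zero hpos hn
  rw [hasDerivAt_iff_isLittleO, Asymptotics.isLittleO_iff]
  intro ε hε
  obtain ⟨_, hk, ⟨k, rfl⟩⟩ := Metric.dense_iff.1 hd g (ε / 6) (by positivity)
  have hk' : ‖g - R k‖ ≤ ε / 6 := by
    rw [← dist_eq_norm, dist_comm]; exact le_of_lt (Metric.mem_ball.1 hk)
  set T : ℝ → H →L[ℂ] H := fun t => W R t - R + (Complex.I * t) • (1 - R) with hT
  have hTn : ∀ t, ‖T t‖ ≤ 3 * |t| := by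
    intro t
    have a1 : ‖W R t - R‖ ≤ |t| := by simpa [hW0] using norm_W_sub hpos hn 0 t
    have a2 : ‖(1 : H →L[ℂ] H) - R‖ ≤ 2 :=
      (norm_sub_le _ _).trans (by linarith [ContinuousLinearMap.norm_id_le (𝕜 := ℂ) (E := H),
        show ‖(1 : H →L[ℂ] H)‖ ≤ 1 from ContinuousLinearMap.norm_id_le])
    calc _ ≤ ‖W R t - R‖ + ‖(Complex.I * t) • ((1 : H →L[ℂ] H) - R)‖ := norm_add_le _ _
      _ ≤ |t| + |t| * 2 := by
        gcongr
        rw [norm_smul]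
        have : ‖Complex.I * (t : ℂ)‖ = |t| := by simp
        rw [this]; gcongr
      _ = _ := by ring
  have hball : ∀ᶠ t : ℝ in 𝓝 0, |t| * (2 * ‖k‖) < ε / 2 := by
    have : Tendsto (fun t : ℝ => |t| * (2 * ‖k‖)) (𝓝 0) (𝓝 (|0| * (2 * ‖k‖))) :=
      (continuous_abs.mul continuous_const).tendsto 0
    rw [abs_zero, zero_mul] at this
    exact this.eventually_lt_const (by positivity)
  filter_upwards [hball] with t ht
  have e : W R t g - W R 0 g - (t - 0) • (-(Complex.I • (g - R g))) = T t (g - R k) + (T t * R) k := by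
    rw [mul_apply_eq_comp, ← map_add, sub_add_cancel, hW0, hT]
    simp only [add_apply, sub_apply, smul_apply, one_apply_eq_self, sub_zero, smul_neg, sub_neg_eq_add]
    congr 1
    rw [← Complex.coe_smul, smul_smul, mul_comm]
  rw [e]
  calc _ ≤ ‖T t (g - R k)‖ + ‖(T t * R) k‖ := norm_add_le _ _
    _ ≤ (3 * |t|) * (ε / 6) + (2 * t ^ 2) * ‖k‖ := by
      gcongr
      · exact (ContinuousLinearMap.le_opNorm _ _).trans (by gcongr; exact hTn t)
      · exact (ContinuousLinearMap.le_opNorm _ _).trans (by gcongr; exact W_taylor hpos hn t)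
    _ = ε / 2 * |t| + |t| * (|t| * (2 * ‖k‖)) := by rw [← sq_abs t]; ring
    _ ≤ ε / 2 * |t| + |t| * (ε / 2) := by gcongr
    _ = ε * ‖t - 0‖ := by rw [sub_zero, Real.norm_eq_abs]; ring

theorem exists_group (hpos : 0 ≤ R) (hn : ‖R‖ ≤ 1) (hinj : ∀ f, R f = 0 → f = 0) :
    ∃ U : ℝ → H →L[ℂ] H, U 0 = 1 ∧ (∀ s t, U (s + t) = U s * U t) ∧ (∀ t f, ‖U t f‖ = ‖f‖) ∧
      (∀ f, Continuous fun t => U t f) ∧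
      ∀ f h, f = R (f + h) → HasDerivAt (fun t => U t f) (-(Complex.I • h)) 0 := by
  have hsa : IsSelfAdjoint R := .of_nonneg hpos
  have hd : DenseRange R := by
    have : (LinearMap.range (R : H →ₗ[ℂ] H)).topologicalClosure = ⊤ := by
      rw [Submodule.topologicalClosure_eq_top_iff, Submodule.eq_bot_iff]
      intro x hx
      refine hinj x (ext_inner_left ℂ fun y => ?_)
      rw [inner_zero_right, ← ContinuousLinearMap.adjoint_inner_left,
        ← ContinuousLinearMap.star_eq_adjoint, hsa.star_eq]
      exact (Submodule.mem_orthogonal _ _).1 hx _ ⟨y, rfl⟩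
    rw [DenseRange, dense_iff_closure_eq]
    have h2 := congrArg (fun S : Submodule ℂ H => (S : Set H)) this
    exact h2
  have hinj' : Function.Injective (R : H →ₗ[ℂ] H) := by
    rw [injective_iff_map_eq_zero]; exact hinj
  let S := LinearMap.range (R : H →ₗ[ℂ] H)
  let e := LinearEquiv.ofInjective (R : H →ₗ[ℂ] H) hinj'
  have he : ∀ y : S, R (e.symm y) = y := fun y => congrArg Subtype.val (e.apply_symm_apply y)
  let f : ℝ → S →L[ℂ] H := fun t =>
    LinearMap.mkContinuous ((W R t : H →ₗ[ℂ] H) ∘ₗ e.symm.toLinearMap) 1 fun y => by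
      have : ‖W R t (e.symm y)‖ = ‖y‖ := by rw [norm_W hpos hn, he]; rfl
      simp [this]
  have hdS : DenseRange S.subtypeL := by
    have : Set.range S.subtypeL = Set.range R := by ext; simp [S]
    rw [DenseRange, this]; exact hd
  have hui : IsUniformInducing S.subtypeL := isUniformInducing_val _
  let U : ℝ → H →L[ℂ] H := fun t => (f t).extend S.subtypeL
  have hU : ∀ t g, U t (R g) = W R t g := by
    intro t g
    have h1 := (f t).extend_eq hdS hui (e g)
    have h2 : S.subtypeL (e g) = R g := rfl
    rw [h2] at h1
    rw [h1]
    simp [f]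
  have hU2 : ∀ t, Continuous (U t) := fun t => (U t).continuous
  have hnorm : ∀ t f, ‖U t f‖ = ‖f‖ := by
    intro t
    refine fun f => hd.induction_on (p := fun f => ‖U t f‖ = ‖f‖) f
      (isClosed_eq (hU2 t).norm continuous_norm) fun g => ?_
    rw [hU, norm_W hpos hn]
  refine ⟨U, ?_, ?_, hnorm, ?_, ?_⟩
  · ext f
    refine hd.induction_on (p := fun f => U 0 f = (1 : H →L[ℂ] H) f) f
      (isClosed_eq (hU2 0) continuous_id) fun g => ?_
    rw [hU, W_zero hpos hn]; rfl
  · intro s t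
    ext f
    have hc : Continuous (U s * U t) := (U s * U t).continuous
    have hRk : ∀ k, U (s + t) (R (R k)) = (U s * U t) (R (R k)) := by
      intro k
      have c1 : W R t (R k) = R (W R t k) := congrArg (fun T : H →L[ℂ] H => T k) (W_comm hpos t)
      have c2 : W R s (W R t k) = W R (s + t) (R k) :=
        congrArg (fun T : H →L[ℂ] H => T k) (W_mul hpos hn s t)
      change _ = U s (U t (R (R k)))
      rw [hU, hU, c1, hU, c2]
    refine hd.induction_on (p := fun f => U (s + t) f = (U s * U t) f) f
      (isClosed_eq (hU2 _) hc) fun g => ?_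
    exact hd.induction_on (p := fun g => U (s + t) (R g) = (U s * U t) (R g)) g
      (isClosed_eq ((hU2 _).comp R.continuous) (hc.comp R.continuous)) hRk
  · intro f
    rw [Metric.continuous_iff]
    intro s ε hε
    obtain ⟨_, hk, ⟨k, rfl⟩⟩ := Metric.dense_iff.1 hd f (ε / 3) (by positivity)
    have hk' : ‖f - R k‖ < ε / 3 := by
      rw [← dist_eq_norm, dist_comm]; exact Metric.mem_ball.1 hk
    refine ⟨ε / 3 / (‖k‖ + 1), by positivity, fun t ht => ?_⟩
    have e : U t f - U s f = U t (f - R k) + (W R t - W R s) k - U s (f - R k) := by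
      simp only [map_sub, hU, sub_apply]; abel
    rw [dist_eq_norm, e]
    have b : ‖(W R t - W R s) k‖ < ε / 3 := by
      refine ((W R t - W R s).le_opNorm k).trans_lt ?_
      rw [Real.dist_eq, lt_div_iff₀ (by positivity)] at ht
      calc _ ≤ |t - s| * ‖k‖ := by gcongr; exact norm_W_sub hpos hn s t
        _ ≤ |t - s| * (‖k‖ + 1) := by gcongr; linarith
        _ < _ := ht
    calc _ ≤ ‖U t (f - R k)‖ + ‖(W R t - W R s) k‖ + ‖U s (f - R k)‖ :=
        (norm_sub_le _ _).trans (by gcongr; exact norm_add_le _ _)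
      _ < ε := by rw [hnorm, hnorm]; linarith
  · intro f h hf
    have h2 : f = R (f + h) := hf
    have := hasDerivAt_W hpos hn hd (f + h)
    rw [← h2, add_sub_cancel_left] at this
    refine this.congr_of_eventuallyEq (Eventually.of_forall fun t => ?_)
    change U t f = W R t (f + h)
    rw [← hU, ← h2]

end abstract_group

section concrete

/-- The inclusion of test functions into `L²`. -/
def jMap (d : ℕ) : PTest d →ₗ[ℂ] L2 d where
  toFun φ := (ptest_memLp φ).toLp φ
  map_add' φ ψ := (ptest_memLp φ).toLp_add (ptest_memLp ψ)
  map_smul' c φ := MemLp.toLp_const_smul c (ptest_memLp φ)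

theorem pd_add (φ ψ : PTest d) (i : Fin d) (x : Space d) :
    pd i ⇑(φ + ψ) x = pd i φ x + pd i ψ x := by
  have h := fderiv_add ((ptest_smooth φ).differentiable (by simp) x)
    ((ptest_smooth ψ).differentiable (by simp) x)
  have h2 : (⇑(φ + ψ) : Space d → ℂ) = ⇑φ + ⇑ψ := rfl
  simp [pd, h2, h]

theorem pd_smul (c : ℂ) (φ : PTest d) (i : Fin d) (x : Space d) :
    pd i ⇑(c • φ) x = c * pd i φ x := by
  have h := fderiv_const_smul ((ptest_smooth φ).differentiable (by simp) x) c
  have h2 : (⇑(c • φ) : Space d → ℂ) = c • ⇑φ := rfl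
  simp [pd, h2, h]

theorem dop_add (a : ℝ) (φ ψ : PTest d) : dop a ⇑(φ + ψ) = dop a φ + dop a ψ := by
  ext x i
  have : (φ + ψ) x = φ x + ψ x := rfl
  simp only [dop, pd_add, this, Pi.add_apply, PiLp.add_apply]
  ring

theorem dop_smul (a : ℝ) (c : ℂ) (φ : PTest d) : dop a ⇑(c • φ) = c • dop a φ := by
  ext x i
  have : (c • φ) x = c * φ x := rfl
  simp only [dop, pd_smul, this, Pi.smul_apply, PiLp.smul_apply, smul_eq_mul]
  ring

/-- The operator `D` with values in `L²`. -/
def dMap (d : ℕ) (a : ℝ) : PTest d →ₗ[ℂ] L2Vec d where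
  toFun φ := (dop_memLp a φ).toLp _
  map_add' φ ψ := by
    rw [← MemLp.toLp_add]; congr 1; exact dop_add a φ ψ
  map_smul' c φ := by
    rw [RingHom.id_apply, ← MemLp.toLp_const_smul]; congr 1; exact dop_smul a c φ

theorem inner_dMap {a : ℝ} (ha : -(((d : ℝ) - 2) / 2) ^ 2 ≤ a) (φ ψ : PTest d) :
    inner ℂ (dMap d a φ) (dMap d a ψ) = sesqForm a φ ψ := by
  rw [← dop_inner ha, MeasureTheory.L2.inner_def]
  refine integral_congr_ae ?_
  filter_upwards [(dop_memLp a φ).coeFn_toLp, (dop_memLp a ψ).coeFn_toLp] with x h1 h2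
  simp [dMap, h1, h2]

theorem inner_jMap (ψ : PTest d) (h : L2 d) :
    inner ℂ (jMap d ψ) h = ∫ x, inner ℂ (ψ x) (h x) := by
  rw [MeasureTheory.L2.inner_def]
  refine integral_congr_ae ?_
  filter_upwards [(ptest_memLp ψ).coeFn_toLp] with x h1
  simp only [jMap, LinearMap.coe_mk, AddHom.coe_mk, h1]

theorem friedrichsGraph_iff {a : ℝ} (ha : -(((d : ℝ) - 2) / 2) ^ 2 ≤ a) (f h : L2 d) :
    FriedrichsGraph a f h ↔ AGraph (jMap d) (dMap d a) f h := by
  unfold FriedrichsGraph AGraph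
  simp_rw [inner_dMap ha, inner_jMap]
  refine exists_congr fun φ => and_congr_left fun _ => ?_
  have h := Lp.tendsto_Lp_iff_tendsto_eLpNorm'' (fi := atTop) (fun n => ⇑(φ n))
    (fun n => ptest_memLp (φ n)) f (Lp.memLp f)
  rw [Lp.toLp_coeFn] at h
  exact h.symm

theorem jMap_dense (hd : 1 ≤ d) (f : L2 d) (hf : ∀ ψ, inner ℂ (jMap d ψ) f = 0) : f = 0 := by
  have : Nontrivial (Space d) := by
    have : Nonempty (Fin d) := ⟨⟨0, hd⟩⟩
    infer_instance
  have h1 : ∀ᵐ x ∂(volume : Measure (Space d)), x ∈ ({0}ᶜ : Set (Space d)) → f x = 0 := by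
    refine IsOpen.ae_eq_zero_of_integral_contDiff_smul_eq_zero isOpen_compl_singleton
      (((Lp.memLp f).locallyIntegrable (by norm_num)).locallyIntegrableOn _) fun g hg hgc hgs => ?_
    let ψ : PTest d := ⟨fun x => (g x : ℂ), Complex.ofRealCLM.contDiff.comp hg,
      hgc.comp_left (g := fun r : ℝ => (r : ℂ)) (by simp), 
      (tsupport_comp_subset (g := fun r : ℝ => (r : ℂ)) (by simp) g).trans hgs⟩
    have := hf ψ
    rw [inner_jMap] at this
    rw [← this]
    congr 1; ext x
    have hx : ψ x = (g x : ℂ) := rfl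
    rw [hx, RCLike.inner_apply, Complex.real_smul, mul_comm]
    simp
  have h0 : ∀ᵐ x ∂(volume : Measure (Space d)), x ∈ ({0}ᶜ : Set (Space d)) := by
    exact compl_mem_ae_iff.2 (measure_singleton 0)
  rw [Lp.eq_zero_iff_ae_eq_zero]
  filter_upwards [h0, h1] with x a b using b a

/-- There is exactly one bounded operator `R` with `(1 + L_a) (R f) = f` for all `f`. -/
theorem existsUnique_resolvent {a : ℝ} (ha : -(((d : ℝ) - 2) / 2) ^ 2 ≤ a) :
    ∃! R : L2 d →L[ℂ] L2 d, ∀ f, FriedrichsGraph a (R f) (f - R f) := by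
  refine ⟨aRes (jMap d) (dMap d a), fun f => (friedrichsGraph_iff ha _ _).2 (aGraph_aRes _ _ f),
    fun R hR => ?_⟩
  ext1 f
  have h := eq_aRes_of_aGraph _ _ ((friedrichsGraph_iff ha _ _).1 (hR f))
  rwa [add_sub_cancel] at h

/-- The unitary group generated by `-i L_a` exists. -/
theorem exists_schrodingerGroup (hd : 1 ≤ d) {a : ℝ} (ha : -(((d : ℝ) - 2) / 2) ^ 2 ≤ a) :
    ∃ U : ℝ → L2 d →L[ℂ] L2 d, IsSchrodingerGroup a U := by
  obtain ⟨U, h1, h2, h3, h4, h5⟩ := exists_group (aRes_pos (jMap d) (dMap d a))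
    (aRes_norm _ _) (aRes_injective _ _ (jMap_dense hd))
  exact ⟨U, h1, h2, h3, h4, fun f h hg => h5 f h
    (eq_aRes_of_aGraph _ _ ((friedrichsGraph_iff ha _ _).1 hg))⟩

end concrete

end existence

/-! ### The operators `(1 + L_a)⁻¹`, `(1 + L_a)^{-1/2}` and `e^{-itL_a}` -/

open scoped Classical in
/-- The bounded operator `(1 + L_a)⁻¹` on `L²`, characterised by `(1 + L_a) (R f) = f` for all `f`.
It exists and is unique as soon as `a ≥ -((d-2)/2)²`; the value in the other case is irrelevant. -/
def resolvent (d : ℕ) (a : ℝ) : L2 d →L[ℂ] L2 d :=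
  if h : ∃ R : L2 d →L[ℂ] L2 d, ∀ f, FriedrichsGraph a (R f) (f - R f) then h.choose else 0

/-- The positive square root of a positive operator. -/
def posSqrt {H : Type*} [NormedAddCommGroup H] [InnerProductSpace ℂ H] [CompleteSpace H]
    (T : H →L[ℂ] H) : H →L[ℂ] H := CFC.sqrt T

/-- The bounded operator `(1 + L_a)^{-1/2}` on `L²`. Its range is `H_a^1`, and
`f = (1 + L_a)^{-1/2} g` means `g = (1 + L_a)^{1/2} f`. -/
def invSqrtOp (d : ℕ) (a : ℝ) : L2 d →L[ℂ] L2 d := posSqrt (resolvent d a)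

open scoped Classical in
/-- The Schrödinger group `t ↦ e^{-itL_a}`. It exists as soon as `d ≥ 1` and `a ≥ -((d-2)/2)²`; the
value in the other case is irrelevant. -/
def propagator (d : ℕ) (a : ℝ) : ℝ → L2 d →L[ℂ] L2 d :=
  if h : ∃ U : ℝ → L2 d →L[ℂ] L2 d, IsSchrodingerGroup a U then h.choose else 0

/-! ### Solutions -/

/-- `u` is a solution on the interval `I` of
`(i∂_t - L_a) u = μ |u|^α u`, `u(t₀) = u₀`:
`u ∈ C_t H_a^1 ∩ L_t^2 H_a^{1, 2d/(d-2)}` on every compact subset of `I` (continuity in `H_a^1`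
contains the local boundedness in `H_a^1`), and `u` obeys the Duhamel formula. -/
structure IsSolution {d : ℕ} (a α μ : ℝ) (I : Set ℝ) (t₀ : ℝ) (u₀ : L2 d) (u : ℝ → L2 d) :
    Prop where
  ordConnected : I.OrdConnected
  mem : t₀ ∈ I
  /-- Here `g t = (1 + L_a)^{1/2} u(t)`, so that `‖u(t)‖` in `H_a^{1,r}` is `‖g t‖` in `L^r`. -/
  regular : ∃ g : ℝ → L2 d, (∀ t ∈ I, u t = invSqrtOp d a (g t)) ∧ ContinuousOn g I ∧
    ∀ K ⊆ I, IsCompact K →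
      ∫⁻ t in K, (eLpNorm (g t) (ENNReal.ofReal (2 * d / ((d : ℝ) - 2))) volume) ^ 2 < ⊤
  /-- Here `N s = |u(s)|^α u(s)`, a locally integrable function of `s` with values in `L²`. -/
  duhamel : ∃ N : ℝ → L2 d,
    (∀ᵐ s ∂(volume.restrict I), N s =ᵐ[volume] fun x => ((‖u s x‖ ^ α : ℝ) : ℂ) * u s x) ∧
    ∀ t ∈ I, IntervalIntegrable N volume t₀ t ∧
      u t = propagator d a (t - t₀) u₀ -
        (Complex.I * (μ : ℂ)) • ∫ s in t₀..t, propagator d a (t - s) (N s)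

/-- The norm of `L_{t,x}^q(I × ℝ^d)`, for `0 < q < ∞`. -/
def spaceTimeNorm {d : ℕ} (q : ℝ) (I : Set ℝ) (u : ℝ → L2 d) : ℝ≥0∞ :=
  (∫⁻ t in I, (eLpNorm (u t) (ENNReal.ofReal q) volume) ^ q) ^ (1 / q)

/-! ### The Sobolev space `H¹`, mass, energy and thresholds -/

/-- `F` is the weak gradient of `f`. -/
def IsWeakGrad {d : ℕ} (f : L2 d) (F : L2Vec d) : Prop :=
  ∀ (φ : 𝓓((⊤ : Opens (Space d)), ℂ)) (i : Fin d),
    ∫ x, f x * pd i φ x = - ∫ x, F x i * φ x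

/-- `f` belongs to the Sobolev space `H¹(ℝ^d; ℂ)`. -/
def MemH1 {d : ℕ} (f : L2 d) : Prop := ∃ F : L2Vec d, IsWeakGrad f F

open scoped Classical in
/-- The weak gradient of an `H¹` function (and `0` otherwise). -/
def weakGrad {d : ℕ} (f : L2 d) : L2Vec d := if h : MemH1 f then h.choose else 0

/-- The set `S` is a precompact subset of `H¹(ℝ^d; ℂ)`. Here `H¹` is identified with the (closed)
graph of the weak gradient in `L² × L²`, which carries its topology. -/
def PrecompactH1 {d : ℕ} (S : Set (L2 d)) : Prop :=
  (∀ f ∈ S, MemH1 f) ∧ IsCompact (closure ((fun f => (f, weakGrad f)) '' S))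

/-- The mass `M(f)`. -/
def mass {d : ℕ} (f : L2 d) : ℝ := ∫ x, ‖f x‖ ^ 2

/-- The energy `E_a(f)` of an `H¹` function. -/
def energy {d : ℕ} (a α μ : ℝ) (f : L2 d) : ℝ :=
  ∫ x, (1 / 2 * ‖weakGrad f x‖ ^ 2 + a / (2 * ‖x‖ ^ 2) * ‖f x‖ ^ 2 +
    μ / (α + 2) * ‖f x‖ ^ (α + 2))

/-- The norm of `Ḣ_a^1`, for `H¹` functions: `Q(f)^{1/2} = ‖L_a^{1/2} f‖_{L²}`. -/
def homNorm {d : ℕ} (a : ℝ) (f : L2 d) : ℝ :=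
  √(∫ x, (‖weakGrad f x‖ ^ 2 + a / ‖x‖ ^ 2 * ‖f x‖ ^ 2))

/-- The sharp constant `C_a` in the Gagliardo–Nirenberg inequality
`‖f‖_{L^{α+2}}^{α+2} ≤ C_a ‖f‖_{L²}^{(4-(d-2)α)/2} ‖f‖_{Ḣ_a^1}^{dα/2}`. -/
def sharpGN (d : ℕ) (a α : ℝ) : ℝ :=
  sSup {c : ℝ | ∃ f : L2 d, MemH1 f ∧ f ≠ 0 ∧
    c = (∫ x, ‖f x‖ ^ (α + 2)) /
      (‖f‖ ^ ((4 - ((d : ℝ) - 2) * α) / 2) * homNorm a f ^ (d * α / 2))}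

/-- The threshold `𝓔_a`, in terms of the sharp constant `C_a`. -/
def energyThreshold (d : ℕ) (a α : ℝ) : ℝ :=
  (α * d - 4) * (α * d) ^ (d * α / (4 - d * α)) / (2 * (2 * (α + 2)) ^ (4 / (4 - d * α))) *
    sharpGN d a α ^ (4 / (4 - d * α))

/-- The threshold `𝓚_a`, in terms of the sharp constant `C_a`. -/
def kineticThreshold (d : ℕ) (a α : ℝ) : ℝ :=
  (2 * (α + 2) / (α * d)) ^ (2 / (d * α - 4)) * sharpGN d a α ^ (2 / (4 - d * α))

/-- The standing assumption on the dimension `d`, the coupling constant `a` and the power `α`. -/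
def AdmissibleParams (d : ℕ) (a α : ℝ) : Prop :=
  (d = 3 ∧ 4 / 3 < α ∧ α ≤ 2 ∧ -(((d : ℝ) - 2) / 2) ^ 2 < a) ∨
  (3 ≤ d ∧ d ≤ 6 ∧ max (2 / ((d : ℝ) - 2)) (4 / d) < α ∧ α < 4 / ((d : ℝ) - 2) ∧
    -(((d : ℝ) - 2) / 2) ^ 2 + (((d : ℝ) - 2) / 2 - 1 / α) ^ 2 < a)

/-- `v` is a minimal blowup solution at the energy level `Ec`: a global solution of mass `1` and
energy `Ec` whose scattering norm `L_{t,x}^{q₀}`, `q₀ = α(d+2)/2`, is infinite in both time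
directions, with precompact orbit in `H¹` and, in the focusing case, below the threshold `𝓚_a` at
time `0`. Mass and energy are independent of time along a solution; `M(v)` and `E_a(v)` are their
constant values. -/
structure IsMinimalBlowupSolution {d : ℕ} (a α μ Ec : ℝ) (v : ℝ → L2 d) : Prop where
  solution : IsSolution a α μ Set.univ 0 (v 0) v
  mass_eq : ∀ t, mass (v t) = 1
  energy_eq : ∀ t, energy a α μ (v t) = Ec
  blowup_backward : spaceTimeNorm (α * (d + 2) / 2) (Set.Iio 0) v = ⊤
  blowup_forward : spaceTimeNorm (α * (d + 2) / 2) (Set.Ioi 0) v = ⊤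
  precompact : PrecompactH1 (Set.range v)
  subthreshold : μ = -1 → homNorm a (v 0) < kineticThreshold d a α

end NLSInvSq

end

noncomputable section
namespace NLSInvSq
open MeasureTheory Filter Topology TopologicalSpace
open scoped ENNReal Distributions

/-! ### Pointwise multiplication operators on `L²` -/

section pointwise

variable {X E F : Type*} [MeasurableSpace X] {ν : Measure X}
  [NormedAddCommGroup E] [NormedSpace ℂ E] [NormedAddCommGroup F] [NormedSpace ℂ F]

/-! The proof is a localized virial argument. Write L_a = D*D with D = ∇ + ρ x/|x|², and let A = x·∇
+ d/2 be the generator of the unitary dilations `dil s`. Since L_a scales like the Laplacian,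
formally d/dt Im⟨v, Av⟩ = 2 (‖Dv‖² + μ dα/(2(α+2)) ∫|v|^{α+2}). The bracket is bounded below by some
δ > 0 for all times (`exists_coercive_bound`). In the defocusing case dα > 4 makes it at least twice
the energy. In the focusing case the sharp Gagliardo–Nirenberg inequality, with mass and energy
fixed, traps the kinetic energy strictly below its threshold.

Now put a cutoff χ, equal to 1 on the ball of radius R about the origin, on both sides of A. The
quantity Im⟨χv, A(χv)⟩ is bounded in time. Precompactness of the orbit in H¹ makes the parts of Dv
and of |v|^{α+2} outside a large ball small uniformly in time (`PrecompactH1.exists_uniform_tail`),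
so a single R keeps the localized bracket above δ/2 (`exists_virial_lower_bound`). A bounded
quantity would then grow at least linearly, which is absurd (`PrecompactH1.not_coercive`).

The work lies in justifying the identity for a solution that is only in H¹ and obeys only the
Duhamel formula. First, the H¹ pairs (f, ∇f) are limits of test functions on the punctured space
(`IsWeakGrad.mem_closure`), and Hardy's inequality then places f in the form domain of L_a
(`exists_hardy`). Second, Duhamel's formula yields the equation tested against the form domain
(`Duhamel.weak_form`), hence the evolution of Im⟨v, Cv⟩ for a bounded antisymmetric C that acts on
the form domain (`Duhamel.quadratic`). Third, this is applied to C_s = χ (`dil s` - `dil (-s)`) χ,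
an approximation of 2s χAχ. Because D `dil s` = e^s `dil s` D, the kinetic term can be
differentiated in s although Dv has no further regularity. Dividing by s and letting s → 0 gives
`Duhamel.virial_identity`. The nonlinear term needs no chain rule: Young's inequality bounds the
pairing of |f|^α f with a dilation increment by an explicit function of s, with equality at s = 0,
so the two derivatives agree there (`RealCutoff.re_inner_gen`). -/

theorem memLp_pointwise {T : X → E →L[ℂ] F} (hT : AEStronglyMeasurable T ν) {C : ℝ}
    (hC : ∀ x, ‖T x‖ ≤ C) {f : X → E} {p : ℝ≥0∞} (hf : MemLp f p ν) :
    MemLp (fun x => T x (f x)) p ν := by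
  refine hf.of_le_mul (c := C) ?_ (Eventually.of_forall fun x => ?_)
  · exact isBoundedBilinearMap_apply.continuous.comp_aestronglyMeasurable
      (hT.prodMk hf.aestronglyMeasurable)
  · exact (T x).le_of_opNorm_le (hC x) _

/-- The operator `f ↦ (x ↦ T x (f x))` on `L²`, for a bounded field of operators `T`. -/
def pwOp (T : X → E →L[ℂ] F) (hT : AEStronglyMeasurable T ν) (C : ℝ) (hC : ∀ x, ‖T x‖ ≤ C) :
    Lp E 2 ν →L[ℂ] Lp F 2 ν :=
  LinearMap.mkContinuous
    { toFun := fun f => (memLp_pointwise hT hC (Lp.memLp f)).toLp _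
      map_add' := fun f g => by
        rw [← MemLp.toLp_add, MemLp.toLp_eq_toLp_iff]
        filter_upwards [Lp.coeFn_add f g] with x hx
        change T x ((f + g : Lp E 2 ν) x) = T x (f x) + T x (g x)
        rw [hx, Pi.add_apply, map_add]
      map_smul' := fun c f => by
        rw [RingHom.id_apply, ← MemLp.toLp_const_smul, MemLp.toLp_eq_toLp_iff]
        filter_upwards [Lp.coeFn_smul c f] with x hx
        change T x ((c • f : Lp E 2 ν) x) = c • T x (f x)
        rw [hx, Pi.smul_apply, map_smul] }
    C fun f => by
      refine Lp.norm_le_mul_norm_of_ae_le_mul ?_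
      filter_upwards [(memLp_pointwise hT hC (Lp.memLp f)).coeFn_toLp] with x hx
      change ‖((memLp_pointwise hT hC (Lp.memLp f)).toLp _) x‖ ≤ _
      rw [hx]
      exact (T x).le_of_opNorm_le (hC x) _

theorem pwOp_coeFn {T : X → E →L[ℂ] F} (hT : AEStronglyMeasurable T ν) {C : ℝ}
    (hC : ∀ x, ‖T x‖ ≤ C) (f : Lp E 2 ν) :
    pwOp T hT C hC f =ᵐ[ν] fun x => T x (f x) :=
  (memLp_pointwise hT hC (Lp.memLp f)).coeFn_toLp

end pointwise

/-! ### Dilations -/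

section dilation

variable {d : ℕ} {E : Type*} [NormedAddCommGroup E]

theorem map_smul_volume {c : ℝ} (hc : 0 < c) :
    Measure.map (fun x : Space d => c • x) volume = ENNReal.ofReal ((c ^ d)⁻¹) • volume := by
  rw [Measure.map_addHaar_smul _ hc.ne', abs_of_pos (by positivity), finrank_euclideanSpace,
    Fintype.card_fin]

theorem quasiMeasurePreserving_smul {c : ℝ} (hc : 0 < c) :
    Measure.QuasiMeasurePreserving (fun x : Space d => c • x) volume volume := by
  refine ⟨(measurable_const_smul c), ?_⟩
  rw [map_smul_volume hc]
  exact Measure.smul_absolutelyContinuous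

theorem memLp_comp_smul {c : ℝ} (hc : 0 < c) {f : Space d → E} {p : ℝ≥0∞} (hf : MemLp f p volume) :
    MemLp (fun x => f (c • x)) p volume := by
  have h : MemLp f p (Measure.map (fun x : Space d => c • x) volume) := by
    rw [map_smul_volume hc]
    exact hf.smul_measure ENNReal.ofReal_ne_top
  exact h.comp_of_map (measurable_const_smul c).aemeasurable

theorem eLpNorm_comp_smul {c : ℝ} (hc : 0 < c) {f : Space d → E}
    (hf : AEStronglyMeasurable f volume) :
    eLpNorm (fun x => f (c • x)) 2 volume =
      ENNReal.ofReal ((c ^ d)⁻¹) ^ (1 / 2 : ℝ) * eLpNorm f 2 volume := by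
  have h1 : AEStronglyMeasurable f (Measure.map (fun x : Space d => c • x) volume) := by
    rw [map_smul_volume hc]
    exact hf.smul_measure _
  have h2 := eLpNorm_map_measure (p := 2) h1 (measurable_const_smul c).aemeasurable
  rw [map_smul_volume hc, eLpNorm_smul_measure_of_ne_top (by norm_num)] at h2
  rw [show (fun x => f (c • x)) = f ∘ fun x => c • x from rfl, ← h2]
  simp

variable [NormedSpace ℂ E]

/-- The dilation `f ↦ e^{sd/2} f(e^s ·)` on functions. -/
def dilFun (s : ℝ) (f : Space d → E) (x : Space d) : E :=
  (Real.exp (s * (d / 2)) : ℂ) • f (Real.exp s • x)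

theorem memLp_dilFun (s : ℝ) {f : Space d → E} {p : ℝ≥0∞} (hf : MemLp f p volume) :
    MemLp (dilFun s f) p volume :=
  (memLp_comp_smul (Real.exp_pos s) hf).const_smul _

theorem eLpNorm_dilFun (s : ℝ) {f : Space d → E} (hf : AEStronglyMeasurable f volume) :
    eLpNorm (dilFun s f) 2 volume = eLpNorm f 2 volume := by
  have : dilFun s f = (Real.exp (s * (d / 2)) : ℂ) • fun x => f (Real.exp s • x) := rfl
  rw [this, eLpNorm_const_smul, eLpNorm_comp_smul (Real.exp_pos s) hf, ← mul_assoc]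
  have h1 : ‖(Real.exp (s * (d / 2)) : ℂ)‖ₑ = ENNReal.ofReal (Real.exp (s * (d / 2))) := by
    rw [← ofReal_norm, Complex.norm_real, Real.norm_eq_abs, abs_of_pos (Real.exp_pos _)]
  rw [h1, ENNReal.ofReal_rpow_of_pos (by positivity), ← ENNReal.ofReal_mul (by positivity),
    ← Real.exp_nat_mul, ← Real.exp_neg, ← Real.exp_mul, ← Real.exp_add]
  rw [show s * (d / 2) + -(d * s) * (1 / 2) = 0 by ring]
  simp

theorem dilFun_congr (s : ℝ) {f g : Space d → E} (h : f =ᵐ[volume] g) :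
    dilFun s f =ᵐ[volume] dilFun s g := by
  filter_upwards [(quasiMeasurePreserving_smul (Real.exp_pos s)).ae h] with x hx
  simp only [dilFun, hx]

/-- The unitary dilation `f ↦ e^{sd/2} f(e^s ·)` on `L²`. -/
def dil (s : ℝ) : Lp E 2 (volume : Measure (Space d)) →ₗᵢ[ℂ] Lp E 2 (volume : Measure (Space d)) where
  toFun f := (memLp_dilFun s (Lp.memLp f)).toLp _
  map_add' f g := by
    rw [← MemLp.toLp_add, MemLp.toLp_eq_toLp_iff]
    refine (dilFun_congr s (Lp.coeFn_add f g)).trans (Eventually.of_forall fun x => ?_)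
    simp [dilFun]
  map_smul' c f := by
    rw [RingHom.id_apply, ← MemLp.toLp_const_smul, MemLp.toLp_eq_toLp_iff]
    refine (dilFun_congr s (Lp.coeFn_smul c f)).trans (Eventually.of_forall fun x => ?_)
    simp only [dilFun, Pi.smul_apply]
    rw [smul_comm]
  norm_map' f := by
    change ‖(memLp_dilFun s (Lp.memLp f)).toLp _‖ = _
    rw [Lp.norm_toLp, eLpNorm_dilFun s (Lp.aestronglyMeasurable f), Lp.norm_def]

theorem dil_coeFn (s : ℝ) (f : Lp E 2 (volume : Measure (Space d))) :
    dil s f =ᵐ[volume] dilFun s f :=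
  (memLp_dilFun s (Lp.memLp f)).coeFn_toLp

theorem dil_toLp (s : ℝ) {f : Space d → E} (hf : MemLp f 2 volume) :
    dil s (hf.toLp f) = (memLp_dilFun s hf).toLp _ := by
  refine Lp.ext ((dil_coeFn s _).trans ?_)
  exact (dilFun_congr s hf.coeFn_toLp).trans (memLp_dilFun s hf).coeFn_toLp.symm

theorem dilFun_dilFun (s t : ℝ) (f : Space d → E) : dilFun s (dilFun t f) = dilFun (s + t) f := by
  ext x
  simp only [dilFun, smul_smul]
  rw [← Complex.ofReal_mul, ← Real.exp_add, ← Real.exp_add]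
  ring_nf

theorem dil_dil (s t : ℝ) (f : Lp E 2 (volume : Measure (Space d))) :
    dil s (dil t f) = dil (s + t) f := by
  refine Lp.ext ?_
  filter_upwards [dil_coeFn s (dil t f), dilFun_congr s (dil_coeFn t f), dil_coeFn (s + t) f]
    with x h1 h2 h3
  rw [h1, h2, h3, dilFun_dilFun]

theorem dil_zero (f : Lp E 2 (volume : Measure (Space d))) : dil 0 f = f := by
  refine Lp.ext ?_
  filter_upwards [dil_coeFn 0 f] with x h1
  simp [h1, dilFun]

theorem integral_comp_exp_smul {G : Type*} [NormedAddCommGroup G] [NormedSpace ℝ G] (s : ℝ)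
    (f : Space d → G) :
    ∫ x, f (Real.exp s • x) = Real.exp (-(s * d)) • ∫ x, f x := by
  rw [Measure.integral_comp_smul, finrank_euclideanSpace, Fintype.card_fin,
    abs_of_pos (by positivity), ← Real.exp_nat_mul, ← Real.exp_neg]
  ring_nf

end dilation

section dilation_inner

variable {d : ℕ} {E : Type*} [NormedAddCommGroup E] [InnerProductSpace ℂ E]

theorem inner_dil_left (s : ℝ) (f g : Lp E 2 (volume : Measure (Space d))) :
    inner ℂ (dil s f) g = inner ℂ f (dil (-s) g) := by
  rw [← LinearIsometry.inner_map_map (dil s) f, dil_dil, add_neg_cancel, dil_zero]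

end dilation_inner

/-! ### Dominated convergence in `L²` and the generator of dilations -/

section dominated

variable {X E : Type*} [MeasurableSpace X] {ν : Measure X} [NormedAddCommGroup E]

theorem norm_sq_eq_integral (f : Lp E 2 ν) : ‖f‖ ^ 2 = ∫ x, ‖f x‖ ^ 2 ∂ν := by
  have h := integral_eq_lintegral_of_nonneg_ae (μ := ν) (f := fun x => ‖f x‖ ^ 2)
      (Eventually.of_forall fun x => by positivity) ((Lp.aestronglyMeasurable f).norm.pow 2)
  rw [h, Lp.norm_def, eLpNorm_eq_lintegral_rpow_enorm_toReal (by norm_num) (by norm_num),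
    ← ENNReal.toReal_pow, ← ENNReal.rpow_natCast, ← ENNReal.rpow_mul]
  norm_num

theorem integrable_norm_sq (f : Lp E 2 ν) : Integrable (fun x => ‖f x‖ ^ 2) ν := by
  have := (Lp.memLp f).integrable_norm_rpow (by norm_num) (by norm_num)
  simpa using this

/-- Dominated convergence in `L²`. -/
theorem tendsto_Lp_of_dominated {ι : Type*} {l : Filter ι} [l.IsCountablyGenerated]
    {f : ι → Lp E 2 ν} {g : Lp E 2 ν} {F : ι → X → E} {F₀ : X → E} {G : X → ℝ}
    (hF : ∀ i, f i =ᵐ[ν] F i) (hF₀ : g =ᵐ[ν] F₀) (hG : MemLp G 2 ν)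
    (hb : ∀ᶠ i in l, ∀ᵐ x ∂ν, ‖F i x - F₀ x‖ ≤ G x)
    (hl : ∀ᵐ x ∂ν, Tendsto (fun i => F i x) l (𝓝 (F₀ x))) : Tendsto f l (𝓝 g) := by
  rw [tendsto_iff_norm_sub_tendsto_zero]
  have h1 : Tendsto (fun i => ∫ x, ‖F i x - F₀ x‖ ^ 2 ∂ν) l (𝓝 (∫ _, 0 ∂ν)) := by
    refine tendsto_integral_filter_of_dominated_convergence (fun x => ‖G x‖ ^ 2)
      (Eventually.of_forall fun i => (((Lp.aestronglyMeasurable _).congr (hF i)).sub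
        ((Lp.aestronglyMeasurable _).congr hF₀)).norm.pow 2) ?_ ?_ ?_
    · filter_upwards [hb] with i hi
      filter_upwards [hi] with x hx
      rw [norm_pow, norm_norm]
      gcongr
      exact hx.trans (le_abs_self _)
    · have := hG.integrable_norm_rpow (by norm_num) (by norm_num)
      simpa using this
    · filter_upwards [hl] with x hx
      have := (tendsto_iff_norm_sub_tendsto_zero.1 hx).pow 2
      simpa using this
  rw [integral_zero] at h1
  have h2 : ∀ i, ‖f i - g‖ = √(∫ x, ‖F i x - F₀ x‖ ^ 2 ∂ν) := by
    intro i
    rw [← Real.sqrt_sq (norm_nonneg (f i - g)), norm_sq_eq_integral]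
    congr 1
    refine integral_congr_ae ?_
    filter_upwards [Lp.coeFn_sub (f i) g, hF i, hF₀] with x hx h3 h4
    rw [hx, Pi.sub_apply, h3, h4]
  simp_rw [h2]
  simpa using h1.sqrt

end dominated

/-! ### Differentiability and strong continuity of the dilation group -/

section generator

variable {d : ℕ} {E : Type*} [NormedAddCommGroup E] [NormedSpace ℂ E]

/-- The generator `φ ↦ x·∇φ + (d/2) φ` of dilations on smooth functions. -/
def dilGen (φ : Space d → E) (x : Space d) : E := fderiv ℝ φ x x + (((d : ℝ) / 2 : ℝ) : ℂ) • φ x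

theorem hasDerivAt_dilFun {φ : Space d → E} (hφ : ContDiff ℝ 1 φ) (s : ℝ) (x : Space d) :
    HasDerivAt (fun s => dilFun s φ x) (dilFun s (dilGen φ) x) s := by
  have h1 : HasDerivAt (fun s : ℝ => ((Real.exp (s * (d / 2)) : ℝ) : ℂ))
      ((Real.exp (s * (d / 2)) * (1 * (d / 2)) : ℝ) : ℂ) s :=
    (((hasDerivAt_id s).mul_const ((d : ℝ) / 2)).exp).ofReal_comp
  have h2 : HasDerivAt (fun s : ℝ => Real.exp s • x) (Real.exp s • x) s :=
    (Real.hasDerivAt_exp s).smul_const x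
  have h3 := ((hφ.differentiable (by simp)) (Real.exp s • x)).hasFDerivAt.comp_hasDerivAt s h2
  refine (h1.smul h3).congr_deriv ?_
  simp only [dilFun, dilGen, smul_add, smul_smul, Function.comp]
  congr 1
  push_cast
  ring_nf

theorem dilGen_continuous {φ : Space d → E} (hφ : ContDiff ℝ 1 φ) : Continuous (dilGen φ) :=
  ((hφ.continuous_fderiv (by simp)).clm_apply continuous_id).add (hφ.continuous.const_smul _)

theorem dilGen_support {φ : Space d → E} (hc : HasCompactSupport φ) :
    HasCompactSupport (dilGen φ) := by
  have h1 : HasCompactSupport (fun x => fderiv ℝ φ x x) :=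
    hc.mono' (fun x hx => support_fderiv_subset ℝ (f := φ) (by
      intro h; exact hx (by simp [h])))
  exact h1.add hc.smul_left

theorem memLp_dilGen {φ : Space d → E} (hφ : ContDiff ℝ 1 φ) (hc : HasCompactSupport φ) :
    MemLp (dilGen φ) 2 (volume : Measure (Space d)) :=
  (dilGen_continuous hφ).memLp_of_hasCompactSupport (dilGen_support hc)

/-- Dominated convergence for the difference quotients: for |s| ≤ 1 the dilates of φ are supported
in one fixed ball, and there the mean value inequality bounds the quotients by a multiple of the
supremum of the generator. -/
theorem hasDerivAt_dil_zero {φ : Space d → E} (hφ : ContDiff ℝ 1 φ) (hc : HasCompactSupport φ)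
    (hm : MemLp φ 2 volume) :
    HasDerivAt (fun s => dil s (hm.toLp φ)) ((memLp_dilGen hφ hc).toLp _) 0 := by
  rw [hasDerivAt_iff_tendsto_slope]
  obtain ⟨K, hK⟩ := (dilGen_support hc).exists_bound_of_continuous (dilGen_continuous hφ)
  have hK0 : 0 ≤ K := (norm_nonneg _).trans (hK 0)
  obtain ⟨R, hR0, hR⟩ := hc.isCompact.isBounded.subset_closedBall_lt 0 0
  have hzero : ∀ x : Space d, R < ‖x‖ → φ x = 0 := by
    intro x hx
    refine image_eq_zero_of_notMem_tsupport fun h => ?_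
    have := hR h
    rw [mem_closedBall_zero_iff] at this
    linarith
  have hbound : ∀ s : ℝ, |s| ≤ 1 → ∀ x : Space d,
      ‖dilFun s φ x - φ x‖ ≤ (Metric.closedBall (0 : Space d) (Real.exp 1 * R)).indicator
        (fun _ => Real.exp (d / 2) * K) x * |s| := by
    intro s hs x
    by_cases hx : x ∈ Metric.closedBall (0 : Space d) (Real.exp 1 * R)
    · rw [Set.indicator_of_mem hx]
      have h0 : φ x = dilFun 0 φ x := by simp [dilFun]
      rw [h0]
      have := (convex_Icc (-1 : ℝ) 1).norm_image_sub_le_of_norm_hasDerivWithin_le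
        (f := fun s => dilFun s φ x) (f' := fun s => dilFun s (dilGen φ) x)
        (C := Real.exp (d / 2) * K) (x := 0) (y := s)
        (fun t _ => (hasDerivAt_dilFun hφ t x).hasDerivWithinAt) ?_ (by simp) (abs_le.1 hs)
      · simpa using this
      · intro t ht
        rw [dilFun, norm_smul, Complex.norm_real, Real.norm_eq_abs, abs_of_pos (Real.exp_pos _)]
        have h3 : t * ((d : ℝ) / 2) ≤ d / 2 := by
          have : (0 : ℝ) ≤ d / 2 := by positivity
          nlinarith [ht.2]
        gcongr
        exact hK _
    · rw [Set.indicator_of_notMem hx]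
      rw [mem_closedBall_zero_iff, not_le] at hx
      have e1 : φ x = 0 := by
        refine hzero x (lt_of_le_of_lt ?_ hx)
        nlinarith [Real.add_one_le_exp (1 : ℝ)]
      have e2 : φ (Real.exp s • x) = 0 := by
        refine hzero _ ?_
        rw [norm_smul, Real.norm_eq_abs, abs_of_pos (Real.exp_pos _)]
        have h5 : R = Real.exp (-1) * (Real.exp 1 * R) := by
          rw [← mul_assoc, ← Real.exp_add]; simp
        rw [h5]
        have h6 : Real.exp (-1) ≤ Real.exp s := Real.exp_le_exp.2 (abs_le.1 hs).1
        have h7 := Real.exp_pos (-1)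
        calc _ < Real.exp (-1) * ‖x‖ := by gcongr
          _ ≤ _ := by gcongr
      simp [dilFun, e1, e2]
  have hG : MemLp (fun x => (Metric.closedBall (0 : Space d) (Real.exp 1 * R)).indicator
      (fun _ => Real.exp (d / 2) * K) x + ‖dilGen φ x‖) 2 (volume : Measure (Space d)) := by
    refine MemLp.add ?_ (memLp_dilGen hφ hc).norm
    exact memLp_indicator_const 2 Metric.isClosed_closedBall.measurableSet _
      (Or.inr (measure_closedBall_lt_top).ne)
  have hae : ∀ s, slope (fun s => dil s (hm.toLp φ)) 0 s =ᵐ[volume]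
      fun x => s⁻¹ • (dilFun s φ x - φ x) := by
    intro s
    have e : slope (fun s => dil s (hm.toLp φ)) 0 s =
        s⁻¹ • ((memLp_dilFun s hm).toLp _ - hm.toLp φ) := by
      rw [slope_def_module, dil_zero, sub_zero, dil_toLp]
    rw [e]
    filter_upwards [Lp.coeFn_smul s⁻¹ ((memLp_dilFun s hm).toLp _ - hm.toLp φ),
      Lp.coeFn_sub ((memLp_dilFun s hm).toLp _) (hm.toLp φ), (memLp_dilFun s hm).coeFn_toLp,
      hm.coeFn_toLp] with x h1 h2 h3 h4
    rw [h1, Pi.smul_apply, h2, Pi.sub_apply, h3, h4]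
  refine tendsto_Lp_of_dominated hae (memLp_dilGen hφ hc).coeFn_toLp hG ?_ ?_
  · have h1 : ∀ᶠ s : ℝ in 𝓝[≠] 0, |s| < 1 :=
      (continuous_abs.tendsto' (0 : ℝ) 0 (by simp)).eventually_lt_const one_pos |>.filter_mono
        nhdsWithin_le_nhds
    filter_upwards [h1, self_mem_nhdsWithin] with s hs hs0
    refine Eventually.of_forall fun x => (norm_sub_le _ _).trans (add_le_add_left ?_ _)
    rw [norm_smul, norm_inv, Real.norm_eq_abs, inv_mul_le_iff₀ (abs_pos.2 hs0), mul_comm]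
    exact hbound s hs.le x
  · refine Eventually.of_forall fun x => ?_
    have := hasDerivAt_iff_tendsto_slope.1 (hasDerivAt_dilFun hφ 0 x)
    refine (this.congr fun s => ?_).trans (le_of_eq ?_)
    · simp [slope_def_module, dilFun]
    · simp [dilFun]

theorem hasDerivAt_dil {φ : Space d → E} (hφ : ContDiff ℝ 1 φ) (hc : HasCompactSupport φ)
    (hm : MemLp φ 2 volume) (s : ℝ) :
    HasDerivAt (fun s => dil s (hm.toLp φ)) (dil s ((memLp_dilGen hφ hc).toLp _)) s := by
  have h := hasDerivAt_dil_zero hφ hc hm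
  have h1 : HasDerivAt (fun t => dil (t - s) (hm.toLp φ)) ((memLp_dilGen hφ hc).toLp _) s := by
    rw [← sub_self s] at h
    exact h.comp_sub_const s s
  have h2 := ((dil (d := d) (E := E) s).toContinuousLinearMap.restrictScalars ℝ).hasFDerivAt
    |>.comp_hasDerivAt s h1
  refine h2.congr_of_eventuallyEq (Eventually.of_forall fun t => ?_)
  simp [dil_dil]

/-- Strong continuity of dilations. -/
theorem tendsto_dil_zero (f : Lp E 2 (volume : Measure (Space d))) :
    Tendsto (fun s => dil s f) (𝓝 0) (𝓝 f) := by
  rw [Metric.tendsto_nhds]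
  intro ε hε
  obtain ⟨g, hfg, φ, hgφ, hc, hφ⟩ := Metric.dense_iff.1
    (Lp.dense_hasCompactSupport_contDiff (E := Space d) (F := E) (p := 2) (μ := volume)
      (by norm_num)) f (ε / 3) (by positivity)
  have hφ1 : ContDiff ℝ 1 φ := hφ.of_le (by exact_mod_cast le_top)
  have hm : MemLp φ 2 volume := (memLp_congr_ae hgφ).1 (Lp.memLp g)
  have hg : g = hm.toLp φ := Lp.ext (hgφ.trans hm.coeFn_toLp.symm)
  have h1 := (hasDerivAt_dil_zero hφ1 hc hm).continuousAt.tendsto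
  rw [dil_zero, ← hg] at h1
  rw [Metric.mem_ball_comm, Metric.mem_ball] at hfg
  filter_upwards [Metric.tendsto_nhds.1 h1 (ε / 3) (by positivity)] with s hs
  calc dist (dil s f) f ≤ dist (dil s f) (dil s g) + dist (dil s g) g + dist g f :=
        dist_triangle4 _ _ _ _
    _ < ε / 3 + ε / 3 + ε / 3 := by
        rw [(dil s).dist_map, dist_comm g f]
        gcongr
    _ = ε := by ring

end generator

/-! ### Gradients and cutoff functions -/

section cutoff

variable {d : ℕ}

theorem continuous_grad {φ : Space d → ℂ} (hφ : ContDiff ℝ 1 φ) : Continuous (grad φ) :=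
  (PiLp.continuous_toLp 2 _).comp (continuous_pi fun _ =>
    (hφ.continuous_fderiv (by simp)).clm_apply continuous_const)

theorem grad_eq_zero {φ : Space d → ℂ} {x : Space d} (hx : x ∉ tsupport φ) : grad φ x = 0 := by
  have h : fderiv ℝ φ x = 0 := image_eq_zero_of_notMem_tsupport fun h => hx (tsupport_fderiv_subset ℝ h)
  ext i
  simp [grad, pd, h]

theorem hasCompactSupport_grad {φ : Space d → ℂ} (hc : HasCompactSupport φ) :
    HasCompactSupport (grad φ) :=
  HasCompactSupport.intro hc fun _ hx => grad_eq_zero hx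

theorem grad_mul {η φ : Space d → ℂ} {x : Space d} (hη : DifferentiableAt ℝ η x)
    (hφ : DifferentiableAt ℝ φ x) :
    grad (fun x => η x * φ x) x = η x • grad φ x + φ x • grad η x := by
  have h := hη.hasFDerivAt.mul hφ.hasFDerivAt
  have h' : fderiv ℝ (fun x => η x * φ x) x = η x • fderiv ℝ φ x + φ x • fderiv ℝ η x := h.fderiv
  ext i
  simp [grad, pd, h']

theorem grad_comp_smul (c : ℝ) (φ : Space d → ℂ) (x : Space d) :
    grad (fun x => φ (c • x)) x = (c : ℂ) • grad φ (c • x) := by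
  ext i
  simp [grad, pd, fderiv_comp_smul]

theorem grad_const_sub (a : ℂ) (φ : Space d → ℂ) (x : Space d) :
    grad (fun x => a - φ x) x = - grad φ x := by
  ext i
  simp [grad, pd, fderiv_const_sub]

theorem fderiv_apply_eq_sum (φ : Space d → ℂ) (x v : Space d) :
    fderiv ℝ φ x v = ∑ i, (v i : ℂ) * grad φ x i := by
  have hv : v = ∑ i, v i • EuclideanSpace.single i (1 : ℝ) := by
    have := (EuclideanSpace.basisFun (Fin d) ℝ).sum_repr v
    simpa using this.symm
  conv_lhs => rw [hv]
  simp [grad, pd]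

/-- A fixed bump function, equal to `1` on the unit ball and supported in the ball of radius `2`. -/
def bumpFn (d : ℕ) : ContDiffBump (0 : Space d) := ⟨1, 2, one_pos, one_lt_two⟩

/-- The rescaled bump function `x ↦ bumpFn (c x)`, with complex values. -/
def cut (c : ℝ) (x : Space d) : ℂ := ((bumpFn d (c • x) : ℝ) : ℂ)

theorem contDiff_cut (c : ℝ) : ContDiff ℝ (⊤ : ℕ∞) (cut (d := d) c) :=
  Complex.ofRealCLM.contDiff.comp ((bumpFn d).contDiff.comp (contDiff_const_smul c))

theorem norm_cut_le (c : ℝ) (x : Space d) : ‖cut c x‖ ≤ 1 := by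
  rw [cut, Complex.norm_real, Real.norm_eq_abs, abs_of_nonneg (bumpFn d).nonneg]
  exact (bumpFn d).le_one

theorem cut_eq_one {c : ℝ} {x : Space d} (h : ‖c • x‖ ≤ 1) : cut c x = 1 := by
  rw [cut, (bumpFn d).one_of_mem_closedBall (by simpa [bumpFn] using h)]
  simp

theorem cut_eq_zero {c : ℝ} {x : Space d} (h : 2 ≤ ‖c • x‖) : cut c x = 0 := by
  rw [cut, (bumpFn d).zero_of_le_dist (by simpa [bumpFn] using h)]
  simp

theorem hasCompactSupport_cut {c : ℝ} (hc : 0 < c) : HasCompactSupport (cut (d := d) c) := by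
  refine HasCompactSupport.intro (isCompact_closedBall (0 : Space d) (2 / c)) fun x hx => ?_
  refine cut_eq_zero ?_
  rw [mem_closedBall_zero_iff, not_le, div_lt_iff₀ hc] at hx
  rw [norm_smul, Real.norm_eq_abs, abs_of_pos hc]
  linarith

theorem cut_eq_cut_one (c : ℝ) : cut (d := d) c = fun x => cut 1 (c • x) := by
  ext x; simp [cut]

theorem grad_cut (c : ℝ) (x : Space d) : grad (cut c) x = (c : ℂ) • grad (cut 1) (c • x) := by
  rw [cut_eq_cut_one c, grad_comp_smul]

theorem exists_bound_grad_cut (d : ℕ) : ∃ K : ℝ, 0 ≤ K ∧ ∀ x : Space d, ‖grad (cut 1) x‖ ≤ K := by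
  obtain ⟨K, hK⟩ := (hasCompactSupport_grad (hasCompactSupport_cut one_pos)).exists_bound_of_continuous
    (continuous_grad (d := d) ((contDiff_cut 1).of_le (by exact_mod_cast le_top)))
  exact ⟨K, (norm_nonneg _).trans (hK 0), hK⟩

end cutoff

/-! ### Density of test functions on the punctured space in `H¹` -/

section density

variable {d : ℕ}

theorem rho_zero (hd : 2 ≤ d) : rho d 0 = 0 := by
  have : (0 : ℝ) ≤ ((d : ℝ) - 2) / 2 := by
    have : (2 : ℝ) ≤ d := by exact_mod_cast hd
    linarith
  rw [rho, add_zero, Real.sqrt_sq this, sub_self]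

/-- At a = 0 the smaller root ρ vanishes and D is the plain gradient. Hence `graphCl (jMap d) (dMap
d 0)` is the closure of C_c^∞(ℝ^d ∖ {0}) in the H¹ norm, the form in which H¹ is used below. -/
theorem dop_zero (hd : 2 ≤ d) (φ : Space d → ℂ) : dop 0 φ = grad φ := by
  ext x i
  simp [dop, grad, rho_zero hd]

theorem tendsto_withLp_prod {ι H K : Type*} [NormedAddCommGroup H] [NormedAddCommGroup K]
    {l : Filter ι} {f : ι → WithLp 2 (H × K)} {w : WithLp 2 (H × K)}
    (h1 : Tendsto (fun i => (f i).fst) l (𝓝 w.fst)) (h2 : Tendsto (fun i => (f i).snd) l (𝓝 w.snd)) :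
    Tendsto f l (𝓝 w) := by
  rw [(WithLp.homeomorphProd 2 H K).isInducing.tendsto_nhds_iff, Prod.tendsto_iff]
  exact ⟨h1, h2⟩

/-- The pair `(φ, ∇φ)` in `L² × L²`. -/
def gradPair {φ : Space d → ℂ} (h : MemLp φ 2 volume) (h' : MemLp (grad φ) 2 volume) :
    WithLp 2 (L2 d × L2Vec d) :=
  WithLp.toLp 2 (h.toLp φ, h'.toLp (grad φ))

/-- A smooth compactly supported function, cut off near the origin. -/
def cutOrigin {φ : Space d → ℂ} (hφ : ContDiff ℝ (⊤ : ℕ∞) φ) (hc : HasCompactSupport φ) (c : ℝ) :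
    PTest d :=
  ⟨fun x => (1 - cut c x) * φ x, (contDiff_const.sub (contDiff_cut c)).mul hφ, hc.mul_left, by
    intro x hx hx0
    have hx0' : x = 0 := hx0
    subst hx0'
    refine (notMem_tsupport_iff_eventuallyEq.2 ?_) hx
    have : ∀ᶠ y : Space d in 𝓝 0, ‖c • y‖ < 1 :=
      ((continuous_const_smul c).norm.tendsto' (0 : Space d) 0 (by simp)).eventually_lt_const one_pos
    filter_upwards [this] with y hy
    simp [cut_eq_one hy.le]⟩

theorem cutOrigin_apply {φ : Space d → ℂ} (hφ : ContDiff ℝ (⊤ : ℕ∞) φ) (hc : HasCompactSupport φ)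
    (c : ℝ) : ⇑(cutOrigin hφ hc c) = fun x => (1 - cut c x) * φ x := rfl

/-- For d ≥ 3 a point has zero H¹ capacity: cutting φ off in balls of radius about 1/(n+1) costs an
error φ ∇cut that tends to 0 in L². -/
theorem gradPair_mem_of_compactSupport (hd : 3 ≤ d) {φ : Space d → ℂ}
    (hφ : ContDiff ℝ (⊤ : ℕ∞) φ) (hc : HasCompactSupport φ)
    (h : MemLp φ 2 volume) (h' : MemLp (grad φ) 2 volume) :
    gradPair h h' ∈ graphCl (jMap d) (dMap d 0) := by
  have hφ1 : ContDiff ℝ 1 φ := hφ.of_le (by exact_mod_cast le_top)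
  have hcutlim : ∀ x : Space d, x ≠ 0 → ∀ᶠ n : ℕ in atTop, cut ((n : ℝ) + 1) x = 0 := by
    intro x hx
    have hx' : 0 < ‖x‖ := norm_pos_iff.2 hx
    obtain ⟨N, hN⟩ := exists_nat_gt (2 / ‖x‖)
    filter_upwards [eventually_ge_atTop N] with n hn
    refine cut_eq_zero ?_
    rw [div_lt_iff₀ hx'] at hN
    rw [norm_smul, Real.norm_eq_abs, abs_of_pos (by positivity)]
    have : (N : ℝ) ≤ n := by exact_mod_cast hn
    nlinarith
  have hne : ∀ᵐ x : Space d, x ≠ 0 := by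
    have : Nonempty (Fin d) := ⟨⟨0, by omega⟩⟩
    exact compl_mem_ae_iff.2 (measure_singleton 0)
  have hG1 : MemLp (grad (cut (d := d) 1)) 2 volume :=
    (continuous_grad ((contDiff_cut 1).of_le (by exact_mod_cast le_top))).memLp_of_hasCompactSupport
      (hasCompactSupport_grad (hasCompactSupport_cut one_pos))
  obtain ⟨K, hK⟩ := hc.exists_bound_of_continuous hφ.continuous
  have hcm : ∀ c, Continuous (cut (d := d) c) := fun c => (contDiff_cut c).continuous
  have hA : ∀ n : ℕ, MemLp (fun x => (1 - cut ((n : ℝ) + 1) x) • grad φ x) 2 volume := fun n =>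
    ((continuous_const.sub (hcm _)).smul (continuous_grad hφ1)).memLp_of_hasCompactSupport
      (hasCompactSupport_grad hc).smul_left
  have hB : ∀ n : ℕ, MemLp (fun x => φ x • grad (cut ((n : ℝ) + 1)) x) 2 volume := fun n =>
    (hφ.continuous.smul (continuous_grad
      ((contDiff_cut _).of_le (by exact_mod_cast le_top)))).memLp_of_hasCompactSupport hc.smul_right
  refine (mem_graphCl_seq _ _ _).2 ⟨fun n => cutOrigin hφ hc ((n : ℝ) + 1), ?_, ?_⟩
  · refine tendsto_Lp_of_dominated (G := fun x => ‖φ x‖)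
      (fun n => (ptest_memLp (cutOrigin hφ hc ((n : ℝ) + 1))).coeFn_toLp) h.coeFn_toLp h.norm
      (Eventually.of_forall fun n => Eventually.of_forall fun x => ?_) ?_
    · rw [cutOrigin_apply]
      have : (1 - cut ((n : ℝ) + 1) x) * φ x - φ x = - (cut ((n : ℝ) + 1) x * φ x) := by ring
      rw [this, norm_neg, norm_mul]
      exact mul_le_of_le_one_left (norm_nonneg _) (norm_cut_le _ _)
    · filter_upwards [hne] with x hx
      refine tendsto_const_nhds.congr' ?_
      filter_upwards [hcutlim x hx] with n hn
      simp [cutOrigin_apply, hn]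
  · have e : ∀ n : ℕ, dMap d 0 (cutOrigin hφ hc ((n : ℝ) + 1)) = (hA n).toLp _ - (hB n).toLp _ := by
      intro n
      rw [← MemLp.toLp_sub]
      change (dop_memLp 0 _).toLp _ = _
      rw [MemLp.toLp_eq_toLp_iff, dop_zero (by omega), cutOrigin_apply]
      refine Eventually.of_forall fun x => ?_
      rw [grad_mul (η := fun x => 1 - cut ((n : ℝ) + 1) x)
        ((differentiableAt_const _).sub ((contDiff_cut _).differentiable (by simp) x))
        (hφ1.differentiable (by simp) x), grad_const_sub]
      simp [sub_eq_add_neg]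
    simp_rw [e]
    have hAlim : Tendsto (fun n => (hA n).toLp _) atTop (𝓝 (h'.toLp (grad φ))) := by
      refine tendsto_Lp_of_dominated (G := fun x => ‖grad φ x‖) (fun n => (hA n).coeFn_toLp)
        h'.coeFn_toLp h'.norm (Eventually.of_forall fun n => Eventually.of_forall fun x => ?_) ?_
      · have : (1 - cut ((n : ℝ) + 1) x) • grad φ x - grad φ x =
          - (cut ((n : ℝ) + 1) x • grad φ x) := by module
        rw [this, norm_neg, norm_smul]
        exact mul_le_of_le_one_left (norm_nonneg _) (norm_cut_le _ _)
      · filter_upwards [hne] with x hx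
        refine tendsto_const_nhds.congr' ?_
        filter_upwards [hcutlim x hx] with n hn
        simp [hn]
    -- Up to the factor (n+1)^{1-d/2}, the gradient of the cutoff at scale 1/(n+1) is the unitary
    -- dilation of the gradient at scale 1. The exponent is negative exactly because d > 2.
    have hBlim : Tendsto (fun n => (hB n).toLp _) atTop (𝓝 0) := by
      refine squeeze_zero_norm (a := fun n : ℕ => K * ((n : ℝ) + 1) ^ (1 - (d : ℝ) / 2) *
        ‖hG1.toLp _‖) (fun n => ?_) ?_
      · have hn : (0 : ℝ) < (n : ℝ) + 1 := by positivity
        rw [← (dil (Real.log ((n : ℝ) + 1))).norm_map (hG1.toLp _)]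
        refine Lp.norm_le_mul_norm_of_ae_le_mul ?_
        rw [dil_toLp]
        filter_upwards [(hB n).coeFn_toLp, (memLp_dilFun (Real.log ((n : ℝ) + 1)) hG1).coeFn_toLp]
          with x h1 h2
        have e1 : Real.exp (Real.log ((n : ℝ) + 1) * (d / 2)) = ((n : ℝ) + 1) ^ ((d : ℝ) / 2) :=
          (Real.rpow_def_of_pos hn _).symm
        rw [h1, h2, grad_cut, dilFun, norm_smul, norm_smul, norm_smul, Real.exp_log hn, e1,
          Complex.norm_real, Complex.norm_real, Real.norm_of_nonneg hn.le,
          Real.norm_of_nonneg (by positivity)]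
        have e2 : K * ((n : ℝ) + 1) ^ (1 - (d : ℝ) / 2) * (((n : ℝ) + 1) ^ ((d : ℝ) / 2) *
            ‖grad (cut 1) (((n : ℝ) + 1) • x)‖) =
            K * (((n : ℝ) + 1) * ‖grad (cut 1) (((n : ℝ) + 1) • x)‖) := by
          rw [← mul_assoc, mul_assoc K, ← Real.rpow_add hn, sub_add_cancel, Real.rpow_one, mul_assoc]
        rw [e2]
        gcongr
        exact hK x
      · have h3 : Tendsto (fun n : ℕ => ((n : ℝ) + 1) ^ (1 - (d : ℝ) / 2)) atTop (𝓝 0) := by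
          have h4 : (0 : ℝ) < (d : ℝ) / 2 - 1 := by
            have : (3 : ℝ) ≤ d := by exact_mod_cast hd
            linarith
          have h5 := (tendsto_rpow_neg_atTop h4).comp
            (tendsto_atTop_add_const_right _ (1 : ℝ) tendsto_natCast_atTop_atTop)
          simpa [Function.comp_def] using h5
        simpa using (h3.const_mul K).mul_const ‖hG1.toLp _‖
    have := hAlim.sub hBlim
    rw [sub_zero] at this
    exact this

/-- Schwartz functions belong to the closure of the test functions on the punctured space. -/
theorem gradPair_mem_of_schwartz (hd : 3 ≤ d) (φ : SchwartzMap (Space d) ℂ)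
    (h : MemLp φ 2 volume) (h' : MemLp (grad φ) 2 volume) :
    gradPair h h' ∈ graphCl (jMap d) (dMap d 0) := by
  have hφ : ContDiff ℝ (⊤ : ℕ∞) φ := φ.smooth ⊤
  have hφ1 : ContDiff ℝ 1 φ := φ.smooth 1
  obtain ⟨K, hK0, hK⟩ := exists_bound_grad_cut d
  have hψ : ∀ n : ℕ, ContDiff ℝ (⊤ : ℕ∞) (fun x => cut ((n : ℝ) + 1)⁻¹ x * φ x) := fun n =>
    (contDiff_cut _).mul hφ
  have hψc : ∀ n : ℕ, HasCompactSupport (fun x => cut ((n : ℝ) + 1)⁻¹ x * φ x) := fun n =>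
    (hasCompactSupport_cut (by positivity)).mul_right
  have hm : ∀ n : ℕ, MemLp (fun x => cut ((n : ℝ) + 1)⁻¹ x * φ x) 2 volume := fun n =>
    (hψ n).continuous.memLp_of_hasCompactSupport (hψc n)
  have hm' : ∀ n : ℕ, MemLp (grad fun x => cut ((n : ℝ) + 1)⁻¹ x * φ x) 2 volume := fun n =>
    (continuous_grad ((hψ n).of_le (by exact_mod_cast le_top))).memLp_of_hasCompactSupport
      (hasCompactSupport_grad (hψc n))
  have hinv : Tendsto (fun n : ℕ => ((n : ℝ) + 1)⁻¹) atTop (𝓝 0) :=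
    (tendsto_inv_atTop_zero.comp
      (tendsto_atTop_add_const_right _ (1 : ℝ) tendsto_natCast_atTop_atTop))
  have hcutlim : ∀ x : Space d, ∀ᶠ n : ℕ in atTop, cut ((n : ℝ) + 1)⁻¹ x = 1 := by
    intro x
    have h1 : Tendsto (fun n : ℕ => ‖(((n : ℝ) + 1)⁻¹) • x‖) atTop (𝓝 0) := by
      have := (hinv.smul_const x).norm
      simpa using this
    filter_upwards [h1.eventually_lt_const one_pos] with n hn using cut_eq_one hn.le
  have hgrad : ∀ (n : ℕ) (x : Space d), grad (fun x => cut ((n : ℝ) + 1)⁻¹ x * φ x) x =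
      cut ((n : ℝ) + 1)⁻¹ x • grad φ x + φ x • grad (cut ((n : ℝ) + 1)⁻¹) x := fun n x =>
    grad_mul ((contDiff_cut _).differentiable (by simp) x) (hφ1.differentiable (by simp) x)
  -- The cutoff now lives at scale n+1, so its gradient is of size 1/(n+1) and the commutator term
  -- vanishes in the limit.
  have hgc : ∀ (n : ℕ) (x : Space d), ‖φ x • grad (cut ((n : ℝ) + 1)⁻¹) x‖ ≤
      ((n : ℝ) + 1)⁻¹ * (K * ‖φ x‖) := by
    intro n x
    have hn : (0 : ℝ) < ((n : ℝ) + 1)⁻¹ := by positivity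
    rw [grad_cut, norm_smul, norm_smul, Complex.norm_real, Real.norm_of_nonneg hn.le]
    have := hK (((n : ℝ) + 1)⁻¹ • x)
    calc _ ≤ ‖φ x‖ * (((n : ℝ) + 1)⁻¹ * K) := by gcongr
      _ = _ := by ring
  have hdom : ∀ (n : ℕ) (z : Space d) , ‖cut ((n : ℝ) + 1)⁻¹ z - 1‖ ≤ 2 := fun n z =>
    (norm_sub_le _ _).trans (by have := norm_cut_le ((n : ℝ) + 1)⁻¹ z; rw [norm_one]; linarith)
  refine (Submodule.isClosed_topologicalClosure (LinearMap.range (graphMap (jMap d) (dMap d 0)))).mem_of_tendsto (b := atTop)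
    (tendsto_withLp_prod (f := fun n => gradPair (hm n) (hm' n)) ?_ ?_) (Eventually.of_forall fun n =>
      gradPair_mem_of_compactSupport hd (hψ n) (hψc n) (hm n) (hm' n))
  · refine tendsto_Lp_of_dominated (G := fun x => 2 * ‖φ x‖) (fun n => (hm n).coeFn_toLp)
      h.coeFn_toLp (h.norm.const_mul 2) (Eventually.of_forall fun n => Eventually.of_forall fun x => ?_)
      (Eventually.of_forall fun x => ?_)
    · rw [show cut ((n : ℝ) + 1)⁻¹ x * φ x - φ x = (cut ((n : ℝ) + 1)⁻¹ x - 1) * φ x by ring, norm_mul]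
      gcongr
      exact hdom n x
    · refine tendsto_const_nhds.congr' ?_
      filter_upwards [hcutlim x] with n hn
      simp [hn]
  · refine tendsto_Lp_of_dominated (G := fun x => 2 * ‖grad φ x‖ + K * ‖φ x‖)
      (fun n => (hm' n).coeFn_toLp) h'.coeFn_toLp ((h'.norm.const_mul 2).add (h.norm.const_mul K))
      (Eventually.of_forall fun n => Eventually.of_forall fun x => ?_)
      (Eventually.of_forall fun x => ?_)
    · rw [hgrad, add_sub_right_comm, show cut ((n : ℝ) + 1)⁻¹ x • grad φ x - grad φ x =
        (cut ((n : ℝ) + 1)⁻¹ x - 1) • grad φ x by module]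
      refine (norm_add_le _ _).trans (add_le_add ?_ ((hgc n x).trans ?_))
      · rw [norm_smul]
        gcongr
        exact hdom n x
      · refine mul_le_of_le_one_left (by positivity) (inv_le_one_of_one_le₀ ?_)
        linarith [show (0 : ℝ) ≤ n by positivity]
    · simp_rw [hgrad]
      have l1 : Tendsto (fun n : ℕ => φ x • grad (cut ((n : ℝ) + 1)⁻¹) x) atTop (𝓝 0) :=
        squeeze_zero_norm (fun n => hgc n x) (by simpa using hinv.mul_const (K * ‖φ x‖))
      have l2 : Tendsto (fun n : ℕ => cut ((n : ℝ) + 1)⁻¹ x • grad φ x) atTop (𝓝 (grad φ x)) := by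
        refine tendsto_const_nhds.congr' ?_
        filter_upwards [hcutlim x] with n hn
        simp [hn]
      simpa using l2.add l1

/-- The `i`-th coordinate of a vector field. -/
def coordOp (i : Fin d) : L2Vec d →L[ℂ] L2 d :=
  pwOp (fun _ => (EuclideanSpace.proj i : CSpace d →L[ℂ] ℂ)) aestronglyMeasurable_const
    ‖(EuclideanSpace.proj i : CSpace d →L[ℂ] ℂ)‖ fun _ => le_rfl

theorem coordOp_coeFn (i : Fin d) (F : L2Vec d) : coordOp i F =ᵐ[volume] fun x => F x i :=
  pwOp_coeFn _ _ F

theorem inner_eq_sum_coordOp (F G : L2Vec d) :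
    inner ℂ F G = ∑ i, inner ℂ (coordOp i F) (coordOp i G) := by
  simp_rw [L2.inner_def]
  rw [← integral_finsetSum _ fun i _ => L2.integrable_inner (coordOp i F) (coordOp i G)]
  refine integral_congr_ae ?_
  have h : ∀ F : L2Vec d, ∀ᵐ x, ∀ i, coordOp i F x = F x i := fun F =>
    ae_all_iff.2 fun i => coordOp_coeFn i F
  filter_upwards [h F, h G] with x h1 h2
  simp [PiLp.inner_apply, h1, h2]

theorem eq_zero_of_coordOp {F : L2Vec d} (h : ∀ i, coordOp i F = 0) : F = 0 := by
  rw [← inner_self_eq_zero (𝕜 := ℂ), inner_eq_sum_coordOp]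
  simp [h]

theorem dMap_coeFn (a : ℝ) (ψ : PTest d) : dMap d a ψ =ᵐ[volume] dop a ψ :=
  (dop_memLp a ψ).coeFn_toLp

theorem jMap_coeFn (ψ : PTest d) : jMap d ψ =ᵐ[volume] ψ :=
  (ptest_memLp ψ).coeFn_toLp

theorem inner_coordOp_dMap (hd : 2 ≤ d) (i : Fin d) (ψ : PTest d) (f : L2 d) :
    inner ℂ (coordOp i (dMap d 0 ψ)) f = ∫ x, f x * (starRingEnd ℂ) (pd i ψ x) := by
  rw [L2.inner_def]
  refine integral_congr_ae ?_
  filter_upwards [coordOp_coeFn i (dMap d 0 ψ), dMap_coeFn 0 ψ] with x h1 h2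
  rw [h1, h2, dop_zero hd, RCLike.inner_apply]
  simp [grad]

theorem inner_jMap_coordOp (i : Fin d) (ψ : PTest d) (F : L2Vec d) :
    inner ℂ (jMap d ψ) (coordOp i F) = ∫ x, F x i * (starRingEnd ℂ) (ψ x) := by
  rw [L2.inner_def]
  refine integral_congr_ae ?_
  filter_upwards [coordOp_coeFn i F, jMap_coeFn ψ] with x h1 h2
  rw [h1, h2, RCLike.inner_apply]

theorem pd_conj {ψ : Space d → ℂ} {x : Space d} (h : DifferentiableAt ℝ ψ x) (i : Fin d) :
    pd i (fun x => (starRingEnd ℂ) (ψ x)) x = (starRingEnd ℂ) (pd i ψ x) := by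
  have h1 : HasFDerivAt (fun x => (starRingEnd ℂ) (ψ x))
      ((Complex.conjCLE : ℂ →L[ℝ] ℂ) ∘L fderiv ℝ ψ x) x :=
    (Complex.conjCLE : ℂ →L[ℝ] ℂ).hasFDerivAt.comp x h.hasFDerivAt
  simp [pd, h1.fderiv]

/-- The inner product is antilinear in its first entry, so the weak derivative is tested against the
conjugate of ψ. -/
theorem IsWeakGrad.inner_test (hd : 2 ≤ d) {f : L2 d} {F : L2Vec d} (h : IsWeakGrad f F)
    (ψ : PTest d) (i : Fin d) :
    inner ℂ (coordOp i (dMap d 0 ψ)) f = - inner ℂ (jMap d ψ) (coordOp i F) := by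
  let φ : 𝓓((⊤ : Opens (Space d)), ℂ) := ⟨fun x => (starRingEnd ℂ) (ψ x),
    Complex.conjCLE.contDiff.comp (ptest_smooth ψ),
    ψ.hasCompactSupport.comp_left (g := starRingEnd ℂ) (by simp), by simp⟩
  have h1 := h φ i
  have h2 : ⇑φ = fun x => (starRingEnd ℂ) (ψ x) := rfl
  rw [h2] at h1
  rw [inner_coordOp_dMap hd, inner_jMap_coordOp]
  refine Eq.trans (integral_congr_ae (Eventually.of_forall fun x => ?_)) h1
  simp only
  rw [pd_conj ((ptest_smooth ψ).differentiable (by simp) x)]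

/-- Both sides are continuous in the graph norm, so an integration by parts known for test functions
holds on the closed graph. -/
theorem inner_test_extend {f : L2 d} {F : L2Vec d} {i : Fin d}
    (h : ∀ ψ : PTest d, inner ℂ (coordOp i (dMap d 0 ψ)) f = - inner ℂ (jMap d ψ) (coordOp i F))
    {w : WithLp 2 (L2 d × L2Vec d)} (hw : w ∈ graphCl (jMap d) (dMap d 0)) :
    inner ℂ (coordOp i w.snd) f = - inner ℂ w.fst (coordOp i F) := by
  obtain ⟨φ, h1, h2⟩ := (mem_graphCl_seq _ _ _).1 hw
  have l1 := (((coordOp i).continuous.tendsto _).comp h2).inner (𝕜 := ℂ)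
    (tendsto_const_nhds (x := f))
  have l2 := (h1.inner (𝕜 := ℂ) (tendsto_const_nhds (x := coordOp i F))).neg
  refine tendsto_nhds_unique l1 (l2.congr fun n => ?_)
  exact (h (φ n)).symm

theorem inner_test_test (hd : 2 ≤ d) (ψ φ : PTest d) (i : Fin d) :
    inner ℂ (coordOp i (dMap d 0 ψ)) (jMap d φ) =
      - inner ℂ (jMap d ψ) (coordOp i (dMap d 0 φ)) := by
  rw [inner_coordOp_dMap hd, inner_jMap_coordOp]
  have hc : Continuous fun x => (starRingEnd ℂ) (ψ x) :=
    Complex.continuous_conj.comp ψ.continuous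
  have hd' : ∀ x, DifferentiableAt ℝ ψ x := (ptest_smooth ψ).differentiable (by simp)
  have hcs : HasCompactSupport fun x => (starRingEnd ℂ) (ψ x) :=
    ψ.hasCompactSupport.comp_left (g := starRingEnd ℂ) (by simp)
  have hpc : ∀ φ : PTest d, HasCompactSupport (pd i φ) := fun φ =>
    φ.hasCompactSupport.mono' ((subset_tsupport _).trans (pd_support φ i))
  have key := integral_mul_fderiv_eq_neg_fderiv_mul_of_integrable (μ := (volume : Measure (Space d)))
    (f := φ) (g := fun x => (starRingEnd ℂ) (ψ x)) (v := EuclideanSpace.single i 1)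
    ?_ ?_ ?_ ?_ ?_
  · have e1 : ∫ x, jMap d φ x * (starRingEnd ℂ) (pd i ψ x) =
        ∫ x, φ x * fderiv ℝ (fun x => (starRingEnd ℂ) (ψ x)) x (EuclideanSpace.single i 1) := by
      refine integral_congr_ae ?_
      filter_upwards [jMap_coeFn φ] with x hx
      rw [hx, ← pd_conj (hd' x)]
      rfl
    rw [e1, key]
    congr 1
    refine integral_congr_ae ?_
    filter_upwards [dMap_coeFn 0 φ] with x hx
    rw [hx, dop_zero hd]
    simp [grad, pd]
  · exact ((pd_smooth φ i).continuous.mul hc).integrable_of_hasCompactSupport (hpc φ).mul_right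
  · have e : (fun x => φ x * fderiv ℝ (fun x => (starRingEnd ℂ) (ψ x)) x (EuclideanSpace.single i 1)) =
        fun x => φ x * (starRingEnd ℂ) (pd i ψ x) := by
      ext x; rw [← pd_conj (hd' x)]; rfl
    rw [e]
    exact (φ.continuous.mul (Complex.continuous_conj.comp
      (pd_smooth ψ i).continuous)).integrable_of_hasCompactSupport φ.hasCompactSupport.mul_right
  · exact (φ.continuous.mul hc).integrable_of_hasCompactSupport φ.hasCompactSupport.mul_right
  · exact fun x _ => (ptest_smooth φ).differentiable (by simp) x
  · exact fun x _ => Complex.conjCLE.differentiable.comp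
      ((ptest_smooth ψ).differentiable (by simp)) x

/-- `1 - Δ` maps Schwartz functions onto Schwartz functions. -/
theorem exists_schwartz_one_sub_laplacian (ψ : SchwartzMap (Space d) ℂ) :
    ∃ φ : SchwartzMap (Space d) ℂ, φ - Laplacian.laplacian φ = ψ := by
  -- The symbol of (1 - Δ)⁻¹ in the Fourier normalization where Δ has symbol -4π²|ξ|².
  have ht : (fun x : Space d => (1 + ‖(2 * Real.pi) • x‖ ^ 2) ^ (-1 : ℝ)).HasTemperateGrowth :=
    (Function.hasTemperateGrowth_one_add_norm_sq_rpow (Space d) (-1 : ℝ)).comp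
      (((2 * Real.pi) • ContinuousLinearMap.id ℝ (Space d)).hasTemperateGrowth)
  set g := fun x : Space d => (1 + ‖(2 * Real.pi) • x‖ ^ 2) ^ (-1 : ℝ) with hg
  have hn : (fun x : Space d => ‖x‖ ^ 2).HasTemperateGrowth := by fun_prop
  have hng : ((fun x : Space d => ‖x‖ ^ 2) * g).HasTemperateGrowth := hn.mul ht
  refine ⟨SchwartzMap.fourierMultiplierCLM ℂ g ψ, ?_⟩
  have e : Laplacian.laplacian (SchwartzMap.fourierMultiplierCLM ℂ g ψ) =
      -(2 * Real.pi) ^ 2 •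
        SchwartzMap.fourierMultiplierCLM ℂ ((fun x : Space d => ‖x‖ ^ 2) * g) ψ := by
    rw [SchwartzMap.laplacian_eq_fourierMultiplierCLM]
    congr 1
    exact SchwartzMap.fourierMultiplierCLM_fourierMultiplierCLM_apply hn ht ψ
  rw [e, neg_smul, sub_neg_eq_add]
  simp only [SchwartzMap.fourierMultiplierCLM_apply]
  rw [← FourierTransform.fourierInv_smul, ← FourierTransform.fourierInv_add]
  conv_rhs => rw [← FourierTransform.fourierInv_fourier_eq (F := SchwartzMap (Space d) ℂ) ψ]
  congr 1
  ext x
  have hp : 0 < 1 + ‖(2 * Real.pi) • x‖ ^ 2 := by positivity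
  have h1 : g x * (1 + (2 * Real.pi) ^ 2 * ‖x‖ ^ 2) = 1 := by
    have : (1 + (2 * Real.pi) ^ 2 * ‖x‖ ^ 2) = 1 + ‖(2 * Real.pi) • x‖ ^ 2 := by
      rw [norm_smul, mul_pow ‖_‖, Real.norm_eq_abs, sq_abs]
    rw [this]
    change (1 + ‖(2 * Real.pi) • x‖ ^ 2) ^ (-1 : ℝ) * _ = 1
    rw [Real.rpow_neg_one]
    exact inv_mul_cancel₀ hp.ne'
  simp only [_root_.add_apply, _root_.smul_apply, SchwartzMap.smulLeftCLM_apply_apply ht,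
    SchwartzMap.smulLeftCLM_apply_apply hng, Pi.mul_apply, smul_smul, ← add_smul]
  rw [show g x + (2 * Real.pi) ^ 2 * (‖x‖ ^ 2 * g x) = g x * (1 + (2 * Real.pi) ^ 2 * ‖x‖ ^ 2) by ring,
    h1, one_smul]

/-- `H¹` functions are limits of test functions on the punctured space. -/
theorem IsWeakGrad.mem_closure (hd : 3 ≤ d) {f : L2 d} {F : L2Vec d} (h : IsWeakGrad f F) :
    (WithLp.toLp 2 (f, F) : WithLp 2 (L2 d × L2Vec d)) ∈ graphCl (jMap d) (dMap d 0) := by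
  have hd2 : 2 ≤ d := by omega
  set Γ := graphCl (jMap d) (dMap d 0) with hΓ
  set w : WithLp 2 (L2 d × L2Vec d) := WithLp.toLp 2 (f, F) with hw
  -- Project (f, F) onto the closure Γ of the test pairs. The residual w - p is still a function
  -- together with its weak gradient, and it is orthogonal to Γ in H¹; both facts together force it
  -- to vanish.
  set p := Γ.starProjection w with hp
  have hpm : p ∈ Γ := Submodule.starProjection_apply_mem _ _
  -- The weak gradient identity for the residual: it holds for (f, F) by hypothesis, and for p
  -- because it holds between two test functions and extends to Γ in one entry.
  have htest : ∀ (ψ : PTest d) (i : Fin d), inner ℂ (coordOp i (dMap d 0 ψ)) (w - p).fst =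
      - inner ℂ (jMap d ψ) (coordOp i (w - p).snd) := by
    intro ψ i
    have h1 := h.inner_test hd2 ψ i
    have h2 := inner_test_extend (fun φ => inner_test_test hd2 φ ψ i) hpm
    have h3 := congrArg (starRingEnd ℂ) h2
    rw [map_neg, inner_conj_symm, inner_conj_symm] at h3
    have e1 : (w - p).fst = f - p.fst := rfl
    have e2 : (w - p).snd = F - p.snd := rfl
    rw [e1, e2, map_sub, inner_sub_right, inner_sub_right, h1, h3]
    ring
  have hext : ∀ v ∈ Γ, ∀ i : Fin d, inner ℂ (coordOp i v.snd) (w - p).fst =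
      - inner ℂ v.fst (coordOp i (w - p).snd) := fun v hv i =>
    inner_test_extend (fun ψ => htest ψ i) hv
  have horth : ∀ v ∈ Γ, inner ℂ v.fst (w - p).fst + inner ℂ v.snd (w - p).snd = 0 := by
    intro v hv
    have h1 := (Submodule.mem_orthogonal _ _).1
      (Submodule.sub_starProjection_mem_orthogonal (K := Γ) w) v hv
    rwa [WithLp.prod_inner_apply] at h1
  have hgm : ∀ φ : SchwartzMap (Space d) ℂ, MemLp (grad φ) 2 volume := by
    intro φ
    refine MemLp.of_eval_piLp fun i => ?_
    exact (LineDeriv.lineDerivOp (EuclideanSpace.single i (1 : ℝ) : Space d) φ).memLp 2 volume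
  have hf : (w - p).fst = 0 := by
    refine jMap_dense (by omega) _ fun ψ => ?_
    -- Test the residual (r, R) with ψ = φ - Δφ. The pairs (∂ᵢφ, ∇∂ᵢφ) lie in Γ, so ⟨Δφ, r⟩ = -⟨∇φ,
    -- R⟩ and ⟨ψ, r⟩ = ⟨φ, r⟩ + ⟨∇φ, R⟩, which is 0 by orthogonality to (φ, ∇φ). Since φ need not
    -- have compact support, Γ had to be shown to contain the Schwartz functions.
    obtain ⟨φ, hφ⟩ := exists_schwartz_one_sub_laplacian
      (ψ.hasCompactSupport.toSchwartzMap (ptest_smooth ψ))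
    set e : Fin d → Space d := fun i => EuclideanSpace.single i (1 : ℝ) with he
    set D : Fin d → SchwartzMap (Space d) ℂ := fun i => LineDeriv.lineDerivOp (e i) φ with hD
    set DD : Fin d → SchwartzMap (Space d) ℂ := fun i => LineDeriv.lineDerivOp (e i) (D i) with hDD
    have hlap : Laplacian.laplacian φ = ∑ i, DD i := by
      rw [SchwartzMap.laplacian_eq_sum (EuclideanSpace.basisFun (Fin d) ℝ)]
      simp [hDD, hD, he]
    have hcoord : ∀ (χ : SchwartzMap (Space d) ℂ) (i : Fin d),
        coordOp i ((hgm χ).toLp _) =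
          ((LineDeriv.lineDerivOp (e i) χ : SchwartzMap (Space d) ℂ)).toLp 2 volume := by
      intro χ i
      refine Lp.ext ?_
      filter_upwards [coordOp_coeFn i ((hgm χ).toLp _), (hgm χ).coeFn_toLp,
        (LineDeriv.lineDerivOp (e i) χ : SchwartzMap (Space d) ℂ).coeFn_toLp 2 volume] with x h1 h2 h3
      rw [h1, h2, h3]
      rfl
    have h1 := horth _ (gradPair_mem_of_schwartz hd φ (φ.memLp 2 volume) (hgm φ))
    have h2 : ∀ i, inner ℂ ((DD i).toLp 2 volume) (w - p).fst =
        - inner ℂ ((D i).toLp 2 volume) (coordOp i (w - p).snd) := by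
      intro i
      have := hext _ (gradPair_mem_of_schwartz hd (D i) ((D i).memLp 2 volume) (hgm (D i))) i
      change inner ℂ (coordOp i ((hgm (D i)).toLp _)) _ = - inner ℂ ((D i).toLp 2 volume) _ at this
      rwa [hcoord] at this
    change inner ℂ (φ.toLp 2 volume) _ + inner ℂ ((hgm φ).toLp _) _ = 0 at h1
    rw [inner_eq_sum_coordOp] at h1
    simp_rw [hcoord] at h1
    have h3 : jMap d ψ = φ.toLp 2 volume - ∑ i, (DD i).toLp 2 volume := by
      have e2 : (ψ.hasCompactSupport.toSchwartzMap (ptest_smooth ψ)).toLp 2 volume = jMap d ψ := rfl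
      have e1 := congrArg (SchwartzMap.toLpCLM ℂ ℂ 2 volume) hφ
      rw [map_sub, hlap, map_sum] at e1
      exact (e1.trans e2).symm
    rw [h3, inner_sub_left, sum_inner]
    simp_rw [h2]
    rw [Finset.sum_neg_distrib, sub_neg_eq_add]
    exact h1
  have hF : (w - p).snd = 0 := by
    refine eq_zero_of_coordOp fun i => jMap_dense (by omega) _ fun ψ => ?_
    have := htest ψ i
    rw [hf, inner_zero_right] at this
    simpa using this.symm
  have : w = p := by
    rw [← sub_eq_zero]
    exact (WithLp.ofLp_injective 2) (Prod.ext hf hF)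
  rw [this]
  exact hpm

end density

/-! ### Multiplication by scalar functions and by vector fields -/

section multiplication

variable {d : ℕ} {E : Type*} [NormedAddCommGroup E] [NormedSpace ℂ E]

/-- Multiplication by a bounded scalar function on `L²`. -/
def mulOp (η : Space d → ℂ) (hη : AEStronglyMeasurable η volume) (C : ℝ) (hC : ∀ x, ‖η x‖ ≤ C) :
    Lp E 2 (volume : Measure (Space d)) →L[ℂ] Lp E 2 (volume : Measure (Space d)) :=
  pwOp (fun x => η x • ContinuousLinearMap.id ℂ E) (hη.smul aestronglyMeasurable_const) C fun x => by
    rw [norm_smul]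
    exact (mul_le_of_le_one_right (norm_nonneg _) ContinuousLinearMap.norm_id_le).trans (hC x)

theorem mulOp_coeFn {η : Space d → ℂ} (hη : AEStronglyMeasurable η volume) {C : ℝ}
    (hC : ∀ x, ‖η x‖ ≤ C) (f : Lp E 2 (volume : Measure (Space d))) :
    mulOp η hη C hC f =ᵐ[volume] fun x => η x • f x :=
  pwOp_coeFn _ _ f

/-- Multiplication of a scalar function by a bounded vector field. -/
def vecMulOp (V : Space d → CSpace d) (hV : AEStronglyMeasurable V volume) (C : ℝ)
    (hC : ∀ x, ‖V x‖ ≤ C) : L2 d →L[ℂ] L2Vec d :=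
  pwOp (fun x => ContinuousLinearMap.smulRightL ℂ ℂ (CSpace d) 1 (V x))
    ((ContinuousLinearMap.smulRightL ℂ ℂ (CSpace d) 1).continuous.comp_aestronglyMeasurable hV) C
    fun x => by
      change ‖ContinuousLinearMap.smulRight (1 : ℂ →L[ℂ] ℂ) (V x)‖ ≤ C
      rw [ContinuousLinearMap.norm_smulRight_apply]
      exact (mul_le_of_le_one_left (norm_nonneg _) ContinuousLinearMap.norm_id_le).trans (hC x)

theorem vecMulOp_coeFn {V : Space d → CSpace d} (hV : AEStronglyMeasurable V volume) {C : ℝ}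
    (hC : ∀ x, ‖V x‖ ≤ C) (f : L2 d) : vecMulOp V hV C hC f =ᵐ[volume] fun x => f x • V x :=
  (pwOp_coeFn _ _ f).trans (Eventually.of_forall fun x => by simp)

/-- The pointwise inner product with a bounded vector field. -/
def dotOp (V : Space d → CSpace d) (hV : AEStronglyMeasurable V volume) (C : ℝ)
    (hC : ∀ x, ‖V x‖ ≤ C) : L2Vec d →L[ℂ] L2 d :=
  pwOp (fun x => innerSL ℂ (V x)) ((innerSL ℂ).continuous.comp_aestronglyMeasurable hV) C
    fun x => by rw [innerSL_apply_norm]; exact hC x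

theorem dotOp_coeFn {V : Space d → CSpace d} (hV : AEStronglyMeasurable V volume) {C : ℝ}
    (hC : ∀ x, ‖V x‖ ≤ C) (F : L2Vec d) :
    dotOp V hV C hC F =ᵐ[volume] fun x => inner ℂ (V x) (F x) :=
  pwOp_coeFn _ _ F

/-- A real vector as a complex vector. -/
def cvec (x : Space d) : CSpace d := WithLp.toLp 2 fun i => (x i : ℂ)

theorem continuous_cvec : Continuous (cvec (d := d)) :=
  (PiLp.continuous_toLp 2 _).comp (continuous_pi fun i =>
    Complex.continuous_ofReal.comp (EuclideanSpace.proj i : Space d →L[ℝ] ℝ).continuous)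

theorem norm_cvec (x : Space d) : ‖cvec x‖ = ‖x‖ := by
  simp [cvec, EuclideanSpace.norm_eq]

end multiplication

/-! ### Hardy's inequality and the operator `D` on `H¹` -/

section hardy

variable {d : ℕ}

theorem norm_inv_smul_le (x : Space d) : ‖cvec (‖x‖⁻¹ • x)‖ ≤ 1 := by
  rw [norm_cvec, norm_smul, norm_inv, norm_norm]
  exact inv_mul_le_one

theorem aestronglyMeasurable_dir :
    AEStronglyMeasurable (fun x : Space d => cvec (‖x‖⁻¹ • x)) volume :=
  continuous_cvec.comp_aestronglyMeasurable
    ((measurable_norm.inv.smul measurable_id).aestronglyMeasurable)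

/-- Multiplication by `x/|x|`. -/
def radOp (d : ℕ) : L2 d →L[ℂ] L2Vec d :=
  vecMulOp (fun x => cvec (‖x‖⁻¹ • x)) aestronglyMeasurable_dir 1 norm_inv_smul_le

theorem contAt_inv_norm (x : Space d) (hx : x ≠ 0) :
    ContinuousAt (fun x : Space d => ((‖x‖⁻¹ : ℝ) : ℂ)) x :=
  Complex.continuous_ofReal.continuousAt.comp
    (continuous_norm.continuousAt.inv₀ (norm_ne_zero_iff.2 hx))

theorem memLp_hardy (φ : PTest d) :
    MemLp (fun x => ((‖x‖⁻¹ : ℝ) : ℂ) * φ x) 2 (volume : Measure (Space d)) :=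
  (continuous_mul_of _ contAt_inv_norm φ.continuous (not_mem_tsupport φ)).memLp_of_hasCompactSupport
    φ.hasCompactSupport.mul_left

/-- The operator `φ ↦ φ/|x|` on test functions. -/
def hMap (d : ℕ) : PTest d →ₗ[ℂ] L2 d where
  toFun φ := (memLp_hardy φ).toLp _
  map_add' φ ψ := by
    rw [← MemLp.toLp_add]; congr 1; ext x; exact mul_add _ _ _
  map_smul' c φ := by
    rw [RingHom.id_apply, ← MemLp.toLp_const_smul]; congr 1; ext x
    have : (c • φ) x = c * φ x := rfl
    simp only [this, Pi.smul_apply, smul_eq_mul]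
    ring

theorem hMap_coeFn (φ : PTest d) : hMap d φ =ᵐ[volume] fun x => ((‖x‖⁻¹ : ℝ) : ℂ) * φ x :=
  (memLp_hardy φ).coeFn_toLp

/-- Both ‖D_a φ‖² and ‖D_0 φ‖² are values of quadratic forms that differ only by a∫|φ|²/|x|². The
endpoint a = -((d-2)/2)² is allowed, and Hardy's inequality comes from there. -/
theorem norm_dMap_sq {a : ℝ} (ha : -(((d : ℝ) - 2) / 2) ^ 2 ≤ a) (φ : PTest d) :
    ‖dMap d a φ‖ ^ 2 = ‖dMap d 0 φ‖ ^ 2 + a * ‖hMap d φ‖ ^ 2 := by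
  have ha0 : -(((d : ℝ) - 2) / 2) ^ 2 ≤ 0 := neg_nonpos.2 (sq_nonneg _)
  have h1 := inner_dMap ha φ φ
  have h2 := inner_dMap ha0 φ φ
  have h3 : inner ℂ (hMap d φ) (hMap d φ) =
      ∫ x, ((1 / ‖x‖ ^ 2 : ℝ) : ℂ) * inner ℂ (φ x) (φ x) := by
    rw [L2.inner_def]
    refine integral_congr_ae ?_
    filter_upwards [hMap_coeFn φ] with x hx
    rw [hx]
    simp only [RCLike.inner_apply, map_mul, Complex.conj_ofReal]
    push_cast
    ring
  have hg : Continuous fun x => inner ℂ (φ x) (φ x) := φ.continuous.inner φ.continuous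
  have hgs : tsupport (fun x => inner ℂ (φ x) (φ x)) ⊆ tsupport φ := by
    refine closure_mono fun x hx => ?_
    contrapose! hx
    simp only [Function.mem_support, not_not] at hx ⊢
    simp [hx]
  have I1 : Integrable fun x => ((1 / ‖x‖ ^ 2 : ℝ) : ℂ) * inner ℂ (φ x) (φ x) := by
    refine integrable_mul_of _ (fun x hx => ?_) hg (φ.hasCompactSupport.mono'
      ((subset_tsupport _).trans hgs)) (fun h => not_mem_tsupport φ (hgs h))
    have hn : ‖x‖ ^ 2 ≠ 0 := by positivity
    refine Complex.continuous_ofReal.continuousAt.comp ?_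
    fun_prop (disch := assumption)
  have I0 : Integrable fun x => inner ℂ (grad φ x) (grad φ x) := by
    refine ((continuous_grad ((ptest_smooth φ).of_le (by exact_mod_cast le_top))).inner
      (continuous_grad ((ptest_smooth φ).of_le
        (by exact_mod_cast le_top)))).integrable_of_hasCompactSupport ?_
    refine HasCompactSupport.intro φ.hasCompactSupport fun x hx => ?_
    simp [grad_eq_zero hx]
  have h4 : sesqForm a φ φ = sesqForm 0 φ φ + (a : ℂ) * inner ℂ (hMap d φ) (hMap d φ) := by
    rw [h3, ← integral_const_mul]
    unfold sesqForm
    simp only [zero_div, Complex.ofReal_zero, zero_mul, add_zero]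
    rw [← integral_add I0 (I1.const_mul _)]
    congr 1; ext x; push_cast; ring
  rw [← h1, ← h2, inner_self_eq_norm_sq_to_K, inner_self_eq_norm_sq_to_K,
    inner_self_eq_norm_sq_to_K] at h4
  refine Complex.ofReal_injective ?_
  push_cast
  exact h4

/-- Hardy's inequality on test functions. -/
theorem hardy_test (φ : PTest d) :
    (((d : ℝ) - 2) / 2) ^ 2 * ‖hMap d φ‖ ^ 2 ≤ ‖dMap d 0 φ‖ ^ 2 := by
  -- At the critical coupling the left side is still a square, hence nonnegative: this is Hardy's
  -- inequality with its sharp constant.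
  have h := norm_dMap_sq (le_refl (-(((d : ℝ) - 2) / 2) ^ 2)) φ
  nlinarith [sq_nonneg ‖dMap d (-(((d : ℝ) - 2) / 2) ^ 2) φ‖]

theorem half_dim_pos (hd : 3 ≤ d) : 0 < ((d : ℝ) - 2) / 2 := by
  have : (3 : ℝ) ≤ d := by exact_mod_cast hd
  linarith

theorem hardy_test_norm (hd : 3 ≤ d) (φ : PTest d) :
    ‖hMap d φ‖ ≤ (((d : ℝ) - 2) / 2)⁻¹ * ‖dMap d 0 φ‖ := by
  have h := hardy_test φ
  have hp := half_dim_pos hd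
  rw [le_inv_mul_iff₀ hp]
  refine le_of_sq_le_sq ?_ (norm_nonneg _)
  rwa [mul_pow]

/-- The coercivity constant of the quadratic form. -/
def coerConst (d : ℕ) (a : ℝ) : ℝ := min 1 (1 + a / (((d : ℝ) - 2) / 2) ^ 2)

theorem coerConst_pos (hd : 3 ≤ d) {a : ℝ} (ha : -(((d : ℝ) - 2) / 2) ^ 2 < a) :
    0 < coerConst d a := by
  have hp := half_dim_pos hd
  refine lt_min one_pos ?_
  have : -1 < a / (((d : ℝ) - 2) / 2) ^ 2 := by
    rw [lt_div_iff₀ (by positivity)]; linarith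
  linarith

/-- Here x stands for ‖∇f‖² and y for ‖f/|x|‖². For a ≥ 0 the potential term is dropped; for a < 0
Hardy's inequality bounds it by a multiple of x. -/
theorem coercive_aux (hd : 3 ≤ d) {a x y : ℝ} (hy : 0 ≤ y)
    (h : (((d : ℝ) - 2) / 2) ^ 2 * y ≤ x) : coerConst d a * x ≤ x + a * y := by
  have hp := half_dim_pos hd
  have hx : 0 ≤ x := le_trans (by positivity) h
  rcases le_total 0 a with h0 | h0
  · calc _ ≤ 1 * x := by gcongr; exact min_le_left _ _
      _ ≤ _ := by nlinarith
  · calc _ ≤ (1 + a / (((d : ℝ) - 2) / 2) ^ 2) * x := by gcongr; exact min_le_right _ _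
      _ = x + a * (x / (((d : ℝ) - 2) / 2) ^ 2) := by ring
      _ ≤ _ := by
        have : y ≤ x / (((d : ℝ) - 2) / 2) ^ 2 := by
          rw [le_div_iff₀ (by positivity)]; linarith
        nlinarith

theorem coercive_test (hd : 3 ≤ d) {a : ℝ} (ha : -(((d : ℝ) - 2) / 2) ^ 2 < a) (φ : PTest d) :
    coerConst d a * ‖dMap d 0 φ‖ ^ 2 ≤ ‖dMap d a φ‖ ^ 2 := by
  rw [norm_dMap_sq ha.le]
  exact coercive_aux hd (sq_nonneg _) (hardy_test φ)

/-- The singular field x/|x|² is split as the bounded field x/|x| times 1/|x|. Hardy's inequality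
controls φ/|x|, so D_a is controlled by the gradient. -/
theorem dMap_eq (hd : 2 ≤ d) (a : ℝ) (φ : PTest d) :
    dMap d a φ = dMap d 0 φ + (rho d a : ℂ) • radOp d (hMap d φ) := by
  refine Lp.ext ?_
  filter_upwards [dMap_coeFn a φ, dMap_coeFn 0 φ,
    Lp.coeFn_add (dMap d 0 φ) ((rho d a : ℂ) • radOp d (hMap d φ)),
    Lp.coeFn_smul (rho d a : ℂ) (radOp d (hMap d φ)),
    vecMulOp_coeFn aestronglyMeasurable_dir norm_inv_smul_le (hMap d φ), hMap_coeFn φ]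
    with x h1 h2 h3 h4 h5 h6
  have h5' : radOp d (hMap d φ) x = hMap d φ x • cvec (‖x‖⁻¹ • x) := h5
  rw [h1, h3, Pi.add_apply, h2, h4, Pi.smul_apply, h5', h6, dop_zero hd]
  ext i
  simp only [dop, grad, cvec, PiLp.add_apply, PiLp.smul_apply, smul_eq_mul, wt]
  push_cast
  ring

theorem exists_subseq_tendsto_ae {X E : Type*} [MeasurableSpace X] {ν : Measure X}
    [NormedAddCommGroup E] {f : ℕ → Lp E 2 ν} {g : Lp E 2 ν} (h : Tendsto f atTop (𝓝 g)) :
    ∃ ns : ℕ → ℕ, StrictMono ns ∧ ∀ᵐ x ∂ν, Tendsto (fun i => f (ns i) x) atTop (𝓝 (g x)) :=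
  (tendstoInMeasure_of_tendsto_Lp h).exists_seq_tendsto_ae

/-- Multiplication by 1/|x| is a closed operator: along a common subsequence both L² limits are also
almost everywhere limits. -/
theorem ae_of_tendsto_hMap {φ : ℕ → PTest d} {f η : L2 d}
    (h1 : Tendsto (fun n => jMap d (φ n)) atTop (𝓝 f))
    (h2 : Tendsto (fun n => hMap d (φ n)) atTop (𝓝 η)) :
    η =ᵐ[volume] fun x => ((‖x‖⁻¹ : ℝ) : ℂ) * f x := by
  obtain ⟨n1, hn1, l1⟩ := exists_subseq_tendsto_ae h1
  obtain ⟨n2, hn2, l2⟩ := exists_subseq_tendsto_ae (h2.comp hn1.tendsto_atTop)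
  filter_upwards [l1, l2, ae_all_iff.2 fun n => jMap_coeFn (φ n),
    ae_all_iff.2 fun n => hMap_coeFn (φ n)] with x m1 m2 e1 e2
  have m3 := (m1.comp hn2.tendsto_atTop).const_mul ((‖x‖⁻¹ : ℝ) : ℂ)
  refine tendsto_nhds_unique m2 (m3.congr fun n => ?_)
  simp only [Function.comp_apply]
  rw [e1, e2]

theorem cauchySeq_of_norm_le {V H K : Type*} [AddCommGroup V] [Module ℂ V] [NormedAddCommGroup H]
    [Module ℂ H] [NormedAddCommGroup K] [Module ℂ K] (A : V →ₗ[ℂ] H) (B : V →ₗ[ℂ] K) {C : ℝ}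
    (h : ∀ φ, ‖A φ‖ ≤ C * ‖B φ‖) {φ : ℕ → V} (hB : CauchySeq fun n => B (φ n)) :
    CauchySeq fun n => A (φ n) := by
  rw [Metric.cauchySeq_iff] at hB ⊢
  intro ε hε
  obtain ⟨N, hN⟩ := hB (ε / (|C| + 1)) (by positivity)
  refine ⟨N, fun m hm n hn => ?_⟩
  have h1 := hN m hm n hn
  rw [dist_eq_norm, ← map_sub] at h1 ⊢
  rw [lt_div_iff₀ (by positivity)] at h1
  calc _ ≤ C * ‖B (φ m - φ n)‖ := h _
    _ ≤ ‖B (φ m - φ n)‖ * (|C| + 1) := by nlinarith [le_abs_self C, norm_nonneg (B (φ m - φ n))]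
    _ < ε := h1

/-- An `H¹` function belongs to the form domain of `L_a`, with `D f = ∇f + ρ x/|x|² f`. -/
theorem exists_hardy (hd : 3 ≤ d) {a : ℝ} (ha : -(((d : ℝ) - 2) / 2) ^ 2 < a) {f : L2 d}
    {F : L2Vec d} (h : (WithLp.toLp 2 (f, F) : WithLp 2 (L2 d × L2Vec d)) ∈
      graphCl (jMap d) (dMap d 0)) :
    ∃ η : L2 d, (η =ᵐ[volume] fun x => ((‖x‖⁻¹ : ℝ) : ℂ) * f x) ∧
      (WithLp.toLp 2 (f, F + (rho d a : ℂ) • radOp d η) : WithLp 2 (L2 d × L2Vec d)) ∈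
        graphCl (jMap d) (dMap d a) ∧
      ‖F + (rho d a : ℂ) • radOp d η‖ ^ 2 = ‖F‖ ^ 2 + a * ‖η‖ ^ 2 ∧
      (((d : ℝ) - 2) / 2) ^ 2 * ‖η‖ ^ 2 ≤ ‖F‖ ^ 2 := by
  obtain ⟨φ, h1, h2⟩ := (mem_graphCl_seq _ _ _).1 h
  obtain ⟨η, hη⟩ := cauchySeq_tendsto_of_complete
    (cauchySeq_of_norm_le (hMap d) (dMap d 0) (hardy_test_norm hd) h2.cauchySeq)
  have h3 : Tendsto (fun n => dMap d a (φ n)) atTop (𝓝 (F + (rho d a : ℂ) • radOp d η)) := by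
    simp_rw [dMap_eq (show 2 ≤ d by omega) a]
    exact h2.add ((((radOp d).continuous.tendsto η).comp hη).const_smul _)
  refine ⟨η, ae_of_tendsto_hMap h1 hη, (mem_graphCl_seq _ _ _).2 ⟨φ, h1, h3⟩, ?_, ?_⟩
  · refine tendsto_nhds_unique (h3.norm.pow 2) ?_
    simp_rw [norm_dMap_sq ha.le]
    exact (h2.norm.pow 2).add ((hη.norm.pow 2).const_mul a)
  · exact le_of_tendsto_of_tendsto' ((hη.norm.pow 2).const_mul _) (h2.norm.pow 2)
      fun n => hardy_test (φ n)

/-- Elements of the form domain are determined by their first component. -/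
theorem eq_zero_of_mem_graphCl (hd : 3 ≤ d) {a : ℝ} (ha : -(((d : ℝ) - 2) / 2) ^ 2 < a)
    {w : WithLp 2 (L2 d × L2Vec d)} (hw : w ∈ graphCl (jMap d) (dMap d a)) (h0 : w.fst = 0) :
    w = 0 := by
  obtain ⟨φ, h1, h2⟩ := (mem_graphCl_seq _ _ _).1 hw
  have hc := coerConst_pos hd ha
  -- By coercivity, convergence of D_a φ_n forces convergence of ∇φ_n, and then of φ_n/|x| by
  -- Hardy's inequality. The first operator is closable by integration by parts and the second by
  -- almost everywhere limits, so φ_n → 0 makes both limits vanish, and D_a is closable too.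
  have hle : ∀ φ, ‖dMap d 0 φ‖ ≤ √(coerConst d a)⁻¹ * ‖dMap d a φ‖ := by
    intro φ
    refine le_of_sq_le_sq ?_ (by positivity)
    rw [mul_pow, Real.sq_sqrt (by positivity), le_inv_mul_iff₀ hc]
    exact coercive_test hd ha φ
  obtain ⟨F, hF⟩ := cauchySeq_tendsto_of_complete
    (cauchySeq_of_norm_le (dMap d 0) (dMap d a) hle h2.cauchySeq)
  obtain ⟨η, hη⟩ := cauchySeq_tendsto_of_complete
    (cauchySeq_of_norm_le (hMap d) (dMap d 0) (hardy_test_norm hd) hF.cauchySeq)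
  have h3 : Tendsto (fun n => dMap d a (φ n)) atTop (𝓝 (F + (rho d a : ℂ) • radOp d η)) := by
    simp_rw [dMap_eq (show 2 ≤ d by omega) a]
    exact hF.add ((((radOp d).continuous.tendsto η).comp hη).const_smul _)
  have hη0 : η = 0 := by
    rw [Lp.eq_zero_iff_ae_eq_zero]
    filter_upwards [ae_of_tendsto_hMap h1 hη, (Lp.eq_zero_iff_ae_eq_zero).1 h0] with x h4 h5
    rw [h4, h5]
    simp
  have hF0 : F = 0 := by
    refine eq_zero_of_coordOp fun i => jMap_dense (by omega) _ fun ψ => ?_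
    have h4 : inner ℂ (coordOp i (dMap d 0 ψ)) w.fst = - inner ℂ (jMap d ψ) (coordOp i F) := by
      have l1 := (tendsto_const_nhds (x := coordOp i (dMap d 0 ψ))).inner (𝕜 := ℂ) h1
      have l2 := ((tendsto_const_nhds (x := jMap d ψ)).inner (𝕜 := ℂ)
        (((coordOp i).continuous.tendsto F).comp hF)).neg
      refine tendsto_nhds_unique l1 (l2.congr fun n => ?_)
      exact (inner_test_test (by omega) ψ (φ n) i).symm
    rw [h0, inner_zero_right] at h4
    simpa using h4.symm
  have hs : w.snd = 0 := by
    refine (tendsto_nhds_unique h2 h3).trans ?_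
    simp [hη0, hF0]
  exact (WithLp.ofLp_injective 2) (Prod.ext h0 hs)

end hardy

/-! ### The Sobolev and Gagliardo–Nirenberg inequalities -/

section sobolev

variable {d : ℕ}

/-- The Sobolev exponent `2d/(d-2)`. -/
def sobExp (d : ℕ) : NNReal := Real.toNNReal (2 * d / ((d : ℝ) - 2))

theorem norm_fderiv_le_grad (φ : Space d → ℂ) (x : Space d) : ‖fderiv ℝ φ x‖ ≤ ‖grad φ x‖ := by
  refine ContinuousLinearMap.opNorm_le_bound _ (norm_nonneg _) fun v => ?_
  have h : fderiv ℝ φ x v = inner ℂ (cvec v) (grad φ x) := by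
    rw [fderiv_apply_eq_sum]
    simp [PiLp.inner_apply, cvec, mul_comm]
  rw [h, mul_comm, ← norm_cvec v]
  exact norm_inner_le_norm _ _

theorem exists_sobolev_const (hd : 3 ≤ d) : ∃ C : NNReal, ∀ φ : PTest d,
    eLpNorm φ (sobExp d) volume ≤ C * eLpNorm (grad φ) 2 volume := by
  refine ⟨SNormLESNormFDerivOfEqConst ℂ (volume : Measure (Space d)) (2 : NNReal), fun φ => ?_⟩
  have h3 : (3 : ℝ) ≤ d := by exact_mod_cast hd
  have h := eLpNorm_le_eLpNorm_fderiv_of_eq (volume : Measure (Space d)) (u := φ) (p := 2)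
    (p' := sobExp d) ((ptest_smooth φ).of_le (by exact_mod_cast le_top)) φ.hasCompactSupport
    (by norm_num) (by rw [finrank_euclideanSpace, Fintype.card_fin]; omega) (by
      rw [finrank_euclideanSpace, Fintype.card_fin, sobExp, Real.coe_toNNReal _ (by
        apply div_nonneg <;> linarith)]
      have : (d : ℝ) - 2 ≠ 0 := by linarith
      have : (d : ℝ) ≠ 0 := by linarith
      push_cast
      field_simp)
  refine h.trans ?_
  gcongr
  refine eLpNorm_mono fun x => ?_
  exact norm_fderiv_le_grad φ x

/-- The Sobolev embedding `H¹ ⊂ L^{2d/(d-2)}`. -/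
theorem exists_sobolev (hd : 3 ≤ d) : ∃ C : NNReal, ∀ (f : L2 d) (F : L2Vec d),
    (WithLp.toLp 2 (f, F) : WithLp 2 (L2 d × L2Vec d)) ∈ graphCl (jMap d) (dMap d 0) →
    eLpNorm f (sobExp d) volume ≤ C * ENNReal.ofReal ‖F‖ := by
  obtain ⟨C, hC⟩ := exists_sobolev_const hd
  refine ⟨C, fun f F h => ?_⟩
  obtain ⟨φ, h1, h2⟩ := (mem_graphCl_seq _ _ _).1 h
  obtain ⟨ns, hns, hae⟩ := exists_subseq_tendsto_ae h1
  have hae' : ∀ᵐ x, Tendsto (fun i => φ (ns i) x) atTop (𝓝 (f x)) := by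
    filter_upwards [hae, ae_all_iff.2 fun n => jMap_coeFn (φ n)] with x hx h3
    simpa [h3] using hx
  -- Fatou's lemma along an almost everywhere convergent subsequence carries the inequality from
  -- test functions to the limit.
  have h4 := Lp.eLpNorm_lim_le_liminf_eLpNorm (p := sobExp d) (f := fun n => ⇑(φ (ns n)))
    (fun n => (φ (ns n)).continuous.aestronglyMeasurable) f hae'
  refine h4.trans ?_
  have h5 : Tendsto (fun n => (C : ℝ≥0∞) * ENNReal.ofReal ‖dMap d 0 (φ (ns n))‖) atTop
      (𝓝 (C * ENNReal.ofReal ‖F‖)) := by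
    refine ENNReal.Tendsto.const_mul ?_ (Or.inr ENNReal.coe_ne_top)
    exact (ENNReal.continuous_ofReal.tendsto _).comp ((h2.norm).comp hns.tendsto_atTop)
  rw [← h5.liminf_eq]
  refine liminf_le_liminf (Eventually.of_forall fun n => (hC _).trans (le_of_eq ?_))
  congr 1
  rw [Lp.norm_def, ENNReal.ofReal_toReal (Lp.eLpNorm_ne_top _), eLpNorm_congr_ae (dMap_coeFn 0 _),
    dop_zero (by omega)]

/-- The Gagliardo–Nirenberg inequality. -/
theorem exists_gagliardoNirenberg (hd : 3 ≤ d) {α : ℝ} (hα : 0 < α) (hα' : α < 4 / ((d : ℝ) - 2)) :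
    ∃ C : ℝ, 0 ≤ C ∧ ∀ (f : L2 d) (F : L2Vec d),
    (WithLp.toLp 2 (f, F) : WithLp 2 (L2 d × L2Vec d)) ∈ graphCl (jMap d) (dMap d 0) →
    Integrable (fun x => ‖f x‖ ^ (α + 2)) ∧
    ∫ x, ‖f x‖ ^ (α + 2) ≤
      C * (‖f‖ ^ ((4 - ((d : ℝ) - 2) * α) / 2) * ‖F‖ ^ (d * α / 2)) := by
  obtain ⟨C, hC⟩ := exists_sobolev hd
  refine ⟨(C : ℝ) ^ (d * α / 2), by positivity, fun f F h => ?_⟩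
  have h3 : (3 : ℝ) ≤ d := by exact_mod_cast hd
  have hd2 : 0 < (d : ℝ) - 2 := by linarith
  have hs : (sobExp d : ℝ) = 2 * d / ((d : ℝ) - 2) := by
    rw [sobExp, Real.coe_toNNReal _ (by positivity)]
  have hs0 : 0 < (sobExp d : ℝ) := by rw [hs]; positivity
  -- The Hölder weight for which 2(1 - θ) + θ·2d/(d-2) = α + 2. It is below 1 because α is
  -- energy-subcritical.
  set θ : ℝ := α * ((d : ℝ) - 2) / 4 with hθ
  have hθ0 : 0 ≤ θ := by positivity
  have hθ1 : 0 ≤ 1 - θ := by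
    rw [lt_div_iff₀ hd2] at hα'
    rw [hθ]; linarith
  have hm : AEMeasurable (fun x => ‖f x‖ₑ) volume := (Lp.aestronglyMeasurable f).enorm
  have key := ENNReal.lintegral_mul_norm_pow_le (μ := (volume : Measure (Space d)))
    (f := fun x => ‖f x‖ₑ ^ (2 : ℝ)) (g := fun x => ‖f x‖ₑ ^ (sobExp d : ℝ))
    (hm.pow_const _) (hm.pow_const _) hθ1 hθ0 (by ring)
  have e1 : ∀ x, (‖f x‖ₑ ^ (2 : ℝ)) ^ (1 - θ) * (‖f x‖ₑ ^ (sobExp d : ℝ)) ^ θ =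
      ENNReal.ofReal (‖f x‖ ^ (α + 2)) := by
    intro x
    rw [← ENNReal.rpow_mul, ← ENNReal.rpow_mul, ← ENNReal.rpow_add_of_nonneg _ _ (by positivity)
      (by positivity), ← ofReal_norm, ENNReal.ofReal_rpow_of_nonneg (norm_nonneg _) (by positivity)]
    congr 2
    rw [hs, hθ]; field_simp; ring
  have e2 : (∫⁻ x, ‖f x‖ₑ ^ (2 : ℝ)) ^ (1 - θ) =
      ENNReal.ofReal (‖f‖ ^ ((4 - ((d : ℝ) - 2) * α) / 2)) := by
    have : (∫⁻ x, ‖f x‖ₑ ^ (2 : ℝ)) = ENNReal.ofReal ‖f‖ ^ (2 : ℝ) := by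
      rw [Lp.norm_def, ENNReal.ofReal_toReal (Lp.eLpNorm_ne_top _),
        eLpNorm_eq_lintegral_rpow_enorm_toReal (by norm_num) (by norm_num), ← ENNReal.rpow_mul]
      norm_num
    rw [this, ← ENNReal.rpow_mul, ENNReal.ofReal_rpow_of_nonneg (norm_nonneg _) (by positivity)]
    congr 2
    rw [hθ]; ring
  have e3 : (∫⁻ x, ‖f x‖ₑ ^ (sobExp d : ℝ)) ^ θ ≤
      ENNReal.ofReal ((C : ℝ) ^ (d * α / 2) * ‖F‖ ^ (d * α / 2)) := by
    have h5 : (∫⁻ x, ‖f x‖ₑ ^ (sobExp d : ℝ)) = eLpNorm f (sobExp d) volume ^ (sobExp d : ℝ) := by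
      rw [eLpNorm_eq_lintegral_rpow_enorm_toReal (by exact_mod_cast hs0.ne') (by simp),
        ← ENNReal.rpow_mul]
      simp [hs0.ne']
    rw [h5, ← ENNReal.rpow_mul]
    have h6 : (sobExp d : ℝ) * θ = d * α / 2 := by rw [hs, hθ]; field_simp; ring
    rw [h6, ← Real.mul_rpow (by positivity) (by positivity),
      ← ENNReal.ofReal_rpow_of_nonneg (by positivity) (by positivity),
      ENNReal.ofReal_mul (by positivity), ENNReal.ofReal_coe_nnreal]
    exact ENNReal.rpow_le_rpow (hC f F h) (by positivity)
  have h7 : ∫⁻ x, ENNReal.ofReal (‖f x‖ ^ (α + 2)) ≤ ENNReal.ofReal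
      ((C : ℝ) ^ (d * α / 2) * (‖f‖ ^ ((4 - ((d : ℝ) - 2) * α) / 2) * ‖F‖ ^ (d * α / 2))) := by
    simp_rw [← e1]
    refine key.trans ?_
    rw [e2]
    refine (mul_le_mul_right e3 _).trans (le_of_eq ?_)
    rw [← ENNReal.ofReal_mul (by positivity)]
    congr 1; ring
  have hmeas : AEStronglyMeasurable (fun x => ‖f x‖ ^ (α + 2)) volume :=
    (Real.continuous_rpow_const (by positivity)).comp_aestronglyMeasurable
      (Lp.aestronglyMeasurable f).norm
  refine ⟨⟨hmeas, ?_⟩, ?_⟩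
  · rw [hasFiniteIntegral_iff_ofReal (Eventually.of_forall fun x => by positivity)]
    exact h7.trans_lt ENNReal.ofReal_lt_top
  · rw [integral_eq_lintegral_of_nonneg_ae (Eventually.of_forall fun x => by positivity) hmeas]
    exact ENNReal.toReal_le_of_le_ofReal (by positivity) h7

end sobolev

/-! ### Cutoffs and dilations on the form domain -/

section cutoffs

/-- A smooth compactly supported function. -/
structure Cutoff (d : ℕ) where
  /-- The underlying function. -/
  fn : Space d → ℂ
  smooth : ContDiff ℝ (⊤ : ℕ∞) fn
  compact : HasCompactSupport fn

variable {d : ℕ}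

namespace Cutoff

theorem contDiff_one (η : Cutoff d) : ContDiff ℝ 1 η.fn :=
  η.smooth.of_le (by exact_mod_cast le_top)

theorem differentiable (η : Cutoff d) : Differentiable ℝ η.fn := η.contDiff_one.differentiable (by simp)

/-- The partial derivative of a cutoff. -/
def pderiv (η : Cutoff d) (i : Fin d) : Cutoff d where
  fn := pd i η.fn
  smooth := (η.smooth.fderiv_right (m := (⊤ : ℕ∞)) (by simp)).clm_apply contDiff_const
  compact := η.compact.mono' ((subset_tsupport _).trans (tsupport_fderiv_apply_subset ℝ _))

theorem exists_bound (η : Cutoff d) : ∃ C, ∀ x, ‖η.fn x‖ ≤ C :=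
  η.compact.exists_bound_of_continuous η.smooth.continuous

theorem exists_bound_grad (η : Cutoff d) : ∃ C, ∀ x, ‖grad η.fn x‖ ≤ C :=
  (hasCompactSupport_grad η.compact).exists_bound_of_continuous (continuous_grad η.contDiff_one)

/-- The vector field `conj(η) x`. -/
def field (η : Cutoff d) (x : Space d) : CSpace d := (starRingEnd ℂ) (η.fn x) • cvec x

theorem continuous_field (η : Cutoff d) : Continuous η.field :=
  (Complex.continuous_conj.comp η.smooth.continuous).smul continuous_cvec

theorem exists_bound_field (η : Cutoff d) : ∃ C, ∀ x, ‖η.field x‖ ≤ C :=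
  HasCompactSupport.exists_bound_of_continuous (HasCompactSupport.intro η.compact fun x hx => by
    simp [field, image_eq_zero_of_notMem_tsupport hx]) η.continuous_field

/-- The function `x·∇η + c η`. -/
def radial (η : Cutoff d) (c : ℂ) (x : Space d) : ℂ := inner ℂ (cvec x) (grad η.fn x) + c * η.fn x

theorem continuous_radial (η : Cutoff d) (c : ℂ) : Continuous (η.radial c) :=
  (continuous_cvec.inner (continuous_grad η.contDiff_one)).add
    (continuous_const.mul η.smooth.continuous)

theorem exists_bound_radial (η : Cutoff d) (c : ℂ) : ∃ C, ∀ x, ‖η.radial c x‖ ≤ C :=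
  HasCompactSupport.exists_bound_of_continuous (HasCompactSupport.intro η.compact fun x hx => by
    simp [radial, image_eq_zero_of_notMem_tsupport hx, grad_eq_zero hx]) (η.continuous_radial c)

/-- Multiplication by a cutoff. -/
def mul {E : Type*} [NormedAddCommGroup E] [NormedSpace ℂ E] (η : Cutoff d) :
    Lp E 2 (volume : Measure (Space d)) →L[ℂ] Lp E 2 (volume : Measure (Space d)) :=
  mulOp η.fn η.smooth.continuous.aestronglyMeasurable _ η.exists_bound.choose_spec

theorem mul_coeFn {E : Type*} [NormedAddCommGroup E] [NormedSpace ℂ E] (η : Cutoff d)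
    (f : Lp E 2 (volume : Measure (Space d))) : η.mul f =ᵐ[volume] fun x => η.fn x • f x :=
  mulOp_coeFn _ _ f

/-- Multiplication by the gradient of a cutoff. -/
def gmul (η : Cutoff d) : L2 d →L[ℂ] L2Vec d :=
  vecMulOp (grad η.fn) (continuous_grad η.contDiff_one).aestronglyMeasurable _
    η.exists_bound_grad.choose_spec

theorem gmul_coeFn (η : Cutoff d) (f : L2 d) :
    η.gmul f =ᵐ[volume] fun x => f x • grad η.fn x :=
  vecMulOp_coeFn _ _ f

/-- The operator `D(η f)`, in terms of `f` and `g = D f`. -/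
def dmul (η : Cutoff d) (f : L2 d) (g : L2Vec d) : L2Vec d := η.mul g + η.gmul f

/-- The generator of dilations, applied to `η f`, in terms of `f` and `g = D f`. -/
def gen (a : ℝ) (η : Cutoff d) (f : L2 d) (g : L2Vec d) : L2 d :=
  dotOp η.field η.continuous_field.aestronglyMeasurable _ η.exists_bound_field.choose_spec g +
    mulOp (η.radial ((d : ℂ) / 2 - rho d a)) (η.continuous_radial _).aestronglyMeasurable _
      (η.exists_bound_radial _).choose_spec f

theorem gen_coeFn (a : ℝ) (η : Cutoff d) (f : L2 d) (g : L2Vec d) :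
    η.gen a f g =ᵐ[volume] fun x => η.fn x * inner ℂ (cvec x) (g x) +
      (inner ℂ (cvec x) (grad η.fn x) + ((d : ℂ) / 2 - rho d a) * η.fn x) * f x := by
  filter_upwards [Lp.coeFn_add (dotOp η.field η.continuous_field.aestronglyMeasurable _
      η.exists_bound_field.choose_spec g) (mulOp (η.radial ((d : ℂ) / 2 - rho d a))
      (η.continuous_radial _).aestronglyMeasurable _ (η.exists_bound_radial _).choose_spec f),
    dotOp_coeFn η.continuous_field.aestronglyMeasurable η.exists_bound_field.choose_spec g,
    mulOp_coeFn (η.continuous_radial ((d : ℂ) / 2 - rho d a)).aestronglyMeasurable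
      (η.exists_bound_radial _).choose_spec f] with x h1 h2 h3
  rw [gen, h1, Pi.add_apply, h2, h3]
  simp only [field, radial, inner_smul_left, Complex.conj_conj, smul_eq_mul]

theorem exists_gen_bound (a : ℝ) (η : Cutoff d) : ∃ C, 0 ≤ C ∧ ∀ f g,
    ‖η.gen a f g‖ ≤ C * (‖f‖ + ‖g‖) := by
  set A := dotOp η.field η.continuous_field.aestronglyMeasurable _ η.exists_bound_field.choose_spec
  set B := mulOp (E := ℂ) (η.radial ((d : ℂ) / 2 - rho d a))
    (η.continuous_radial _).aestronglyMeasurable _ (η.exists_bound_radial _).choose_spec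
  refine ⟨‖A‖ + ‖B‖, by positivity, fun f g => ?_⟩
  calc ‖A g + B f‖ ≤ ‖A‖ * ‖g‖ + ‖B‖ * ‖f‖ :=
        (norm_add_le _ _).trans (add_le_add (A.le_opNorm _) (B.le_opNorm _))
    _ ≤ _ := by nlinarith [norm_nonneg A, norm_nonneg B, norm_nonneg f, norm_nonneg g]

theorem exists_dmul_bound (η : Cutoff d) : ∃ C, 0 ≤ C ∧ ∀ f g,
    ‖η.dmul f g‖ ≤ C * (‖f‖ + ‖g‖) := by
  obtain ⟨A, hA⟩ : ∃ A, A = η.mul (E := CSpace d) := ⟨_, rfl⟩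
  obtain ⟨B, hB⟩ : ∃ B, B = η.gmul := ⟨_, rfl⟩
  refine ⟨‖A‖ + ‖B‖, by positivity, fun f g => ?_⟩
  rw [dmul, ← hA, ← hB]
  calc ‖A g + B f‖ ≤ ‖A‖ * ‖g‖ + ‖B‖ * ‖f‖ :=
        (norm_add_le _ _).trans (add_le_add (A.le_opNorm _) (B.le_opNorm _))
    _ ≤ _ := by nlinarith [norm_nonneg A, norm_nonneg B, norm_nonneg f, norm_nonneg g]

/-- The product of a cutoff and a test function. -/
def mulTest (η : Cutoff d) (φ : PTest d) : PTest d :=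
  ⟨fun x => η.fn x * φ x, η.smooth.mul (ptest_smooth φ), φ.hasCompactSupport.mul_left,
    (tsupport_mul_subset_right).trans φ.tsupport_subset⟩

theorem jMap_mulTest (η : Cutoff d) (φ : PTest d) : jMap d (η.mulTest φ) = η.mul (jMap d φ) := by
  refine Lp.ext ?_
  filter_upwards [jMap_coeFn (η.mulTest φ), η.mul_coeFn (jMap d φ), jMap_coeFn φ] with x h1 h2 h3
  rw [h1, h2, h3]
  rfl

theorem dop_mulTest (a : ℝ) (η : Cutoff d) (φ : PTest d) (x : Space d) :
    dop a (η.mulTest φ) x = η.fn x • dop a φ x + φ x • grad η.fn x := by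
  have e : ⇑(η.mulTest φ) = fun x => η.fn x * φ x := rfl
  have h := grad_mul (η.differentiable x) ((ptest_smooth φ).differentiable (by simp) x)
  have h' : ∀ i, pd i (fun x => η.fn x * φ x) x = η.fn x * pd i φ x + φ x * pd i η.fn x := fun i => by
    have := congrArg (fun v : CSpace d => v i) h
    simpa [grad] using this
  ext i
  simp only [dop, e, h', grad, PiLp.add_apply, PiLp.smul_apply, smul_eq_mul]
  ring

theorem dMap_mulTest (a : ℝ) (η : Cutoff d) (φ : PTest d) :
    dMap d a (η.mulTest φ) = η.dmul (jMap d φ) (dMap d a φ) := by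
  refine Lp.ext ?_
  filter_upwards [dMap_coeFn a (η.mulTest φ), Lp.coeFn_add (η.mul (dMap d a φ)) (η.gmul (jMap d φ)),
    η.mul_coeFn (dMap d a φ), η.gmul_coeFn (jMap d φ), jMap_coeFn φ, dMap_coeFn a φ]
    with x h1 h2 h3 h4 h5 h6
  rw [h1, dmul, h2, Pi.add_apply, h3, h4, h5, h6, dop_mulTest]

theorem mul_mem (a : ℝ) (η : Cutoff d) {f : L2 d} {g : L2Vec d}
    (h : (WithLp.toLp 2 (f, g) : WithLp 2 (L2 d × L2Vec d)) ∈ graphCl (jMap d) (dMap d a)) :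
    (WithLp.toLp 2 (η.mul f, η.dmul f g) : WithLp 2 (L2 d × L2Vec d)) ∈
      graphCl (jMap d) (dMap d a) := by
  obtain ⟨φ, h1, h2⟩ := (mem_graphCl_seq _ _ _).1 h
  refine (mem_graphCl_seq _ _ _).2 ⟨fun n => η.mulTest (φ n), ?_, ?_⟩
  · simp_rw [jMap_mulTest]
    exact (η.mul.continuous.tendsto _).comp h1
  · simp_rw [dMap_mulTest]
    exact ((η.mul.continuous.tendsto _).comp h2).add ((η.gmul.continuous.tendsto _).comp h1)

end Cutoff

theorem contDiff_dilFun (s : ℝ) (φ : PTest d) : ContDiff ℝ (⊤ : ℕ∞) (dilFun s φ) := by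
  have h : ContDiff ℝ (⊤ : ℕ∞) fun x : Space d => φ (Real.exp s • x) :=
    (ptest_smooth φ).comp (contDiff_const_smul (Real.exp s))
  exact contDiff_const.mul h

theorem hasCompactSupport_dilFun (s : ℝ) (φ : PTest d) : HasCompactSupport (dilFun s φ) := by
  have h : HasCompactSupport fun x : Space d => φ (Real.exp s • x) :=
    φ.hasCompactSupport.comp_smul (Real.exp_pos s).ne'
  exact h.mul_left (f := fun _ => ((Real.exp (s * (d / 2)) : ℝ) : ℂ))

theorem tsupport_dilFun (s : ℝ) (φ : PTest d) :
    tsupport (dilFun s φ) ⊆ (puncturedSpace d : Set (Space d)) := by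
  intro x hx hx0
  have hx0' : x = 0 := hx0
  subst hx0'
  refine (notMem_tsupport_iff_eventuallyEq.2 ?_) hx
  have h0 := notMem_tsupport_iff_eventuallyEq.1 (not_mem_tsupport φ)
  have hc : Tendsto (fun y : Space d => Real.exp s • y) (𝓝 0) (𝓝 0) :=
    (continuous_const_smul _).tendsto' _ _ (by simp)
  filter_upwards [hc.eventually h0] with y hy
  simp [dilFun, hy]

/-- The dilation of a test function. -/
def dilTest (s : ℝ) (φ : PTest d) : PTest d :=
  ⟨dilFun s φ, contDiff_dilFun s φ, hasCompactSupport_dilFun s φ, tsupport_dilFun s φ⟩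

theorem jMap_dilTest (s : ℝ) (φ : PTest d) : jMap d (dilTest s φ) = dil s (jMap d φ) :=
  (dil_toLp s (ptest_memLp φ)).symm

/-- The weight x/|x|² has the same homogeneity as the gradient, so D `dil s` = e^s `dil s` D. This
exact scaling of D is what produces the kinetic part of the virial. -/
theorem dop_dilTest (a : ℝ) (s : ℝ) (φ : PTest d) (x : Space d) :
    dop a (dilTest s φ) x = (Real.exp s : ℂ) • dilFun s (dop a φ) x := by
  have e : ⇑(dilTest s φ) = dilFun s φ := rfl
  have hpd : ∀ i, pd i (dilFun s φ) x =
      (Real.exp (s * (d / 2)) : ℂ) * (Real.exp s * pd i φ (Real.exp s • x)) := by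
    intro i
    have h1 : DifferentiableAt ℝ (fun x : Space d => φ (Real.exp s • x)) x :=
      ((ptest_smooth φ).comp (contDiff_const_smul _)).differentiable (by simp) x
    have h2 := h1.hasFDerivAt.const_smul (Real.exp (s * (d / 2)) : ℂ)
    have h3 : fderiv ℝ (dilFun s φ) x = (Real.exp (s * (d / 2)) : ℂ) •
      fderiv ℝ (fun x : Space d => φ (Real.exp s • x)) x := h2.fderiv
    rw [pd, h3, fderiv_comp_smul]
    simp [pd]
  have hwt : ∀ i, (wt i x : ℂ) = Real.exp s * wt i (Real.exp s • x) := by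
    intro i
    have he := (Real.exp_pos s).ne'
    rw [← Complex.ofReal_mul]
    congr 1
    simp only [wt, PiLp.smul_apply, smul_eq_mul, norm_smul, Real.norm_eq_abs,
      abs_of_pos (Real.exp_pos s)]
    by_cases hx : ‖x‖ = 0
    · simp [hx]
    · field_simp
  ext i
  simp only [dop, e, hpd, hwt, dilFun, PiLp.smul_apply, smul_eq_mul]
  ring

theorem dMap_dilTest (a : ℝ) (s : ℝ) (φ : PTest d) :
    dMap d a (dilTest s φ) = (Real.exp s : ℂ) • dil s (dMap d a φ) := by
  refine Lp.ext ?_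
  filter_upwards [dMap_coeFn a (dilTest s φ), Lp.coeFn_smul (Real.exp s : ℂ) (dil s (dMap d a φ)),
    dil_coeFn s (dMap d a φ), dilFun_congr s (dMap_coeFn a φ)] with x h1 h2 h3 h4
  rw [h1, h2, Pi.smul_apply, h3, h4, dop_dilTest]

theorem dil_mem (a : ℝ) (s : ℝ) {f : L2 d} {g : L2Vec d}
    (h : (WithLp.toLp 2 (f, g) : WithLp 2 (L2 d × L2Vec d)) ∈ graphCl (jMap d) (dMap d a)) :
    (WithLp.toLp 2 (dil s f, (Real.exp s : ℂ) • dil s g) : WithLp 2 (L2 d × L2Vec d)) ∈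
      graphCl (jMap d) (dMap d a) := by
  obtain ⟨φ, h1, h2⟩ := (mem_graphCl_seq _ _ _).1 h
  refine (mem_graphCl_seq _ _ _).2 ⟨fun n => dilTest s (φ n), ?_, ?_⟩
  · simp_rw [jMap_dilTest]
    exact ((dil s).continuous.tendsto _).comp h1
  · simp_rw [dMap_dilTest]
    exact (((dil s).continuous.tendsto _).comp h2).const_smul _

theorem continuous_dil {E : Type*} [NormedAddCommGroup E] [NormedSpace ℂ E]
    (f : Lp E 2 (volume : Measure (Space d))) : Continuous fun s => dil s f := by
  rw [continuous_iff_continuousAt]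
  intro s
  have h1 : Tendsto (fun t => dil (t - s) f) (𝓝 s) (𝓝 f) :=
    (tendsto_dil_zero f).comp ((continuous_id.sub continuous_const).tendsto' s 0 (by simp))
  have h2 := ((dil s).continuous.tendsto f).comp h1
  refine h2.congr fun t => ?_
  simp [dil_dil]

theorem wt_mul_self (x : Space d) (z : ℂ) (hx : x ≠ 0) :
    ∑ i, (x i : ℂ) * ((wt i x : ℂ) * z) = z := by
  have h1 : ∑ i, x i * wt i x = 1 := by
    have h2 : ∑ i, x i ^ 2 = ‖x‖ ^ 2 := by rw [EuclideanSpace.norm_sq_eq]; simp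
    have h3 : ‖x‖ ^ 2 ≠ 0 := by positivity
    simp only [wt, ← mul_div_assoc]
    rw [← Finset.sum_div, ← div_self h3, ← h2]
    simp [sq]
  simp_rw [← mul_assoc]
  rw [← Finset.sum_mul]
  have : ∑ i, (x i : ℂ) * (wt i x : ℂ) = 1 := by exact_mod_cast h1
  rw [this, one_mul]

/-- Since x·(x/|x|²) = 1, one has x·∇φ = x·Dφ - ρφ away from the origin. This is why `Cutoff.gen`
carries the constant d/2 - ρ and makes sense for any f in the form domain, without a separate
gradient. -/
theorem gen_test (a : ℝ) (η : Cutoff d) (φ : PTest d) :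
    η.gen a (jMap d φ) (dMap d a φ) = (memLp_dilGen ((ptest_smooth (η.mulTest φ)).of_le
      (by exact_mod_cast le_top)) (η.mulTest φ).hasCompactSupport).toLp _ := by
  refine Lp.ext ?_
  filter_upwards [η.gen_coeFn a (jMap d φ) (dMap d a φ), (memLp_dilGen
    ((ptest_smooth (η.mulTest φ)).of_le (by exact_mod_cast le_top))
    (η.mulTest φ).hasCompactSupport).coeFn_toLp, jMap_coeFn φ, dMap_coeFn a φ] with x h1 h2 h3 h4
  rw [h1, h2, h3, h4, dilGen, fderiv_apply_eq_sum]
  have e : ⇑(η.mulTest φ) = fun x => η.fn x * φ x := rfl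
  rw [e, grad_mul (η.differentiable x) ((ptest_smooth φ).differentiable (by simp) x)]
  have hgr : inner ℂ (cvec x) (dop a φ x) = ∑ i, (x i : ℂ) * grad φ x i + rho d a * φ x := by
    by_cases hx : x = 0
    · subst hx
      simp [PiLp.inner_apply, cvec, image_eq_zero_of_notMem_tsupport (not_mem_tsupport φ)]
    · conv_rhs => rw [← wt_mul_self x (φ x) hx, Finset.mul_sum, ← Finset.sum_add_distrib]
      simp only [PiLp.inner_apply, cvec, dop, grad, RCLike.inner_apply, Complex.conj_ofReal]
      refine Finset.sum_congr rfl fun i _ => ?_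
      ring
  have hg2 : inner ℂ (cvec x) (grad η.fn x) = ∑ i, (x i : ℂ) * grad η.fn x i := by
    simp [PiLp.inner_apply, cvec, mul_comm]
  rw [hgr, hg2]
  simp only [PiLp.add_apply, PiLp.smul_apply, smul_eq_mul, mul_add, Finset.sum_add_distrib]
  rw [Finset.mul_sum, add_mul, Finset.sum_mul]
  push_cast
  have e1 : ∀ i, η.fn x * (↑(x i) * grad φ x i) = ↑(x i) * (η.fn x * grad φ x i) := fun i => by ring
  have e2 : ∀ i, ↑(x i) * grad η.fn x i * φ x = ↑(x i) * (φ x * grad η.fn x i) := fun i => by ring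
  simp_rw [e1, e2]
  ring

/-- The dilations of `η f`, for `f` in the form domain, are differentiable. -/
theorem dil_sub_eq_integral (a : ℝ) (η : Cutoff d) {f : L2 d} {g : L2Vec d}
    (h : (WithLp.toLp 2 (f, g) : WithLp 2 (L2 d × L2Vec d)) ∈ graphCl (jMap d) (dMap d a)) (s : ℝ) :
    dil s (η.mul f) - η.mul f = ∫ σ in (0 : ℝ)..s, dil σ (η.gen a f g) := by
  obtain ⟨φ, h1, h2⟩ := (mem_graphCl_seq _ _ _).1 h
  -- On test functions this is the fundamental theorem of calculus. The passage to the limit uses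
  -- that `Cutoff.gen` has bounded coefficients in (f, Df) and that dilations are isometric.
  have ht : ∀ n, dil s (η.mul (jMap d (φ n))) - η.mul (jMap d (φ n)) =
      ∫ σ in (0 : ℝ)..s, dil σ (η.gen a (jMap d (φ n)) (dMap d a (φ n))) := by
    intro n
    have h3 := fun σ (_ : σ ∈ Set.uIcc 0 s) => hasDerivAt_dil
      ((ptest_smooth (η.mulTest (φ n))).of_le (by exact_mod_cast le_top))
      (η.mulTest (φ n)).hasCompactSupport (ptest_memLp _) σ
    have h4 := intervalIntegral.integral_eq_sub_of_hasDerivAt h3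
      ((continuous_dil _).intervalIntegrable _ _)
    rw [gen_test, h4, dil_zero, ← Cutoff.jMap_mulTest]
    rfl
  have hgl : Tendsto (fun n => η.gen a (jMap d (φ n)) (dMap d a (φ n))) atTop (𝓝 (η.gen a f g)) :=
    (((dotOp η.field _ _ _).continuous.tendsto g).comp h2).add
      (((mulOp (η.radial _) _ _ _).continuous.tendsto f).comp h1)
  have l1 : Tendsto (fun n => η.mul (jMap d (φ n))) atTop (𝓝 (η.mul f)) :=
    (η.mul.continuous.tendsto f).comp h1
  have l2 := (((dil s).continuous.tendsto _).comp l1).sub l1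
  refine tendsto_nhds_unique l2 ?_
  simp only [Function.comp_def, ht]
  rw [tendsto_iff_norm_sub_tendsto_zero] at hgl ⊢
  refine squeeze_zero (fun _ => norm_nonneg _) (fun n => ?_) (by simpa using hgl.mul_const |s|)
  rw [← intervalIntegral.integral_sub ((continuous_dil _).intervalIntegrable _ _)
    ((continuous_dil _).intervalIntegrable _ _)]
  refine (intervalIntegral.norm_integral_le_of_norm_le_const
    (C := ‖η.gen a (jMap d (φ n)) (dMap d a (φ n)) - η.gen a f g‖) fun σ _ => ?_).trans (by simp)
  rw [← map_sub, LinearIsometry.norm_map]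

theorem hasDerivAt_dil_mul (a : ℝ) (η : Cutoff d) {f : L2 d} {g : L2Vec d}
    (h : (WithLp.toLp 2 (f, g) : WithLp 2 (L2 d × L2Vec d)) ∈ graphCl (jMap d) (dMap d a)) :
    HasDerivAt (fun s => dil s (η.mul f)) (η.gen a f g) 0 := by
  have h1 := intervalIntegral.integral_hasDerivAt_right (a := (0 : ℝ)) (b := 0)
    ((continuous_dil (η.gen a f g)).intervalIntegrable _ _)
    ((continuous_dil _).stronglyMeasurableAtFilter _ _) (continuous_dil _).continuousAt
  rw [dil_zero] at h1
  have h2 := h1.add_const (η.mul f)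
  refine h2.congr_of_eventuallyEq (Eventually.of_forall fun s => ?_)
  simp only [← dil_sub_eq_integral a η h s, sub_add_cancel]

theorem norm_dil_mul_sub_le (a : ℝ) (η : Cutoff d) {f : L2 d} {g : L2Vec d}
    (h : (WithLp.toLp 2 (f, g) : WithLp 2 (L2 d × L2Vec d)) ∈ graphCl (jMap d) (dMap d a)) (s : ℝ) :
    ‖dil s (η.mul f) - η.mul f‖ ≤ ‖η.gen a f g‖ * |s| := by
  rw [dil_sub_eq_integral a η h]
  refine (intervalIntegral.norm_integral_le_of_norm_le_const
    (C := ‖η.gen a f g‖) fun σ _ => ?_).trans (by simp)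
  rw [LinearIsometry.norm_map]

end cutoffs

/-! ### The weak formulation of the equation -/

section riemann

variable {E : Type*} [NormedAddCommGroup E]

/-- Cut [0, T] into equal pieces shorter than δ and telescope: the total increment is at most ε
times a fixed integral. This takes the place of differentiation in time, as the inhomogeneity in
Duhamel's formula is only integrable. -/
theorem eq_of_norm_sub_le_integral {ψ : ℝ → E} {m : ℝ → ℝ} {T : ℝ} (hT : 0 ≤ T)
    (hm : IntervalIntegrable m volume 0 T)
    (h : ∀ ε > 0, ∃ δ > 0, ∀ s t, 0 ≤ s → s ≤ t → t ≤ T → t - s ≤ δ →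
      ‖ψ t - ψ s‖ ≤ ε * ∫ r in s..t, m r) : ψ T = ψ 0 := by
  have key : ∀ ε > 0, ‖ψ T - ψ 0‖ ≤ ε * ∫ r in (0 : ℝ)..T, m r := by
    intro ε hε
    obtain ⟨δ, hδ, hd⟩ := h ε hε
    obtain ⟨n, hn⟩ := exists_nat_gt (T / δ)
    have hn0 : 0 < (n : ℝ) := lt_of_le_of_lt (by positivity) hn
    set p : ℕ → ℝ := fun k => k * (T / n) with hp
    have hTn : 0 ≤ T / n := by positivity
    have hmono : Monotone p := fun i j hij => by
      simp only [hp]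
      gcongr
    have hpn : p n = T := by simp only [hp]; field_simp
    have hp0 : p 0 = 0 := by simp [hp]
    have hmem : ∀ k ≤ n, p k ∈ Set.Icc 0 T := fun k hk =>
      ⟨hp0 ▸ hmono (Nat.zero_le k), hpn ▸ hmono hk⟩
    have hint : ∀ k < n, IntervalIntegrable m volume (p k) (p (k + 1)) := fun k hk =>
      hm.mono_set (by
        rw [Set.uIcc_of_le (hmono (Nat.le_succ k)), Set.uIcc_of_le hT]
        exact Set.Icc_subset_Icc (hmem k hk.le).1 (hmem (k + 1) hk).2)
    have hsum := intervalIntegral.sum_integral_adjacent_intervals hint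
    have htel : ψ T - ψ 0 = ∑ k ∈ Finset.range n, (ψ (p (k + 1)) - ψ (p k)) := by
      rw [Finset.sum_range_sub (fun k => ψ (p k)), hpn, hp0]
    rw [htel]
    calc _ ≤ ∑ k ∈ Finset.range n, ‖ψ (p (k + 1)) - ψ (p k)‖ := norm_sum_le _ _
      _ ≤ ∑ k ∈ Finset.range n, ε * ∫ r in p k..p (k + 1), m r := by
        refine Finset.sum_le_sum fun k hk => ?_
        have hk' := Finset.mem_range.1 hk
        refine hd _ _ (hmem k hk'.le).1 (hmono (Nat.le_succ k)) (hmem (k + 1) hk').2 ?_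
        have : p (k + 1) - p k = T / n := by simp only [hp]; push_cast; ring
        rw [this, div_le_iff₀ hn0]
        rw [div_lt_iff₀ hδ] at hn
        linarith
      _ = ε * ∫ r in (0 : ℝ)..T, m r := by rw [← Finset.mul_sum, hsum, hpn, hp0]
  have h0 : ‖ψ T - ψ 0‖ ≤ 0 := by
    refine le_of_forall_pos_le_add fun ε hε => ?_
    set I := ∫ r in (0 : ℝ)..T, m r
    have := key (ε / (|I| + 1)) (by positivity)
    refine this.trans ?_
    rw [zero_add, div_mul_eq_mul_div, div_le_iff₀ (by positivity)]
    nlinarith [le_abs_self I]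
  exact sub_eq_zero.1 (norm_le_zero_iff.1 h0)

theorem exists_modulus {f : ℝ → E} (hf : Continuous f) (T : ℝ) {ε : ℝ} (hε : 0 < ε) :
    ∃ δ > 0, ∀ s ∈ Set.Icc 0 T, ∀ t ∈ Set.Icc 0 T, |t - s| ≤ δ → ‖f t - f s‖ ≤ ε := by
  have h := isCompact_Icc.uniformContinuousOn_of_continuous (hf.continuousOn (s := Set.Icc 0 T))
  obtain ⟨δ, hδ, h2⟩ := Metric.uniformContinuousOn_iff.1 h ε hε
  refine ⟨δ / 2, by positivity, fun s hs t ht hst => ?_⟩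
  rw [← dist_eq_norm]
  refine (h2 t ht s hs ?_).le
  rw [Real.dist_eq]
  linarith

theorem exists_bound_Icc {f : ℝ → E} (hf : Continuous f) (T : ℝ) :
    ∃ M, 0 ≤ M ∧ ∀ s ∈ Set.Icc 0 T, ‖f s‖ ≤ M := by
  obtain ⟨M, hM⟩ := isCompact_Icc.exists_bound_of_continuousOn (hf.continuousOn (s := Set.Icc 0 T))
  exact ⟨max M 0, le_max_right _ _, fun s hs => (hM s hs).trans (le_max_left _ _)⟩

end riemann

/-! ### Duhamel's formula tested against the domain and the form domain of L_a -/

section weak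

variable {d : ℕ} {a : ℝ} {U : ℝ → L2 d →L[ℂ] L2 d}

theorem IsSchrodingerGroup.add_apply (hU : IsSchrodingerGroup a U) (s t : ℝ) (f : L2 d) :
    U s (U t f) = U (s + t) f := by
  rw [hU.map_add]; rfl

theorem IsSchrodingerGroup.inner_right (hU : IsSchrodingerGroup a U) (t : ℝ) (f g : L2 d) :
    inner ℂ f (U t g) = inner ℂ (U (-t) f) g := by
  let V : L2 d →ₗᵢ[ℂ] L2 d := ⟨(U (-t) : L2 d →ₗ[ℂ] L2 d), hU.norm_map (-t)⟩
  have h := V.inner_map_map f (U t g)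
  have h2 : V (U t g) = g := by
    change U (-t) (U t g) = g
    rw [hU.add_apply, neg_add_cancel, hU.map_zero]; rfl
  rw [h2] at h
  exact h.symm

theorem IsSchrodingerGroup.continuous_uncurry (hU : IsSchrodingerGroup a U) :
    Continuous fun p : ℝ × L2 d => U p.1 p.2 := by
  rw [continuous_iff_continuousAt]
  rintro ⟨t, f⟩
  have h1 : Tendsto (fun p : ℝ × L2 d => U p.1 f) (𝓝 (t, f)) (𝓝 (U t f)) :=
    ((hU.continuous f).tendsto t).comp (continuous_fst.tendsto (t, f))
  have h2 : Tendsto (fun p : ℝ × L2 d => U p.1 p.2 - U p.1 f) (𝓝 (t, f)) (𝓝 0) := by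
    rw [tendsto_zero_iff_norm_tendsto_zero]
    have h3 : Tendsto (fun p : ℝ × L2 d => ‖p.2 - f‖) (𝓝 (t, f)) (𝓝 0) :=
      (continuous_snd.sub continuous_const).norm.tendsto' _ _ (by simp)
    refine h3.congr fun p => ?_
    rw [← map_sub, hU.norm_map]
  have := h2.add h1
  simp only [zero_add, sub_add_cancel] at this
  exact this

theorem IsSchrodingerGroup.intervalIntegrable (hU : IsSchrodingerGroup a U) {N : ℝ → L2 d} {s t : ℝ}
    (hN : IntervalIntegrable N volume s t) (r : ℝ) :
    IntervalIntegrable (fun σ => U (r - σ) (N σ)) volume s t := by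
  rw [intervalIntegrable_iff] at hN ⊢
  have hm : AEStronglyMeasurable (fun σ => U (r - σ) (N σ)) (volume.restrict (Set.uIoc s t)) :=
    hU.continuous_uncurry.comp_aestronglyMeasurable
      (((continuous_const.sub continuous_id).aestronglyMeasurable).prodMk hN.aestronglyMeasurable)
  exact (hN.norm.mono' hm (Eventually.of_forall fun σ => (hU.norm_map _ _).le))

/-- The Duhamel formula, for the linear evolution `U` and the inhomogeneity `N`. -/
def Duhamel (U : ℝ → L2 d →L[ℂ] L2 d) (μ : ℝ) (N u : ℝ → L2 d) : Prop :=
  ∀ t, IntervalIntegrable N volume 0 t ∧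
    u t = U t (u 0) - (Complex.I * (μ : ℂ)) • ∫ s in (0 : ℝ)..t, U (t - s) (N s)

variable {μ : ℝ} {N u : ℝ → L2 d}

theorem Duhamel.intervalIntegrable (h : Duhamel U μ N u) (s t : ℝ) :
    IntervalIntegrable N volume s t :=
  (h s).1.symm.trans (h t).1

theorem Duhamel.restart (hU : IsSchrodingerGroup a U) (h : Duhamel U μ N u) (s t : ℝ) :
    u t = U (t - s) (u s) - (Complex.I * (μ : ℂ)) • ∫ r in s..t, U (t - r) (N r) := by
  rw [(h t).2, (h s).2, map_sub, hU.add_apply, sub_add_cancel, map_smul,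
    ← ContinuousLinearMap.intervalIntegral_comp_comm _ (hU.intervalIntegrable (h s).1 s)]
  simp_rw [hU.add_apply, sub_add_sub_cancel]
  rw [sub_sub, ← smul_add, intervalIntegral.integral_add_adjacent_intervals
    (hU.intervalIntegrable (h s).1 t) (hU.intervalIntegrable (h.intervalIntegrable s t) t)]

/-- Pulling U t out of the integral leaves the primitive of an integrable function, and (t, f) ↦ U t
f is jointly continuous because each U t is isometric. -/
theorem Duhamel.continuous (hU : IsSchrodingerGroup a U) (h : Duhamel U μ N u) : Continuous u := by
  have e : u = fun t => U t (u 0 - (Complex.I * (μ : ℂ)) • ∫ s in (0 : ℝ)..t, U (0 - s) (N s)) := by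
    ext1 t
    conv_lhs => rw [(h t).2]
    rw [map_sub, map_smul,
      ← ContinuousLinearMap.intervalIntegral_comp_comm _ (hU.intervalIntegrable (h t).1 0)]
    simp_rw [hU.add_apply, zero_sub, ← sub_eq_add_neg]
  rw [e]
  have hc : Continuous fun t => ∫ s in (0 : ℝ)..t, U (0 - s) (N s) :=
    intervalIntegral.continuous_primitive (fun s t =>
      hU.intervalIntegrable (h.intervalIntegrable s t) 0) 0
  exact hU.continuous_uncurry.comp (continuous_id.prodMk (continuous_const.sub
    (hc.const_smul (Complex.I * (μ : ℂ)))))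

theorem inner_intervalIntegral (c : L2 d) {f : ℝ → L2 d} {s t : ℝ}
    (hf : IntervalIntegrable f volume s t) :
    inner ℂ c (∫ r in s..t, f r) = ∫ r in s..t, inner ℂ c (f r) :=
  ((innerSL ℂ c).intervalIntegral_comp_comm hf).symm

theorem inner_intervalIntegral_vec (c : L2Vec d) {f : ℝ → L2Vec d} {s t : ℝ}
    (hf : IntervalIntegrable f volume s t) :
    inner ℂ c (∫ r in s..t, f r) = ∫ r in s..t, inner ℂ c (f r) :=
  ((innerSL ℂ c).intervalIntegral_comp_comm hf).symm

theorem intervalIntegrable_inner (c : L2 d) {f : ℝ → L2 d} {s t : ℝ}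
    (hf : IntervalIntegrable f volume s t) :
    IntervalIntegrable (fun r => inner ℂ c (f r)) volume s t := by
  rw [intervalIntegrable_iff] at hf ⊢
  exact (innerSL ℂ c).integrable_comp hf

/-- The equation tested against an element of the domain of `L_a`. -/
theorem Duhamel.weak_domain (hU : IsSchrodingerGroup a U) (h : Duhamel U μ N u) {f k : L2 d}
    (hfk : FriedrichsGraph a f k) {T : ℝ} (hT : 0 ≤ T) :
    inner ℂ f (u T - u 0) = -Complex.I * (inner ℂ k (∫ r in (0 : ℝ)..T, u r) +
      μ * inner ℂ f (∫ r in (0 : ℝ)..T, N r)) := by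
  have hu := h.continuous hU
  have hui : ∀ s t, IntervalIntegrable u volume s t := fun s t => hu.intervalIntegrable s t
  obtain ⟨M, hM0, hM⟩ := exists_bound_Icc hu T
  -- The quantity that the tested equation says is conserved; its increments are shown to be small
  -- relative to the length of the time step and to ∫‖N‖.
  set ψ : ℝ → ℂ := fun t => inner ℂ f (u t) + Complex.I * (inner ℂ k (∫ r in (0 : ℝ)..t, u r) +
      μ * inner ℂ f (∫ r in (0 : ℝ)..t, N r)) with hψ
  have hmi : ∀ s t, IntervalIntegrable (fun r => M + ‖k‖ + |μ| * ‖N r‖) volume s t := fun s t =>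
    (intervalIntegrable_const).add ((h.intervalIntegrable s t).norm.const_mul _)
  have key : ψ T = ψ 0 := by
    refine eq_of_norm_sub_le_integral hT (hmi 0 T) fun ε hε => ?_
    obtain ⟨δ₁, hδ₁, h1⟩ := exists_modulus hu T hε
    obtain ⟨δ₂, hδ₂, h2⟩ := Metric.continuous_iff.1 (hU.continuous f) 0 ε hε
    have h3 := (hasDerivAt_iff_isLittleO.1 (hU.generator f k hfk)).def hε
    obtain ⟨δ₃, hδ₃, h3⟩ := Metric.eventually_nhds_iff.1 h3
    refine ⟨min δ₁ (min (δ₂ / 2) (δ₃ / 2)), by positivity, fun s t hs hst htT hd => ?_⟩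
    have hd1 : t - s ≤ δ₁ := hd.trans (min_le_left _ _)
    have hd2 : t - s ≤ δ₂ / 2 := hd.trans ((min_le_right _ _).trans (min_le_left _ _))
    have hd3 : t - s ≤ δ₃ / 2 := hd.trans ((min_le_right _ _).trans (min_le_right _ _))
    have hUf : ∀ r, |r| ≤ t - s → ‖U r f - f‖ ≤ ε := fun r hr => by
      have := h2 r (by rw [Real.dist_eq, sub_zero]; linarith)
      rw [hU.map_zero, dist_eq_norm] at this
      exact this.le
    have hrem : ‖U (-(t - s)) f - f - ((t - s : ℝ) : ℂ) • (Complex.I • k)‖ ≤ ε * (t - s) := by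
      have := h3 (y := -(t - s)) (by
        rw [Real.dist_eq, sub_zero, abs_neg, abs_of_nonneg (by linarith)]; linarith)
      rw [hU.map_zero, sub_zero, norm_neg, Real.norm_of_nonneg (by linarith)] at this
      have e : (-(t - s)) • -(Complex.I • k) = ((t - s : ℝ) : ℂ) • (Complex.I • k) := by
        rw [smul_neg, neg_smul, neg_neg, Complex.coe_smul]
        rfl
      rw [e] at this
      exact this
    have hsI : s ∈ Set.Icc 0 T := ⟨hs, hst.trans htT⟩
    have e1 : inner ℂ f (u t) = inner ℂ (U (-(t - s)) f) (u s) -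
        Complex.I * μ * ∫ r in s..t, inner ℂ (U (-(t - r)) f) (N r) := by
      rw [h.restart hU s t, inner_sub_right, inner_smul_right, hU.inner_right, inner_intervalIntegral
        _ (hU.intervalIntegrable (h.intervalIntegrable s t) t)]
      simp_rw [hU.inner_right]
    -- After restarting Duhamel's formula at time s and moving the unitary group onto f, three
    -- errors remain: the remainder of the generator at f, the oscillation of u, and the failure of
    -- U(-(t-r)) to fix f. Each is at most ε times an integrable density.
    have e2 : ψ t - ψ s = inner ℂ (U (-(t - s)) f - f - ((t - s : ℝ) : ℂ) • (Complex.I • k)) (u s) +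
        Complex.I * ((∫ r in s..t, inner ℂ k (u r - u s)) +
          μ * ∫ r in s..t, inner ℂ (f - U (-(t - r)) f) (N r)) := by
      have a1 : inner ℂ k (∫ r in (0 : ℝ)..t, u r) - inner ℂ k (∫ r in (0 : ℝ)..s, u r) =
          ∫ r in s..t, inner ℂ k (u r) := by
        rw [← inner_sub_right, intervalIntegral.integral_interval_sub_left (hui _ _) (hui _ _),
          inner_intervalIntegral _ (hui _ _)]
      have a2 : inner ℂ f (∫ r in (0 : ℝ)..t, N r) - inner ℂ f (∫ r in (0 : ℝ)..s, N r) =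
          ∫ r in s..t, inner ℂ f (N r) := by
        rw [← inner_sub_right, intervalIntegral.integral_interval_sub_left
          (h.intervalIntegrable _ _) (h.intervalIntegrable _ _),
          inner_intervalIntegral _ (h.intervalIntegrable _ _)]
      have a3 : ∫ r in s..t, inner ℂ k (u r - u s) =
          (∫ r in s..t, inner ℂ k (u r)) - (t - s : ℝ) * inner ℂ k (u s) := by
        simp_rw [inner_sub_right]
        rw [intervalIntegral.integral_sub (intervalIntegrable_inner k (hui _ _))
          intervalIntegrable_const, intervalIntegral.integral_const]
        simp
      have a4 : ∫ r in s..t, inner ℂ (f - U (-(t - r)) f) (N r) =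
          (∫ r in s..t, inner ℂ f (N r)) - ∫ r in s..t, inner ℂ (U (-(t - r)) f) (N r) := by
        simp_rw [inner_sub_left]
        rw [intervalIntegral.integral_sub (intervalIntegrable_inner f (h.intervalIntegrable _ _))]
        have := intervalIntegrable_inner f (hU.intervalIntegrable (h.intervalIntegrable s t) t)
        simp_rw [hU.inner_right] at this
        exact this
      have a5 : ψ t - ψ s = inner ℂ f (u t) - inner ℂ f (u s) + Complex.I *
          ((inner ℂ k (∫ r in (0 : ℝ)..t, u r) - inner ℂ k (∫ r in (0 : ℝ)..s, u r)) +
          μ * (inner ℂ f (∫ r in (0 : ℝ)..t, N r) - inner ℂ f (∫ r in (0 : ℝ)..s, N r))) := by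
        simp only [hψ]; ring
      rw [a5, a1, a2, a3, a4, e1, inner_sub_left, inner_sub_left, inner_smul_left, inner_smul_left]
      simp only [Complex.conj_ofReal, Complex.conj_I]
      ring
    have b1 : ‖inner ℂ (U (-(t - s)) f - f - ((t - s : ℝ) : ℂ) • (Complex.I • k)) (u s)‖ ≤
        ε * (t - s) * M :=
      (norm_inner_le_norm _ _).trans (by gcongr; exact hM s hsI)
    have b2 : ‖∫ r in s..t, inner ℂ k (u r - u s)‖ ≤ ‖k‖ * ε * (t - s) := by
      refine (intervalIntegral.norm_integral_le_of_norm_le_const (C := ‖k‖ * ε) fun r hr => ?_).trans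
        (by rw [abs_of_nonneg (by linarith)])
      rw [Set.uIoc_of_le hst] at hr
      refine (norm_inner_le_norm _ _).trans ?_
      gcongr
      refine h1 s hsI r ⟨by linarith [hr.1], by linarith [hr.2]⟩ ?_
      rw [abs_of_nonneg (by linarith [hr.1])]
      linarith [hr.2]
    have b3 : ‖∫ r in s..t, inner ℂ (f - U (-(t - r)) f) (N r)‖ ≤ ε * ∫ r in s..t, ‖N r‖ := by
      rw [← intervalIntegral.integral_const_mul]
      refine intervalIntegral.norm_integral_le_of_norm_le hst ?_
        ((h.intervalIntegrable s t).norm.const_mul ε)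
      refine Eventually.of_forall fun r hr => (norm_inner_le_norm _ _).trans ?_
      gcongr
      rw [norm_sub_rev]
      refine hUf _ ?_
      rw [abs_neg, abs_of_nonneg (by linarith [hr.2])]
      linarith [hr.1]
    have b4 : ε * ∫ r in s..t, (M + ‖k‖ + |μ| * ‖N r‖) =
        ε * (t - s) * M + ‖k‖ * ε * (t - s) + |μ| * (ε * ∫ r in s..t, ‖N r‖) := by
      rw [intervalIntegral.integral_add intervalIntegrable_const
        ((h.intervalIntegrable s t).norm.const_mul _), intervalIntegral.integral_const,
        intervalIntegral.integral_const_mul, smul_eq_mul]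
      ring
    rw [e2, b4]
    refine (norm_add_le _ _).trans ?_
    rw [norm_mul, Complex.norm_I, one_mul, add_assoc]
    refine add_le_add b1 ((norm_add_le _ _).trans (add_le_add b2 ?_))
    rw [norm_mul, Complex.norm_real, Real.norm_eq_abs]
    gcongr
  have h0 : ψ 0 = inner ℂ f (u 0) := by simp [hψ]
  rw [h0] at key
  rw [inner_sub_right, ← key]
  simp only [hψ]
  ring

/-- The equation tested against an element of the form domain. -/
theorem Duhamel.weak_form (hd : 3 ≤ d) (ha : -(((d : ℝ) - 2) / 2) ^ 2 < a)
    (hU : IsSchrodingerGroup a U) (h : Duhamel U μ N u) {g : ℝ → L2Vec d} (hg : Continuous g)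
    (hug : ∀ t, (WithLp.toLp 2 (u t, g t) : WithLp 2 (L2 d × L2Vec d)) ∈
      graphCl (jMap d) (dMap d a)) {w : WithLp 2 (L2 d × L2Vec d)}
    (hw : w ∈ graphCl (jMap d) (dMap d a)) {T : ℝ} (hT : 0 ≤ T) :
    inner ℂ w.fst (u T - u 0) = -Complex.I * (inner ℂ w.snd (∫ r in (0 : ℝ)..T, g r) +
      μ * inner ℂ w.fst (∫ r in (0 : ℝ)..T, N r)) := by
  set Γ := graphCl (jMap d) (dMap d a) with hΓ
  -- P k is the orthogonal projection of (k, 0) onto the closed graph, that is, ((1 + L_a)⁻¹k, D(1 +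
  -- L_a)⁻¹k). Its inner product with v in the graph is ⟨k, v.fst⟩, so the case w = P k follows from
  -- the equation tested against the domain.
  let P : L2 d →L[ℂ] WithLp 2 (L2 d × L2Vec d) := Γ.starProjection ∘L inlC
  have hPm : ∀ k, P k ∈ Γ := fun k => Submodule.starProjection_apply_mem _ _
  have hPinner : ∀ k, ∀ v ∈ Γ, inner ℂ (P k) v = inner ℂ k v.fst := by
    intro k v hv
    have h1 := Submodule.starProjection_inner_eq_zero (K := Γ) (inlC k) v hv
    rw [inner_sub_left, sub_eq_zero, inner_inlC'] at h1
    exact h1.symm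
  have hP : ∀ k, inner ℂ (P k).fst (u T - u 0) = -Complex.I * (inner ℂ (P k).snd
      (∫ r in (0 : ℝ)..T, g r) + μ * inner ℂ (P k).fst (∫ r in (0 : ℝ)..T, N r)) := by
    intro k
    have h1 := h.weak_domain hU ((friedrichsGraph_iff ha.le _ _).2
      (aGraph_aRes (jMap d) (dMap d a) k)) hT
    have e1 : aRes (jMap d) (dMap d a) k = (P k).fst := rfl
    rw [e1] at h1
    rw [h1]
    congr 2
    rw [inner_intervalIntegral _ ((h.continuous hU).intervalIntegrable _ _),
      inner_intervalIntegral_vec _ (hg.intervalIntegrable _ _)]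
    refine intervalIntegral.integral_congr fun r _ => ?_
    have h2 := hPinner k _ (hug r)
    rw [WithLp.prod_inner_apply] at h2
    change inner ℂ (P k).fst (u r) + inner ℂ (P k).snd (g r) = inner ℂ k (u r) at h2
    rw [inner_sub_left, ← h2]
    ring
  -- The range of P is dense in the form domain: an element of the graph orthogonal to every P k has
  -- first component 0, hence is 0 by `eq_zero_of_mem_graphCl`.
  have hdense : w ∈ (LinearMap.range (P : L2 d →ₗ[ℂ] WithLp 2 (L2 d × L2Vec d))).topologicalClosure := by
    set S := (LinearMap.range (P : L2 d →ₗ[ℂ] WithLp 2 (L2 d × L2Vec d))).topologicalClosure with hS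
    have : CompleteSpace S := (Submodule.isClosed_topologicalClosure _).completeSpace_coe
    have hSΓ : S ≤ Γ := Submodule.topologicalClosure_minimal _
      (by rintro _ ⟨k, rfl⟩; exact hPm k) (Submodule.isClosed_topologicalClosure _)
    have hv : w - S.starProjection w ∈ Γ :=
      Γ.sub_mem hw (hSΓ (Submodule.starProjection_apply_mem _ _))
    have h0 : (w - S.starProjection w).fst = 0 := by
      refine ext_inner_left ℂ fun k => ?_
      rw [inner_zero_right, ← hPinner k _ hv]
      exact (Submodule.mem_orthogonal _ _).1 (Submodule.sub_starProjection_mem_orthogonal (K := S) w)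
        _ (Submodule.le_topologicalClosure _ ⟨k, rfl⟩)
    have h1 := eq_zero_of_mem_graphCl hd ha hv h0
    rw [sub_eq_zero] at h1
    rw [h1]
    exact Submodule.starProjection_apply_mem _ _
  have hcf : Continuous fun w : WithLp 2 (L2 d × L2Vec d) => w.fst :=
    continuous_fst.comp (WithLp.prod_continuous_ofLp 2 _ _)
  have hcs : Continuous fun w : WithLp 2 (L2 d × L2Vec d) => w.snd :=
    continuous_snd.comp (WithLp.prod_continuous_ofLp 2 _ _)
  have hcl : IsClosed {w : WithLp 2 (L2 d × L2Vec d) | inner ℂ w.fst (u T - u 0) =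
      -Complex.I * (inner ℂ w.snd (∫ r in (0 : ℝ)..T, g r) +
      μ * inner ℂ w.fst (∫ r in (0 : ℝ)..T, N r))} :=
    isClosed_eq (hcf.inner continuous_const) (continuous_const.mul
      ((hcs.inner continuous_const).add (continuous_const.mul (hcf.inner continuous_const))))
  exact closure_minimal (by rintro _ ⟨k, rfl⟩; exact hP k) hcl hdense

/-- The increments of the real part of the weak formulation. -/
theorem Duhamel.weak_form_im (hd : 3 ≤ d) (ha : -(((d : ℝ) - 2) / 2) ^ 2 < a)
    (hU : IsSchrodingerGroup a U) (h : Duhamel U μ N u) {g : ℝ → L2Vec d} (hg : Continuous g)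
    (hug : ∀ t, (WithLp.toLp 2 (u t, g t) : WithLp 2 (L2 d × L2Vec d)) ∈
      graphCl (jMap d) (dMap d a)) {f : L2 d} {e : L2Vec d}
    (hw : (WithLp.toLp 2 (f, e) : WithLp 2 (L2 d × L2Vec d)) ∈ graphCl (jMap d) (dMap d a))
    {s t : ℝ} (hs : 0 ≤ s) (ht : 0 ≤ t) :
    (inner ℂ f (u t - u s)).im =
      - ∫ r in s..t, ((inner ℂ e (g r)).re + μ * (inner ℂ f (N r)).re) := by
  have hi : ∀ x y, IntervalIntegrable (fun r => (inner ℂ e (g r)).re) volume x y := fun x y =>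
    (Complex.continuous_re.comp (continuous_const.inner hg)).intervalIntegrable _ _
  have hn : ∀ x y, IntervalIntegrable (fun r => (inner ℂ f (N r)).re) volume x y := fun x y => by
    have := intervalIntegrable_inner f (h.intervalIntegrable x y)
    rw [intervalIntegrable_iff] at this ⊢
    exact this.re
  have key : ∀ T, 0 ≤ T → (inner ℂ f (u T - u 0)).im =
      - ∫ r in (0 : ℝ)..T, ((inner ℂ e (g r)).re + μ * (inner ℂ f (N r)).re) := by
    intro T hT
    have h1 := h.weak_form hd ha hU hg hug hw hT
    change inner ℂ f (u T - u 0) = -Complex.I * (inner ℂ e (∫ r in (0 : ℝ)..T, g r) +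
      μ * inner ℂ f (∫ r in (0 : ℝ)..T, N r)) at h1
    have e1 : (inner ℂ e (∫ r in (0 : ℝ)..T, g r)).re = ∫ r in (0 : ℝ)..T, (inner ℂ e (g r)).re := by
      rw [inner_intervalIntegral_vec _ (hg.intervalIntegrable _ _)]
      exact (Complex.reCLM.intervalIntegral_comp_comm
        ((continuous_const.inner hg).intervalIntegrable _ _)).symm
    have e2 : (inner ℂ f (∫ r in (0 : ℝ)..T, N r)).re = ∫ r in (0 : ℝ)..T, (inner ℂ f (N r)).re := by
      rw [inner_intervalIntegral _ (h.intervalIntegrable _ _)]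
      exact (Complex.reCLM.intervalIntegral_comp_comm
        (intervalIntegrable_inner f (h.intervalIntegrable _ _))).symm
    rw [h1, intervalIntegral.integral_add (hi _ _) ((hn _ _).const_mul μ),
      intervalIntegral.integral_const_mul, ← e1, ← e2]
    simp
  have e3 : u t - u s = (u t - u 0) - (u s - u 0) := by abel
  rw [e3, inner_sub_right, Complex.sub_im, key t ht, key s hs,
    ← intervalIntegral.integral_interval_sub_left ((hi 0 t).add ((hn 0 t).const_mul μ))
      ((hi 0 s).add ((hn 0 s).const_mul μ))]
  ring

theorem Duhamel.intervalIntegrable_re_inner (h : Duhamel U μ N u) {k : ℝ → L2 d} (hk : Continuous k)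
    (s t : ℝ) : IntervalIntegrable (fun r => (inner ℂ (k r) (N r)).re) volume s t := by
  obtain ⟨M, hM⟩ := isCompact_uIcc.exists_bound_of_continuousOn (hk.continuousOn (s := Set.uIcc s t))
  have h1 := (h.intervalIntegrable s t).norm.const_mul M
  have hNm := (intervalIntegrable_iff.1 (h.intervalIntegrable s t)).aestronglyMeasurable
  rw [intervalIntegrable_iff] at h1 ⊢
  refine h1.mono' (Complex.continuous_re.comp_aestronglyMeasurable
    (hk.aestronglyMeasurable.inner hNm)) ?_
  refine (ae_restrict_iff' measurableSet_uIoc).2 (Eventually.of_forall fun r hr => ?_)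
  exact (Complex.abs_re_le_norm _).trans ((norm_inner_le_norm _ _).trans
    (mul_le_mul_of_nonneg_right (hM r (Set.uIoc_subset_uIcc hr)) (norm_nonneg _)))

/-- The evolution of the quadratic form of a bounded antisymmetric operator. -/
theorem Duhamel.quadratic (hd : 3 ≤ d) (ha : -(((d : ℝ) - 2) / 2) ^ 2 < a)
    (hU : IsSchrodingerGroup a U) (h : Duhamel U μ N u) {g : ℝ → L2Vec d} (hg : Continuous g)
    (hug : ∀ t, (WithLp.toLp 2 (u t, g t) : WithLp 2 (L2 d × L2Vec d)) ∈
      graphCl (jMap d) (dMap d a)) (C : L2 d →L[ℂ] L2 d)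
    (hC : ∀ f f', inner ℂ (C f) f' = - inner ℂ f (C f')) {e : ℝ → L2Vec d} (he : Continuous e)
    (hue : ∀ t, (WithLp.toLp 2 (C (u t), e t) : WithLp 2 (L2 d × L2Vec d)) ∈
      graphCl (jMap d) (dMap d a)) {T : ℝ} (hT : 0 ≤ T) :
    (inner ℂ (u T) (C (u T))).im - (inner ℂ (u 0) (C (u 0))).im =
      2 * ∫ r in (0 : ℝ)..T, ((inner ℂ (e r) (g r)).re + μ * (inner ℂ (C (u r)) (N r)).re) := by
  have hu := h.continuous hU
  have hCu : Continuous fun t => C (u t) := C.continuous.comp hu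
  obtain ⟨G, hG0, hG⟩ := exists_bound_Icc hg T
  have hm : ∀ s t, IntervalIntegrable (fun r => 2 * G + 2 * |μ| * ‖N r‖) volume s t := fun s t =>
    intervalIntegrable_const.add ((h.intervalIntegrable s t).norm.const_mul _)
  have hi : ∀ k : ℝ → L2Vec d, Continuous k → ∀ s t,
      IntervalIntegrable (fun r => (inner ℂ (k r) (g r)).re) volume s t := fun k hk s t =>
    (Complex.continuous_re.comp (hk.inner hg)).intervalIntegrable _ _
  have hn : ∀ k : ℝ → L2 d, Continuous k → ∀ s t,
      IntervalIntegrable (fun r => (inner ℂ (k r) (N r)).re) volume s t := fun k hk s t =>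
    h.intervalIntegrable_re_inner hk s t
  set L : ℝ → ℝ := fun r => (inner ℂ (e r) (g r)).re + μ * (inner ℂ (C (u r)) (N r)).re with hL
  have hLi : ∀ s t, IntervalIntegrable L volume s t := fun s t =>
    (hi e he s t).add ((hn _ hCu s t).const_mul μ)
  set ψ : ℝ → ℝ := fun t => (inner ℂ (u t) (C (u t))).im - 2 * ∫ r in (0 : ℝ)..t, L r with hψ
  suffices key : ψ T = ψ 0 by
    simp only [hψ, intervalIntegral.integral_same] at key
    linarith
  refine eq_of_norm_sub_le_integral hT (hm 0 T) fun ε hε => ?_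
  obtain ⟨δ₁, hδ₁, h1⟩ := exists_modulus he T hε
  obtain ⟨δ₂, hδ₂, h2⟩ := exists_modulus hCu T hε
  refine ⟨min δ₁ δ₂, by positivity, fun s t hs hst htT hd' => ?_⟩
  have hsI : s ∈ Set.Icc 0 T := ⟨hs, hst.trans htT⟩
  have htI : t ∈ Set.Icc 0 T := ⟨hs.trans hst, htT⟩
  -- By antisymmetry Im⟨u_s, Cu_t⟩ = Im⟨u_t, Cu_s⟩, so the increment of the quadratic form equals
  -- -Im⟨C(u_t + u_s), u_t - u_s⟩. The test vector is now fixed on [s, t] and the weak form applies;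
  -- only afterwards are its two halves compared with their values at r.
  have e1 : (inner ℂ (u t) (C (u t))).im - (inner ℂ (u s) (C (u s))).im =
      ∫ r in s..t, ((inner ℂ (e t + e s) (g r)).re +
        μ * (inner ℂ (C (u t) + C (u s)) (N r)).re) := by
    have hw := Submodule.add_mem _ (hue t) (hue s)
    have h3 := h.weak_form_im hd ha hU hg hug (f := C (u t) + C (u s)) (e := e t + e s) hw hs
      htI.1
    rw [← neg_eq_iff_eq_neg] at h3
    have h4 : (inner ℂ (u s) (C (u t))).im = (inner ℂ (u t) (C (u s))).im := by
      have h5 := hC (u s) (u t)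
      rw [← neg_eq_iff_eq_neg, ← inner_conj_symm] at h5
      rw [← h5, Complex.neg_im, Complex.conj_im, neg_neg]
    rw [← h3, ← map_add, hC, map_sub, inner_add_left, inner_sub_right, inner_sub_right]
    simp only [Complex.neg_im, Complex.add_im, Complex.sub_im]
    linarith
  have e2 : ψ t - ψ s = ∫ r in s..t, ((inner ℂ (e t + e s) (g r)).re +
        μ * (inner ℂ (C (u t) + C (u s)) (N r)).re - 2 * L r) := by
    rw [intervalIntegral.integral_sub ((hi _ continuous_const s t).add
      ((hn _ continuous_const s t).const_mul μ)) ((hLi s t).const_mul 2), ← e1,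
      intervalIntegral.integral_const_mul,
      ← intervalIntegral.integral_interval_sub_left (hLi 0 t) (hLi 0 s)]
    simp only [hψ]
    ring
  rw [e2, ← intervalIntegral.integral_const_mul]
  refine intervalIntegral.norm_integral_le_of_norm_le hst (Eventually.of_forall fun r hr => ?_)
    ((hm s t).const_mul ε)
  have hrI : r ∈ Set.Icc 0 T := ⟨hs.trans hr.1.le, hr.2.trans htT⟩
  have c1 : |t - r| ≤ t - s := by
    rw [abs_of_nonneg (by linarith [hr.2])]
    linarith [hr.1]
  have c2 : |s - r| ≤ t - s := by
    rw [abs_sub_comm, abs_of_nonneg (by linarith [hr.1])]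
    linarith [hr.2]
  have e3 : (inner ℂ (e t + e s) (g r)).re + μ * (inner ℂ (C (u t) + C (u s)) (N r)).re - 2 * L r =
      (inner ℂ ((e t - e r) + (e s - e r)) (g r)).re +
      μ * (inner ℂ ((C (u t) - C (u r)) + (C (u s) - C (u r))) (N r)).re := by
    simp only [hL, inner_add_left, inner_sub_left, Complex.add_re, Complex.sub_re]
    ring
  have b1 : ‖(e t - e r) + (e s - e r)‖ ≤ 2 * ε := by
    refine (norm_add_le _ _).trans ?_
    linarith [h1 r hrI t htI (c1.trans (hd'.trans (min_le_left _ _))),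
      h1 r hrI s hsI (c2.trans (hd'.trans (min_le_left _ _)))]
  have b2 : ‖(C (u t) - C (u r)) + (C (u s) - C (u r))‖ ≤ 2 * ε := by
    refine (norm_add_le _ _).trans ?_
    linarith [h2 r hrI t htI (c1.trans (hd'.trans (min_le_right _ _))),
      h2 r hrI s hsI (c2.trans (hd'.trans (min_le_right _ _)))]
  have b3 : |(inner ℂ ((e t - e r) + (e s - e r)) (g r)).re| ≤ 2 * ε * G :=
    (Complex.abs_re_le_norm _).trans ((norm_inner_le_norm _ _).trans
      (mul_le_mul b1 (hG r hrI) (norm_nonneg _) (by positivity)))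
  have b4 : |(inner ℂ ((C (u t) - C (u r)) + (C (u s) - C (u r))) (N r)).re| ≤ 2 * ε * ‖N r‖ :=
    (Complex.abs_re_le_norm _).trans ((norm_inner_le_norm _ _).trans
      (mul_le_mul_of_nonneg_right b2 (norm_nonneg _)))
  rw [e3, Real.norm_eq_abs]
  refine (abs_add_le _ _).trans ?_
  rw [abs_mul]
  have b5 := mul_le_mul_of_nonneg_left b4 (abs_nonneg μ)
  linarith

end weak

/-! ### The virial identity for the nonlinearity -/

section nonlinear

/-- Young's inequality with conjugate exponents α + 2 and (α + 2)/(α + 1), after Cauchy–Schwarz.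
Equality holds for w = z. -/
theorem young_rpow {α : ℝ} (hα : 0 < α) (z w : ℂ) :
    (α + 2) * (inner ℂ (((‖z‖ ^ α : ℝ) : ℂ) * z) w).re ≤
      ‖w‖ ^ (α + 2) + (α + 1) * ‖z‖ ^ (α + 2) := by
  have hz := norm_nonneg z
  have h1 : (inner ℂ (((‖z‖ ^ α : ℝ) : ℂ) * z) w).re ≤ ‖w‖ * ‖z‖ ^ (α + 1) := by
    refine (Complex.re_le_norm _).trans ((norm_inner_le_norm _ _).trans (le_of_eq ?_))
    rw [norm_mul, Complex.norm_real, Real.norm_of_nonneg (by positivity), mul_comm,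
      Real.rpow_add_one' hz (by linarith)]
  have h2 := Real.young_inequality_of_nonneg (norm_nonneg w) (b := ‖z‖ ^ (α + 1)) (by positivity)
    (p := α + 2) (q := (α + 2) / (α + 1)) (Real.holderConjugate_iff.2 ⟨by linarith, by field_simp; ring⟩)
  rw [← Real.rpow_mul hz, mul_div_cancel₀ _ (by linarith)] at h2
  have h3 := mul_le_mul_of_nonneg_left (h1.trans h2) (show 0 ≤ α + 2 by linarith)
  refine h3.trans (le_of_eq ?_)
  have : α + 2 ≠ 0 := by linarith
  have : α + 1 ≠ 0 := by linarith
  field_simp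

/-- It will be used with z = f(x), w = f(e^s x), q = χ(x), r = χ(e^s x) and e = e^{sd/2}. At s = 0
both sides vanish, the property that lets the one-sided estimate determine a derivative. -/
theorem dil_convexity {α : ℝ} (hα : 0 < α) (z w : ℂ) {e q r : ℝ} (he : 0 ≤ e) (hq : 0 ≤ q)
    (hr : 0 ≤ r) :
    (α + 2) * (inner ℂ ((q : ℂ) • (((‖z‖ ^ α : ℝ) : ℂ) * z))
      ((e : ℂ) • ((r : ℂ) • w) - (q : ℂ) • z)).re ≤
      e ^ (α + 2) * (q * r) * ‖w‖ ^ (α + 2) +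
        ((α + 1) * (q * r) - (α + 2) * q ^ 2) * ‖z‖ ^ (α + 2) := by
  have hy := young_rpow hα z ((e : ℂ) * w)
  have hz : (inner ℂ (((‖z‖ ^ α : ℝ) : ℂ) * z) z).re = ‖z‖ ^ (α + 2) := by
    rw [← smul_eq_mul, inner_smul_left, Complex.conj_ofReal, Complex.re_ofReal_mul,
      inner_self_eq_norm_sq_to_K, Real.rpow_add' (norm_nonneg z) (by linarith), Real.rpow_two]
    norm_cast
  have e2 : (inner ℂ ((q : ℂ) • (((‖z‖ ^ α : ℝ) : ℂ) * z))
      ((e : ℂ) • ((r : ℂ) • w) - (q : ℂ) • z)).re =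
      q * r * (inner ℂ (((‖z‖ ^ α : ℝ) : ℂ) * z) ((e : ℂ) * w)).re - q ^ 2 * ‖z‖ ^ (α + 2) := by
    rw [← hz, inner_smul_left, inner_sub_right, Complex.conj_ofReal,
      show (e : ℂ) • ((r : ℂ) • w) = (r : ℂ) • ((e : ℂ) * w) by
        rw [smul_eq_mul, smul_eq_mul, smul_eq_mul]; ring,
      inner_smul_right, inner_smul_right, Complex.re_ofReal_mul, Complex.sub_re,
      Complex.re_ofReal_mul, Complex.re_ofReal_mul]
    ring
  rw [norm_mul, Complex.norm_real, Real.norm_of_nonneg he, Real.mul_rpow he (norm_nonneg _)] at hy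
  have := mul_le_mul_of_nonneg_left hy (mul_nonneg hq hr)
  rw [e2]
  linarith

variable {d : ℕ}

/-- A nonnegative smooth compactly supported function. -/
structure RealCutoff (d : ℕ) where
  /-- The underlying function. -/
  fn : Space d → ℝ
  smooth : ContDiff ℝ (⊤ : ℕ∞) fn
  compact : HasCompactSupport fn
  nonneg : ∀ x, 0 ≤ fn x

namespace RealCutoff

/-- The associated complex cutoff. -/
def toCutoff (χ : RealCutoff d) : Cutoff d where
  fn x := (χ.fn x : ℂ)
  smooth := Complex.ofRealCLM.contDiff.comp χ.smooth
  compact := χ.compact.comp_left (g := fun y : ℝ => (y : ℂ)) Complex.ofReal_zero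

theorem toCutoff_fn (χ : RealCutoff d) (x : Space d) : χ.toCutoff.fn x = (χ.fn x : ℂ) := rfl

/-- The radial derivative `x·∇χ`. -/
def radial (χ : RealCutoff d) (x : Space d) : ℝ := fderiv ℝ χ.fn x x

theorem continuous_radial (χ : RealCutoff d) : Continuous χ.radial :=
  (χ.smooth.continuous_fderiv (by simp)).clm_apply continuous_id

theorem exists_bound (χ : RealCutoff d) : ∃ C, 0 ≤ C ∧ ∀ x, |χ.fn x| ≤ C := by
  obtain ⟨C, hC⟩ := χ.compact.exists_bound_of_continuous χ.smooth.continuous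
  exact ⟨C, (norm_nonneg _).trans (hC 0), hC⟩

theorem exists_bound_radial (χ : RealCutoff d) : ∃ C, 0 ≤ C ∧ ∀ x, |χ.radial x| ≤ C := by
  have h : HasCompactSupport χ.radial := HasCompactSupport.intro χ.compact fun x hx => by
    have h := notMem_tsupport_iff_eventuallyEq.1 hx
    rw [radial, h.fderiv_eq]
    simp
  obtain ⟨C, hC⟩ := h.exists_bound_of_continuous χ.continuous_radial
  exact ⟨C, (norm_nonneg _).trans (hC 0), hC⟩

theorem hasDerivAt_exp_smul (χ : RealCutoff d) (x : Space d) (s : ℝ) :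
    HasDerivAt (fun s => χ.fn (Real.exp s • x)) (χ.radial (Real.exp s • x)) s := by
  have h1 := (χ.smooth.differentiable (by simp) (Real.exp s • x)).hasFDerivAt
  exact h1.comp_hasDerivAt s ((Real.hasDerivAt_exp s).smul_const x)

theorem hasDerivAt_exp_neg_smul (χ : RealCutoff d) (x : Space d) (s : ℝ) :
    HasDerivAt (fun s => χ.fn (Real.exp (-s) • x)) (-χ.radial (Real.exp (-s) • x)) s := by
  have h := (χ.hasDerivAt_exp_smul x (-s)).scomp s (hasDerivAt_neg s)
  rw [neg_one_smul] at h
  exact h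

/-- The weight that bounds the difference quotients of the potential energy. -/
def weight (χ : RealCutoff d) (α β s : ℝ) (x : Space d) : ℝ :=
  Real.exp (s * β) * χ.fn (Real.exp (-s) • x) * χ.fn x +
    (α + 1) * (χ.fn x * χ.fn (Real.exp s • x)) - (α + 2) * χ.fn x ^ 2

/-- The derivative of `weight` in `s`. -/
def weightDeriv (χ : RealCutoff d) (α β s : ℝ) (x : Space d) : ℝ :=
  (Real.exp (s * β) * β * χ.fn (Real.exp (-s) • x) -
    Real.exp (s * β) * χ.radial (Real.exp (-s) • x)) * χ.fn x +
    (α + 1) * (χ.fn x * χ.radial (Real.exp s • x))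

theorem hasDerivAt_weight (χ : RealCutoff d) (α β s : ℝ) (x : Space d) :
    HasDerivAt (fun s => χ.weight α β s x) (χ.weightDeriv α β s x) s := by
  have h1 : HasDerivAt (fun s => Real.exp (s * β)) (Real.exp (s * β) * β) s := by
    simpa using ((hasDerivAt_id s).mul_const β).exp
  have h2 := (h1.mul (χ.hasDerivAt_exp_neg_smul x s)).mul_const (χ.fn x)
  have h3 := ((χ.hasDerivAt_exp_smul x s).const_mul (χ.fn x)).const_mul (α + 1)
  have h4 := (h2.add h3).sub_const ((α + 2) * χ.fn x ^ 2)
  refine h4.congr_deriv ?_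
  rw [weightDeriv]
  ring

theorem continuous_weight (χ : RealCutoff d) (α β s : ℝ) : Continuous (χ.weight α β s) := by
  have := χ.smooth.continuous
  unfold weight
  fun_prop

theorem continuous_weightDeriv (χ : RealCutoff d) (α β s : ℝ) :
    Continuous (χ.weightDeriv α β s) := by
  have := χ.smooth.continuous
  have := χ.continuous_radial
  unfold weightDeriv
  fun_prop

theorem exists_bound_weightDeriv (χ : RealCutoff d) {α : ℝ} (hα : 0 < α) (β : ℝ) :
    ∃ C, ∀ s, |s| ≤ 1 → ∀ x, |χ.weightDeriv α β s x| ≤ C := by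
  obtain ⟨A, hA0, hA⟩ := χ.exists_bound
  obtain ⟨B, hB0, hB⟩ := χ.exists_bound_radial
  refine ⟨(Real.exp |β| * |β| * A + Real.exp |β| * B) * A + (α + 1) * (A * B), fun s hs x => ?_⟩
  have he : |Real.exp (s * β)| ≤ Real.exp |β| := by
    rw [abs_of_pos (Real.exp_pos _)]
    refine Real.exp_le_exp.2 ((le_abs_self _).trans ?_)
    rw [abs_mul]
    exact mul_le_of_le_one_left (abs_nonneg β) hs
  rw [weightDeriv]
  refine (abs_add_le _ _).trans (add_le_add ?_ ?_)
  · rw [abs_mul]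
    refine mul_le_mul ((abs_sub _ _).trans (add_le_add ?_ ?_)) (hA x) (abs_nonneg _) (by positivity)
    · rw [abs_mul, abs_mul]
      have := hA (Real.exp (-s) • x)
      gcongr
    · rw [abs_mul]
      have := hB (Real.exp (-s) • x)
      gcongr
  · rw [abs_mul, abs_mul, abs_of_pos (show 0 < α + 1 by linarith)]
    have := hB (Real.exp s • x)
    have := hA x
    gcongr

theorem exists_bound_weight (χ : RealCutoff d) (α β s : ℝ) :
    ∃ C, ∀ x, ‖χ.weight α β s x‖ ≤ C := by
  refine HasCompactSupport.exists_bound_of_continuous (HasCompactSupport.intro χ.compact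
    fun x hx => ?_) (χ.continuous_weight α β s)
  simp [weight, image_eq_zero_of_notMem_tsupport hx]

/-- Only the smooth weight depends on s, so one differentiates under the integral. The term
χ(e^{-s}x) contributes -χ x·∇χ and the term with factor α + 1 contributes (α + 1) χ x·∇χ, which
leaves α χ x·∇χ. -/
theorem hasDerivAt_integral_weight (χ : RealCutoff d) {α : ℝ} (hα : 0 < α) (β : ℝ)
    {w : Space d → ℝ} (hw : Integrable w) :
    HasDerivAt (fun s => ∫ x, χ.weight α β s x * w x)
      (∫ x, (β * χ.fn x ^ 2 + α * (χ.fn x * χ.radial x)) * w x) 0 := by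
  obtain ⟨C, hC⟩ := χ.exists_bound_weightDeriv hα β
  have h0 : Integrable fun x => χ.weight α β 0 x * w x := by
    obtain ⟨B, hB⟩ := χ.exists_bound_weight α β 0
    exact hw.bdd_mul (χ.continuous_weight α β 0).aestronglyMeasurable (Eventually.of_forall hB)
  have h := (hasDerivAt_integral_of_dominated_loc_of_deriv_le (μ := volume)
    (F := fun s x => χ.weight α β s x * w x) (F' := fun s x => χ.weightDeriv α β s x * w x)
    (x₀ := 0) (s := Metric.ball 0 1) (bound := fun x => C * |w x|) (Metric.ball_mem_nhds _ one_pos)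
    (Eventually.of_forall fun s =>
      (χ.continuous_weight α β s).aestronglyMeasurable.mul hw.aestronglyMeasurable) h0
    ((χ.continuous_weightDeriv α β 0).aestronglyMeasurable.mul hw.aestronglyMeasurable)
    (Eventually.of_forall fun x s hs => ?_) (hw.abs.const_mul C)
    (Eventually.of_forall fun x s _ => (χ.hasDerivAt_weight α β s x).mul_const (w x))).2
  · refine h.congr_deriv (integral_congr_ae (Eventually.of_forall fun x => ?_))
    simp only [weightDeriv, zero_mul, neg_zero, Real.exp_zero, one_smul, one_mul]
    ring
  · rw [Real.norm_eq_abs, abs_mul]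
    refine mul_le_mul_of_nonneg_right (hC s ?_ x) (abs_nonneg _)
    rw [Metric.mem_ball, Real.dist_eq, sub_zero] at hs
    exact hs.le

theorem integral_weight_zero (χ : RealCutoff d) (α β : ℝ) (w : Space d → ℝ) :
    ∫ x, χ.weight α β 0 x * w x = 0 := by
  refine integral_eq_zero_of_ae (Eventually.of_forall fun x => ?_)
  simp only [weight, zero_mul, neg_zero, Real.exp_zero, one_smul, one_mul, Pi.zero_apply]
  ring

/-- The convexity inequality for the potential energy under dilations. -/
theorem re_inner_dil_le (χ : RealCutoff d) {α : ℝ} (hα : 0 < α) {f N : L2 d}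
    (hf : Integrable fun x => ‖f x‖ ^ (α + 2))
    (hN : N =ᵐ[volume] fun x => ((‖f x‖ ^ α : ℝ) : ℂ) * f x) (s : ℝ) :
    (α + 2) * (inner ℂ (χ.toCutoff.mul N) (dil s (χ.toCutoff.mul f) - χ.toCutoff.mul f)).re ≤
      ∫ x, χ.weight α (d * α / 2) s x * ‖f x‖ ^ (α + 2) := by
  set G : Space d → ℝ := fun y => Real.exp (s * (d / 2) * (α + 2)) *
    (χ.fn (Real.exp (-s) • y) * χ.fn y) * ‖f y‖ ^ (α + 2) with hG
  set K : Space d → ℝ := fun x => ((α + 1) * (χ.fn x * χ.fn (Real.exp s • x)) -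
    (α + 2) * χ.fn x ^ 2) * ‖f x‖ ^ (α + 2) with hK
  have hχ := χ.smooth.continuous
  have hGi : Integrable G := by
    have hc : Continuous fun y => Real.exp (s * (d / 2) * (α + 2)) *
      (χ.fn (Real.exp (-s) • y) * χ.fn y) := by fun_prop
    obtain ⟨B, hB⟩ := HasCompactSupport.exists_bound_of_continuous (HasCompactSupport.intro χ.compact
      fun x hx => by simp [image_eq_zero_of_notMem_tsupport hx]) hc
    exact hf.bdd_mul hc.aestronglyMeasurable (Eventually.of_forall hB)
  have hKi : Integrable K := by
    have hc : Continuous fun x => (α + 1) * (χ.fn x * χ.fn (Real.exp s • x)) -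
      (α + 2) * χ.fn x ^ 2 := by fun_prop
    obtain ⟨B, hB⟩ := HasCompactSupport.exists_bound_of_continuous (HasCompactSupport.intro χ.compact
      fun x hx => by simp [image_eq_zero_of_notMem_tsupport hx]) hc
    exact hf.bdd_mul hc.aestronglyMeasurable (Eventually.of_forall hB)
  have hGs : Integrable fun x => G (Real.exp s • x) := hGi.comp_smul (Real.exp_pos s).ne'
  -- The substitution y = e^s x moves the dilation from |f(e^s x)|^{α+2} onto the cutoffs, so that f
  -- no longer depends on s. The Jacobian e^{-sd} combines with e^{sd(α+2)/2} to the factor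
  -- e^{sdα/2} of the weight.
  have e1 : ∫ x, χ.weight α (d * α / 2) s x * ‖f x‖ ^ (α + 2) =
      ∫ x, (G (Real.exp s • x) + K x) := by
    rw [integral_add hGs hKi, integral_comp_exp_smul s G, smul_eq_mul, ← integral_const_mul,
      ← integral_add (hGi.const_mul _) hKi]
    refine integral_congr_ae (Eventually.of_forall fun x => ?_)
    have h1 : Real.exp (s * (d * α / 2)) =
        Real.exp (-(s * d)) * Real.exp (s * (d / 2) * (α + 2)) := by
      rw [← Real.exp_add]
      congr 1
      ring
    simp only [hG, hK, weight, h1]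
    ring
  rw [L2.inner_def, ← Complex.reCLM_apply, ← Complex.reCLM.integral_comp_comm
    (L2.integrable_inner _ _), ← integral_const_mul, e1]
  refine integral_mono_ae (((Complex.reCLM.integrable_comp (L2.integrable_inner _ _))).const_mul _)
    (hGs.add hKi) ?_
  filter_upwards [χ.toCutoff.mul_coeFn N, Lp.coeFn_sub (dil s (χ.toCutoff.mul f)) (χ.toCutoff.mul f),
    dil_coeFn s (χ.toCutoff.mul f), dilFun_congr s (χ.toCutoff.mul_coeFn f), hN,
    χ.toCutoff.mul_coeFn f] with x h1 h2 h3 h4 h5 h6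
  rw [Complex.reCLM_apply, h1, h2, Pi.sub_apply, h3, h4, h6, h5]
  simp only [toCutoff_fn, dilFun, hG, hK]
  refine (dil_convexity hα (f x) (f (Real.exp s • x)) (Real.exp_pos (s * (d / 2))).le
    (χ.nonneg x) (χ.nonneg (Real.exp s • x))).trans (le_of_eq ?_)
  rw [smul_smul (Real.exp (-s)), ← Real.exp_add, neg_add_cancel, Real.exp_zero, one_smul,
    ← Real.exp_mul]

/-- The virial identity for the nonlinearity. -/
theorem re_inner_gen (χ : RealCutoff d) {a α : ℝ} (hα : 0 < α) {f N : L2 d} {g : L2Vec d}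
    (h : (WithLp.toLp 2 (f, g) : WithLp 2 (L2 d × L2Vec d)) ∈ graphCl (jMap d) (dMap d a))
    (hf : Integrable fun x => ‖f x‖ ^ (α + 2))
    (hN : N =ᵐ[volume] fun x => ((‖f x‖ ^ α : ℝ) : ℂ) * f x) :
    (α + 2) * (inner ℂ (χ.toCutoff.mul N) (χ.toCutoff.gen a f g)).re =
      ∫ x, (d * α / 2 * χ.fn x ^ 2 + α * (χ.fn x * χ.radial x)) * ‖f x‖ ^ (α + 2) := by
  have h1 := χ.hasDerivAt_integral_weight hα (d * α / 2) hf
  have h2 : HasDerivAt (fun s => (α + 2) * (inner ℂ (χ.toCutoff.mul N)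
      (dil s (χ.toCutoff.mul f) - χ.toCutoff.mul f)).re)
      ((α + 2) * (inner ℂ (χ.toCutoff.mul N) (χ.toCutoff.gen a f g)).re) 0 := by
    have h3 := (hasDerivAt_dil_mul a χ.toCutoff h).sub_const (χ.toCutoff.mul f)
    have h4 := ((innerSL ℂ (χ.toCutoff.mul N)).restrictScalars ℝ).hasFDerivAt.comp_hasDerivAt 0 h3
    exact (Complex.reCLM.hasFDerivAt.comp_hasDerivAt 0 h4).const_mul (α + 2)
  have h5 := h1.sub h2
  -- The difference of the two sides of `re_inner_dil_le` is nonnegative and vanishes at s = 0. Both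
  -- sides are differentiable there, so their derivatives coincide: an inequality for s of both
  -- signs yields an identity.
  have h6 : IsLocalMin ((fun s => ∫ x, χ.weight α (d * α / 2) s x * ‖f x‖ ^ (α + 2)) -
      fun s => (α + 2) * (inner ℂ (χ.toCutoff.mul N)
      (dil s (χ.toCutoff.mul f) - χ.toCutoff.mul f)).re) 0 := by
    refine Eventually.of_forall fun s => ?_
    simp only [Pi.sub_apply, integral_weight_zero, dil_zero, sub_self, inner_zero_right,
      Complex.zero_re, mul_zero]
    exact sub_nonneg.2 (χ.re_inner_dil_le hα hf hN s)
  have h7 := h6.hasDerivAt_eq_zero h5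
  linarith

end RealCutoff

end nonlinear

/-! ### The virial identity at a fixed time -/

section virial

variable {d : ℕ}

/-- The vector field `f e_i`. -/
def embOp (i : Fin d) : L2 d →L[ℂ] L2Vec d :=
  vecMulOp (fun _ => EuclideanSpace.single i 1) aestronglyMeasurable_const 1 fun _ => by simp

theorem embOp_coeFn (i : Fin d) (f : L2 d) :
    embOp i f =ᵐ[volume] fun x => f x • EuclideanSpace.single i (1 : ℂ) :=
  vecMulOp_coeFn _ _ f

theorem coordOp_embOp (i j : Fin d) (f : L2 d) :
    coordOp j (embOp i f) = if j = i then f else 0 := by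
  refine Lp.ext ?_
  filter_upwards [coordOp_coeFn j (embOp i f), embOp_coeFn i f, Lp.coeFn_zero ℂ 2 volume]
    with x h1 h2 h3
  rw [h1, h2]
  split_ifs with h
  · simp [h]
  · rw [h3]
    simp [h]

theorem dil_embOp (s : ℝ) (i : Fin d) (f : L2 d) : dil s (embOp i f) = embOp i (dil s f) := by
  refine Lp.ext ?_
  filter_upwards [dil_coeFn s (embOp i f), dilFun_congr s (embOp_coeFn i f), embOp_coeFn i (dil s f),
    dil_coeFn s f] with x h1 h2 h3 h4
  rw [h1, h2, h3, h4]
  simp only [dilFun, smul_smul, smul_eq_mul]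

namespace Cutoff

/-- The components of f∇η are f multiplied by the cutoffs ∂ᵢη, so the scalar differentiability
result for dilations applies to each of them. -/
theorem gmul_eq_sum (η : Cutoff d) (f : L2 d) :
    η.gmul f = ∑ i, embOp i ((η.pderiv i).mul f) := by
  rw [← sub_eq_zero]
  refine eq_zero_of_coordOp fun j => ?_
  rw [map_sub, map_sum]
  simp_rw [coordOp_embOp]
  rw [Finset.sum_ite_eq, if_pos (Finset.mem_univ _), sub_eq_zero]
  refine Lp.ext ?_
  filter_upwards [coordOp_coeFn j (η.gmul f), η.gmul_coeFn f, (η.pderiv j).mul_coeFn f]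
    with x h1 h2 h3
  rw [h1, h2, h3]
  simp [grad, pderiv, mul_comm]

/-- The generator of dilations, applied to `f ∇η`, in terms of `f` and `g = D f`. -/
def gradGen (a : ℝ) (η : Cutoff d) (f : L2 d) (g : L2Vec d) : L2Vec d :=
  ∑ i, embOp i ((η.pderiv i).gen a f g)

theorem hasDerivAt_dil_gmul (a : ℝ) (η : Cutoff d) {f : L2 d} {g : L2Vec d}
    (h : (WithLp.toLp 2 (f, g) : WithLp 2 (L2 d × L2Vec d)) ∈ graphCl (jMap d) (dMap d a)) :
    HasDerivAt (fun s => dil s (η.gmul f)) (η.gradGen a f g) 0 := by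
  have h1 : (fun s => dil s (η.gmul f)) = fun s => ∑ i, embOp i (dil s ((η.pderiv i).mul f)) := by
    ext1 s
    rw [gmul_eq_sum, map_sum]
    simp_rw [dil_embOp]
  rw [h1]
  refine HasDerivAt.fun_sum fun i _ => ?_
  exact ((embOp i).restrictScalars ℝ).hasFDerivAt.comp_hasDerivAt 0
    (hasDerivAt_dil_mul a (η.pderiv i) h)

theorem exists_dil_gmul_bound (a : ℝ) (η : Cutoff d) : ∃ C, 0 ≤ C ∧ ∀ (f : L2 d) (g : L2Vec d),
    (WithLp.toLp 2 (f, g) : WithLp 2 (L2 d × L2Vec d)) ∈ graphCl (jMap d) (dMap d a) → ∀ s,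
      ‖dil s (η.gmul f) - η.gmul f‖ ≤ C * (‖f‖ + ‖g‖) * |s| := by
  choose C hC0 hC using fun i => exists_gen_bound a (η.pderiv i)
  refine ⟨∑ i, ‖embOp i‖ * C i, Finset.sum_nonneg fun i _ => mul_nonneg (norm_nonneg _) (hC0 i),
    fun f g h s => ?_⟩
  rw [gmul_eq_sum, map_sum, ← Finset.sum_sub_distrib, Finset.sum_mul, Finset.sum_mul]
  refine norm_sum_le_of_le _ fun i _ => ?_
  rw [dil_embOp, ← map_sub]
  refine ((embOp i).le_opNorm _).trans ?_
  rw [mul_assoc, mul_assoc]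
  refine mul_le_mul_of_nonneg_left ?_ (norm_nonneg _)
  rw [← mul_assoc]
  exact (norm_dil_mul_sub_le a (η.pderiv i) h s).trans
    (mul_le_mul_of_nonneg_right (hC i f g) (abs_nonneg s))

theorem _root_.NLSInvSq.hasDerivAt_re_inner {E : Type*} [NormedAddCommGroup E]
    [InnerProductSpace ℂ E] (G : Lp E 2 (volume : Measure (Space d)))
    {F : ℝ → Lp E 2 (volume : Measure (Space d))} {F' : Lp E 2 (volume : Measure (Space d))}
    {t : ℝ} (h : HasDerivAt F F' t) :
    HasDerivAt (fun s => (inner ℂ G (F s)).re) (inner ℂ G F').re t :=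
  Complex.reCLM.hasFDerivAt.comp_hasDerivAt t
    (((innerSL ℂ G).restrictScalars ℝ).hasFDerivAt.comp_hasDerivAt t h)

theorem continuous_gen (a : ℝ) (η : Cutoff d) {T : Type*} [TopologicalSpace T] {f : T → L2 d}
    {g : T → L2Vec d} (hf : Continuous f) (hg : Continuous g) :
    Continuous fun t => η.gen a (f t) (g t) :=
  ((dotOp η.field _ _ _).continuous.comp hg).add ((mulOp (η.radial _) _ _ _).continuous.comp hf)

theorem continuous_dmul (η : Cutoff d) {T : Type*} [TopologicalSpace T] {f : T → L2 d}
    {g : T → L2Vec d} (hf : Continuous f) (hg : Continuous g) :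
    Continuous fun t => η.dmul (f t) (g t) :=
  (η.mul.continuous.comp hg).add (η.gmul.continuous.comp hf)

theorem continuous_gradGen (a : ℝ) (η : Cutoff d) {T : Type*} [TopologicalSpace T] {f : T → L2 d}
    {g : T → L2Vec d} (hf : Continuous f) (hg : Continuous g) :
    Continuous fun t => η.gradGen a (f t) (g t) :=
  continuous_finsetSum _ fun i _ => (embOp i).continuous.comp ((η.pderiv i).continuous_gen a hf hg)

end Cutoff

namespace RealCutoff

theorem inner_mul_left {E : Type*} [NormedAddCommGroup E] [InnerProductSpace ℂ E] (χ : RealCutoff d)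
    (f g : Lp E 2 (volume : Measure (Space d))) :
    inner ℂ (χ.toCutoff.mul f) g = inner ℂ f (χ.toCutoff.mul g) := by
  rw [L2.inner_def, L2.inner_def]
  refine integral_congr_ae ?_
  filter_upwards [χ.toCutoff.mul_coeFn f, χ.toCutoff.mul_coeFn g] with x h1 h2
  rw [h1, h2, toCutoff_fn, inner_smul_left, inner_smul_right, Complex.conj_ofReal]

/-- The antisymmetric operator `χ (U_s - U_{-s}) χ`, where `U_s` is the dilation. -/
def comm (χ : RealCutoff d) (s : ℝ) : L2 d →L[ℂ] L2 d :=
  χ.toCutoff.mul ∘L ((dil s).toContinuousLinearMap - (dil (-s)).toContinuousLinearMap) ∘L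
    χ.toCutoff.mul

theorem comm_apply (χ : RealCutoff d) (s : ℝ) (f : L2 d) : χ.comm s f =
    χ.toCutoff.mul (dil s (χ.toCutoff.mul f) - dil (-s) (χ.toCutoff.mul f)) := rfl

/-- Dilations satisfy (`dil s`)* = `dil (-s)`, and multiplication by the real function χ is
symmetric. -/
theorem inner_comm_left (χ : RealCutoff d) (s : ℝ) (f f' : L2 d) :
    inner ℂ (χ.comm s f) f' = - inner ℂ f (χ.comm s f') := by
  rw [comm_apply, comm_apply, inner_mul_left, ← inner_mul_left _ f, inner_sub_left, inner_sub_right,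
    inner_dil_left, inner_dil_left, neg_neg, neg_sub]

/-- The operator `D` applied to `(U_s - U_{-s}) f`, in terms of `D f`. -/
def dilDiff (s : ℝ) (G : L2Vec d) : L2Vec d :=
  (Real.exp s : ℂ) • dil s G - (Real.exp (-s) : ℂ) • dil (-s) G

/-- The operator `D` applied to `comm`, in terms of `f` and `g = D f`. -/
def commGrad (χ : RealCutoff d) (s : ℝ) (f : L2 d) (g : L2Vec d) : L2Vec d :=
  χ.toCutoff.dmul (dil s (χ.toCutoff.mul f) - dil (-s) (χ.toCutoff.mul f))
    (dilDiff s (χ.toCutoff.dmul f g))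

theorem comm_mem (χ : RealCutoff d) (a s : ℝ) {f : L2 d} {g : L2Vec d}
    (h : (WithLp.toLp 2 (f, g) : WithLp 2 (L2 d × L2Vec d)) ∈ graphCl (jMap d) (dMap d a)) :
    (WithLp.toLp 2 (χ.comm s f, χ.commGrad s f g) : WithLp 2 (L2 d × L2Vec d)) ∈
      graphCl (jMap d) (dMap d a) := by
  have h1 := χ.toCutoff.mul_mem a h
  exact χ.toCutoff.mul_mem a (Submodule.sub_mem _ (dil_mem a s h1) (dil_mem a (-s) h1))

theorem continuous_commGrad (χ : RealCutoff d) (s : ℝ) {T : Type*} [TopologicalSpace T] {f : T → L2 d}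
    {g : T → L2Vec d} (hf : Continuous f) (hg : Continuous g) :
    Continuous fun t => χ.commGrad s (f t) (g t) := by
  have h1 : Continuous fun t => χ.toCutoff.mul (f t) := χ.toCutoff.mul.continuous.comp hf
  have h2 := χ.toCutoff.continuous_dmul hf hg
  refine χ.toCutoff.continuous_dmul (((dil s).continuous.comp h1).sub ((dil (-s)).continuous.comp h1)) ?_
  have h3 : Continuous fun t => dil s (χ.toCutoff.dmul (f t) (g t)) := (dil s).continuous.comp h2
  have h4 : Continuous fun t => dil (-s) (χ.toCutoff.dmul (f t) (g t)) :=
    (dil (-s)).continuous.comp h2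
  exact (h3.const_smul (Real.exp s : ℂ)).sub (h4.const_smul (Real.exp (-s) : ℂ))

/-- The rate of change of `Im ⟨u, comm s u⟩ / 2` along the flow. -/
def rate (χ : RealCutoff d) (μ s : ℝ) (f : L2 d) (g : L2Vec d) (N : L2 d) : ℝ :=
  (inner ℂ (χ.commGrad s f g) g).re + μ * (inner ℂ (χ.comm s f) N).re

/-- The limit of `rate / (2s)` as `s → 0`. -/
def virial (χ : RealCutoff d) (a μ : ℝ) (f : L2 d) (g : L2Vec d) (N : L2 d) : ℝ :=
  ‖χ.toCutoff.dmul f g‖ ^ 2 -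
    (inner ℂ (χ.toCutoff.dmul f g) (χ.toCutoff.gmul f - χ.toCutoff.gradGen a f g)).re +
    (inner ℂ (χ.toCutoff.gmul (χ.toCutoff.gen a f g)) g).re +
    μ * (inner ℂ (χ.toCutoff.mul (χ.toCutoff.gen a f g)) N).re

/-- ⟨`dil (-s)` G, G⟩ is the conjugate of ⟨`dil s` G, G⟩, so the real parts combine with the factor
e^s - e^{-s}. This vanishes to first order at s = 0, so continuity of s ↦ `dil s` G suffices,
although G = D(χf) need not be differentiable under dilations. -/
theorem re_inner_dilDiff_self (s : ℝ) (G : L2Vec d) :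
    (inner ℂ (dilDiff s G) G).re = (Real.exp s - Real.exp (-s)) * (inner ℂ (dil s G) G).re := by
  rw [dilDiff, inner_sub_left, inner_smul_left, inner_smul_left, Complex.conj_ofReal,
    Complex.conj_ofReal, Complex.sub_re, Complex.re_ofReal_mul, Complex.re_ofReal_mul,
    inner_dil_left (-s), neg_neg, ← inner_conj_symm G, Complex.conj_re]
  ring

/-- The dilations are moved from G onto Y. In the application Y = f∇χ, which is differentiable under
dilations because f lies in the form domain. -/
theorem inner_dilDiff (s : ℝ) (G Y : L2Vec d) :
    inner ℂ (dilDiff s G) Y = inner ℂ G ((Real.exp s : ℂ) • dil (-s) Y -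
      (Real.exp (-s) : ℂ) • dil s Y) := by
  rw [dilDiff, inner_sub_left, inner_smul_left, inner_smul_left, Complex.conj_ofReal,
    Complex.conj_ofReal, inner_dil_left, inner_dil_left, neg_neg, inner_sub_right,
    inner_smul_right, inner_smul_right]

theorem mul_eq_dmul_sub (η : Cutoff d) (f : L2 d) (g : L2Vec d) :
    η.mul g = η.dmul f g - η.gmul f := by
  rw [Cutoff.dmul, add_sub_cancel_right]

theorem re_inner_dmul (χ : RealCutoff d) (f k : L2 d) (g E : L2Vec d) :
    (inner ℂ (χ.toCutoff.dmul k E) g).re = (inner ℂ E (χ.toCutoff.dmul f g)).re -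
      (inner ℂ E (χ.toCutoff.gmul f)).re + (inner ℂ (χ.toCutoff.gmul k) g).re := by
  rw [Cutoff.dmul, inner_add_left, inner_mul_left, mul_eq_dmul_sub _ f, inner_sub_right,
    Complex.add_re, Complex.sub_re]

/-- A rearrangement in which each term can be differentiated at s = 0: the dilations either act on f
times a smooth cutoff, or pair D(χf) with itself behind the vanishing factor e^s - e^{-s}. -/
theorem rate_eq (χ : RealCutoff d) (μ s : ℝ) (f : L2 d) (g : L2Vec d) (N : L2 d) :
    χ.rate μ s f g N = (Real.exp s - Real.exp (-s)) *
        (inner ℂ (dil s (χ.toCutoff.dmul f g)) (χ.toCutoff.dmul f g)).re -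
      (inner ℂ (χ.toCutoff.dmul f g) ((Real.exp s : ℂ) • dil (-s) (χ.toCutoff.gmul f) -
        (Real.exp (-s) : ℂ) • dil s (χ.toCutoff.gmul f))).re +
      (inner ℂ (χ.toCutoff.gmul (dil s (χ.toCutoff.mul f) - dil (-s) (χ.toCutoff.mul f))) g).re +
      μ * (inner ℂ (χ.toCutoff.mul (dil s (χ.toCutoff.mul f) - dil (-s) (χ.toCutoff.mul f))) N).re := by
  rw [rate, commGrad, comm_apply, re_inner_dmul χ f, re_inner_dilDiff_self, inner_dilDiff]

/-- At a zero of k the slope of the product is the slope of k times the value of b, so b need only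
be continuous. -/
theorem _root_.NLSInvSq.hasDerivAt_mul_of_continuousAt {k b : ℝ → ℝ} {k' t : ℝ}
    (hk : HasDerivAt k k' t) (h0 : k t = 0) (hb : ContinuousAt b t) :
    HasDerivAt (fun s => k s * b s) (k' * b t) t := by
  rw [hasDerivAt_iff_tendsto_slope] at hk ⊢
  refine (hk.mul (hb.tendsto.mono_left nhdsWithin_le_nhds)).congr fun s => ?_
  simp only [slope_def_field, h0]
  ring

theorem hasDerivAt_dil_mul_sub_dil_neg (χ : RealCutoff d) {a : ℝ} {f : L2 d} {g : L2Vec d}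
    (h : (WithLp.toLp 2 (f, g) : WithLp 2 (L2 d × L2Vec d)) ∈ graphCl (jMap d) (dMap d a)) :
    HasDerivAt (fun s => dil s (χ.toCutoff.mul f) - dil (-s) (χ.toCutoff.mul f))
      ((2 : ℂ) • χ.toCutoff.gen a f g) 0 := by
  have hneg : HasDerivAt (fun s : ℝ => -s) (-1) 0 := hasDerivAt_neg 0
  have h1 := hasDerivAt_dil_mul a χ.toCutoff h
  have h1' : HasDerivAt (fun s => dil s (χ.toCutoff.mul f)) (χ.toCutoff.gen a f g) (-0) := by
    rw [neg_zero]; exact h1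
  refine (h1.sub (h1'.scomp (0 : ℝ) hneg)).congr_deriv ?_
  rw [two_smul, neg_one_smul, sub_neg_eq_add]

theorem hasDerivAt_rate (χ : RealCutoff d) (a μ : ℝ) {f : L2 d} {g : L2Vec d}
    (h : (WithLp.toLp 2 (f, g) : WithLp 2 (L2 d × L2Vec d)) ∈ graphCl (jMap d) (dMap d a))
    (N : L2 d) : HasDerivAt (fun s => χ.rate μ s f g N) (2 * χ.virial a μ f g N) 0 := by
  set G := χ.toCutoff.dmul f g with hG
  set Y := χ.toCutoff.gmul f with hY
  set Z := χ.toCutoff.gradGen a f g with hZ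
  have hneg : HasDerivAt (fun s : ℝ => -s) (-1) 0 := hasDerivAt_neg 0
  have hexp : HasDerivAt Real.exp 1 0 := by simpa using Real.hasDerivAt_exp 0
  have hexpn : HasDerivAt (fun s => Real.exp (-s)) (-1) 0 := by
    have h1 := (Real.hasDerivAt_exp (-0)).comp 0 hneg
    rw [neg_zero, Real.exp_zero, one_mul] at h1
    exact h1
  have hdA := χ.hasDerivAt_dil_mul_sub_dil_neg h
  have hdY : HasDerivAt (fun s => (Real.exp s : ℂ) • dil (-s) Y - (Real.exp (-s) : ℂ) • dil s Y)
      ((2 : ℂ) • (Y - Z)) 0 := by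
    have h1 := χ.toCutoff.hasDerivAt_dil_gmul a h
    have h1' : HasDerivAt (fun s => dil s Y) Z (-0) := by rw [neg_zero]; exact h1
    refine ((hexp.ofReal_comp.smul (h1'.scomp (0 : ℝ) hneg)).sub
      (hexpn.ofReal_comp.smul h1)).congr_deriv ?_
    simp only [Function.comp_apply, neg_zero, dil_zero, Real.exp_zero, Complex.ofReal_one, one_smul,
      Complex.ofReal_neg, neg_smul, two_smul]
    abel
  have hd1 : HasDerivAt (fun s => (Real.exp s - Real.exp (-s)) * (inner ℂ (dil s G) G).re)
      (2 * ‖G‖ ^ 2) 0 := by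
    have hc : ContinuousAt (fun s => (inner ℂ (dil s G) G).re) 0 :=
      (Complex.continuous_re.comp ((continuous_dil G).inner continuous_const)).continuousAt
    refine (hasDerivAt_mul_of_continuousAt (hexp.sub hexpn) (by simp) hc).congr_deriv ?_
    rw [dil_zero, inner_self_eq_norm_sq_to_K]
    norm_cast
  have hd2 := hasDerivAt_re_inner G hdY
  have hd3 := hasDerivAt_re_inner g
    ((χ.toCutoff.gmul.restrictScalars ℝ).hasFDerivAt.comp_hasDerivAt 0 hdA)
  have hd4 := hasDerivAt_re_inner N
    (((χ.toCutoff.mul (E := ℂ)).restrictScalars ℝ).hasFDerivAt.comp_hasDerivAt 0 hdA)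
  have e : (fun s => χ.rate μ s f g N) = fun s => (Real.exp s - Real.exp (-s)) *
        (inner ℂ (dil s G) G).re -
      (inner ℂ G ((Real.exp s : ℂ) • dil (-s) Y - (Real.exp (-s) : ℂ) • dil s Y)).re +
      (inner ℂ g (χ.toCutoff.gmul (dil s (χ.toCutoff.mul f) - dil (-s) (χ.toCutoff.mul f)))).re +
      μ * (inner ℂ N (χ.toCutoff.mul (dil s (χ.toCutoff.mul f) -
        dil (-s) (χ.toCutoff.mul f)))).re := by
    ext1 s
    rw [rate_eq, ← inner_conj_symm _ g, ← inner_conj_symm _ N, Complex.conj_re, Complex.conj_re]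
  rw [e]
  refine (((hd1.sub hd2).add hd3).add (hd4.const_mul μ)).congr_deriv ?_
  rw [virial, ← inner_conj_symm _ g, ← inner_conj_symm _ N, Complex.conj_re, Complex.conj_re]
  have e1 : χ.toCutoff.gmul ((2 : ℂ) • χ.toCutoff.gen a f g) =
      (2 : ℂ) • χ.toCutoff.gmul (χ.toCutoff.gen a f g) := map_smul _ _ _
  have e2 : χ.toCutoff.mul ((2 : ℂ) • χ.toCutoff.gen a f g) =
      (2 : ℂ) • χ.toCutoff.mul (χ.toCutoff.gen a f g) := map_smul _ _ _
  have e3 : ∀ z : ℂ, (2 * z).re = 2 * z.re := fun z => by simp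
  simp only [ContinuousLinearMap.coe_restrictScalars', e1, e2, inner_smul_right, e3]
  ring

theorem _root_.NLSInvSq.abs_exp_sub_exp_neg_le {s : ℝ} (hs : |s| ≤ 1) :
    |Real.exp s - Real.exp (-s)| ≤ 4 * |s| := by
  have h1 := Real.abs_exp_sub_one_le hs
  have h2 := Real.abs_exp_sub_one_le (x := -s) (by rwa [abs_neg])
  rw [abs_neg] at h2
  calc _ = |(Real.exp s - 1) - (Real.exp (-s) - 1)| := by ring_nf
    _ ≤ _ := (abs_sub _ _).trans (by linarith)

theorem norm_dil_mul_sub_dil_neg_le (χ : RealCutoff d) (a : ℝ) {f : L2 d} {g : L2Vec d}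
    (h : (WithLp.toLp 2 (f, g) : WithLp 2 (L2 d × L2Vec d)) ∈ graphCl (jMap d) (dMap d a)) (s : ℝ) :
    ‖dil s (χ.toCutoff.mul f) - dil (-s) (χ.toCutoff.mul f)‖ ≤
      2 * ‖χ.toCutoff.gen a f g‖ * |s| := by
  have h1 := norm_dil_mul_sub_le a χ.toCutoff h s
  have h2 := norm_dil_mul_sub_le a χ.toCutoff h (-s)
  rw [abs_neg] at h2
  calc _ = ‖(dil s (χ.toCutoff.mul f) - χ.toCutoff.mul f) -
        (dil (-s) (χ.toCutoff.mul f) - χ.toCutoff.mul f)‖ := by rw [sub_sub_sub_cancel_right]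
    _ ≤ _ := (norm_sub_le _ _).trans (by linarith)

theorem _root_.NLSInvSq.norm_exp_smul_dil_sub_le {Y : L2Vec d} {K s : ℝ} (hs : |s| ≤ 1)
    (hY : ∀ s, ‖dil s Y - Y‖ ≤ K * |s|) :
    ‖(Real.exp s : ℂ) • dil (-s) Y - (Real.exp (-s) : ℂ) • dil s Y‖ ≤
      (4 * ‖Y‖ + 2 * K) * |s| := by
  have e : (Real.exp s : ℂ) • dil (-s) Y - (Real.exp (-s) : ℂ) • dil s Y =
      ((Real.exp s - 1 : ℝ) : ℂ) • dil (-s) Y - ((Real.exp (-s) - 1 : ℝ) : ℂ) • dil s Y +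
      ((dil (-s) Y - Y) - (dil s Y - Y)) := by
    push_cast
    rw [sub_smul, sub_smul, one_smul, one_smul]
    abel
  have h1 := Real.abs_exp_sub_one_le hs
  have h2 := Real.abs_exp_sub_one_le (x := -s) (by rwa [abs_neg])
  have h3 := hY (-s)
  rw [abs_neg] at h2 h3
  have h4 : ‖((Real.exp s - 1 : ℝ) : ℂ) • dil (-s) Y‖ ≤ 2 * |s| * ‖Y‖ := by
    rw [norm_smul, Complex.norm_real, LinearIsometry.norm_map]
    exact mul_le_mul_of_nonneg_right h1 (norm_nonneg _)
  have h5 : ‖((Real.exp (-s) - 1 : ℝ) : ℂ) • dil s Y‖ ≤ 2 * |s| * ‖Y‖ := by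
    rw [norm_smul, Complex.norm_real, LinearIsometry.norm_map]
    exact mul_le_mul_of_nonneg_right h2 (norm_nonneg _)
  rw [e]
  refine (norm_add_le _ _).trans ((add_le_add (norm_sub_le _ _) (norm_sub_le _ _)).trans ?_)
  linarith [hY s]

/-- The factor |s| and the linear dependence on ‖N‖ make `rate`/s dominated by a time-integrable
function, as needed to let s → 0 under the time integral. -/
theorem exists_rate_bound (χ : RealCutoff d) (a μ : ℝ) : ∃ K, 0 ≤ K ∧ ∀ (f : L2 d) (g : L2Vec d)
    (N : L2 d) (s : ℝ), (WithLp.toLp 2 (f, g) : WithLp 2 (L2 d × L2Vec d)) ∈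
      graphCl (jMap d) (dMap d a) → |s| ≤ 1 →
      |χ.rate μ s f g N| ≤ K * (‖f‖ + ‖g‖) * (‖f‖ + ‖g‖ + ‖N‖) * |s| := by
  obtain ⟨C₁, hC₁, h1⟩ := χ.toCutoff.exists_dmul_bound
  obtain ⟨C₂, hC₂, h2⟩ := χ.toCutoff.exists_dil_gmul_bound a
  obtain ⟨C₃, hC₃, h3⟩ := χ.toCutoff.exists_gen_bound a
  obtain ⟨P, hP⟩ : ∃ P, P = χ.toCutoff.gmul := ⟨_, rfl⟩
  obtain ⟨Q, hQ⟩ : ∃ Q, Q = χ.toCutoff.mul (E := ℂ) := ⟨_, rfl⟩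
  refine ⟨4 * C₁ ^ 2 + C₁ * (4 * ‖P‖ + 2 * C₂) + ‖P‖ * (2 * C₃) + |μ| * (‖Q‖ * (2 * C₃)),
    by positivity, fun f g N s h hs => ?_⟩
  obtain ⟨S, hS⟩ : ∃ S, S = ‖f‖ + ‖g‖ := ⟨_, rfl⟩
  have hS0 : 0 ≤ S := hS ▸ by positivity
  have hfS : ‖f‖ ≤ S := by rw [hS]; linarith [norm_nonneg g]
  have hgS : ‖g‖ ≤ S := by rw [hS]; linarith [norm_nonneg f]
  have h1 := h1 f g
  have h2 := h2 f g h
  have h3 := h3 f g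
  have hk := (χ.norm_dil_mul_sub_dil_neg_le a h s).trans
    (mul_le_mul_of_nonneg_right (mul_le_mul_of_nonneg_left h3 two_pos.le) (abs_nonneg s))
  have h4 := norm_exp_smul_dil_sub_le hs h2
  rw [rate_eq, ← hS]
  rw [← hS] at h1 h2 h3 hk h4
  rw [← hP] at h2 h4 ⊢
  rw [← hQ] at hk ⊢
  have hPf : ‖P f‖ ≤ ‖P‖ * S := (P.le_opNorm f).trans (by gcongr)
  have b1 : |(Real.exp s - Real.exp (-s)) *
      (inner ℂ (dil s (χ.toCutoff.dmul f g)) (χ.toCutoff.dmul f g)).re| ≤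
      4 * |s| * ((C₁ * S) * (C₁ * S)) := by
    rw [abs_mul]
    refine mul_le_mul (abs_exp_sub_exp_neg_le hs) ((Complex.abs_re_le_norm _).trans
      ((norm_inner_le_norm _ _).trans ?_)) (abs_nonneg _) (by positivity)
    rw [LinearIsometry.norm_map]
    gcongr
  have b2 : |(inner ℂ (χ.toCutoff.dmul f g) ((Real.exp s : ℂ) • dil (-s) (P f) -
        (Real.exp (-s) : ℂ) • dil s (P f))).re| ≤
      (C₁ * S) * ((4 * (‖P‖ * S) + 2 * (C₂ * S)) * |s|) := by
    refine (Complex.abs_re_le_norm _).trans ((norm_inner_le_norm _ _).trans ?_)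
    refine mul_le_mul h1 (h4.trans ?_) (norm_nonneg _) (by positivity)
    gcongr
  have b3 : |(inner ℂ (P (dil s (Q f) - dil (-s) (Q f))) g).re| ≤
      ‖P‖ * (2 * (C₃ * S) * |s|) * S := by
    refine (Complex.abs_re_le_norm _).trans ((norm_inner_le_norm _ _).trans ?_)
    exact mul_le_mul ((P.le_opNorm _).trans (by gcongr)) hgS (norm_nonneg _) (by positivity)
  have b4 : |μ * (inner ℂ (Q (dil s (Q f) - dil (-s) (Q f))) N).re| ≤
      |μ| * (‖Q‖ * (2 * (C₃ * S) * |s|) * ‖N‖) := by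
    rw [abs_mul]
    refine mul_le_mul_of_nonneg_left ?_ (abs_nonneg μ)
    refine (Complex.abs_re_le_norm _).trans ((norm_inner_le_norm _ _).trans ?_)
    exact mul_le_mul_of_nonneg_right ((Q.le_opNorm _).trans (by gcongr)) (norm_nonneg _)
  have key : ∀ x y z w : ℝ, |x - y + z + w| ≤ |x| + |y| + |z| + |w| := fun x y z w =>
    (abs_add_le _ _).trans (add_le_add_left ((abs_add_le _ _).trans
      (add_le_add_left (abs_sub _ _) _)) _)
  refine (key _ _ _ _).trans ((add_le_add (add_le_add (add_le_add b1 b2) b3) b4).trans ?_)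
  have hs0 := abs_nonneg s
  have hN0 := norm_nonneg N
  have r1 : 0 ≤ (4 * C₁ ^ 2 + C₁ * (4 * ‖P‖ + 2 * C₂) + ‖P‖ * (2 * C₃)) * (S * ‖N‖ * |s|) := by
    positivity
  have r2 : 0 ≤ |μ| * (‖Q‖ * (2 * C₃)) * (S * S * |s|) := by positivity
  linarith [r1, r2]

end RealCutoff

end virial

/-! ### The virial identity along the flow -/

section flow

variable {d : ℕ} {a μ : ℝ} {U : ℝ → L2 d →L[ℂ] L2 d} {N u : ℝ → L2 d} {g : ℝ → L2Vec d}

theorem Duhamel.intervalIntegrable_virial (hU : IsSchrodingerGroup a U) (h : Duhamel U μ N u)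
    (hg : Continuous g) (χ : RealCutoff d) (s t : ℝ) :
    IntervalIntegrable (fun r => χ.virial a μ (u r) (g r) (N r)) volume s t := by
  have hu := h.continuous hU
  have h1 := χ.toCutoff.continuous_dmul hu hg
  have h2 := χ.toCutoff.continuous_gen a hu hg
  have h3 := χ.toCutoff.continuous_gradGen a hu hg
  have h4 : Continuous fun r => χ.toCutoff.gmul (u r) := χ.toCutoff.gmul.continuous.comp hu
  have h5 : Continuous fun r => χ.toCutoff.gmul (χ.toCutoff.gen a (u r) (g r)) :=
    χ.toCutoff.gmul.continuous.comp h2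
  have h6 : Continuous fun r => χ.toCutoff.mul (χ.toCutoff.gen a (u r) (g r)) :=
    χ.toCutoff.mul.continuous.comp h2
  have h7 : Continuous fun r => ‖χ.toCutoff.dmul (u r) (g r)‖ ^ 2 -
    (inner ℂ (χ.toCutoff.dmul (u r) (g r))
      (χ.toCutoff.gmul (u r) - χ.toCutoff.gradGen a (u r) (g r))).re +
    (inner ℂ (χ.toCutoff.gmul (χ.toCutoff.gen a (u r) (g r))) (g r)).re :=
    ((h1.norm.pow 2).sub (Complex.continuous_re.comp (h1.inner (h4.sub h3)))).add
      (Complex.continuous_re.comp (h5.inner hg))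
  exact (h7.intervalIntegrable s t).add ((h.intervalIntegrable_re_inner h6 s t).const_mul μ)

theorem tendsto_inv_mul_of_hasDerivAt {f : ℝ → ℝ} {f' : ℝ} (h : HasDerivAt f f' 0) (h0 : f 0 = 0) :
    Tendsto (fun s => s⁻¹ * f s) (𝓝[≠] 0) (𝓝 f') := by
  refine (hasDerivAt_iff_tendsto_slope.1 h).congr fun s => ?_
  simp [slope_def_field, h0, div_eq_inv_mul]

theorem hasDerivAt_im_inner_comm (χ : RealCutoff d) {f : L2 d} {g : L2Vec d}
    (h : (WithLp.toLp 2 (f, g) : WithLp 2 (L2 d × L2Vec d)) ∈ graphCl (jMap d) (dMap d a)) :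
    HasDerivAt (fun s => (inner ℂ f (χ.comm s f)).im)
      (2 * (inner ℂ (χ.toCutoff.mul f) (χ.toCutoff.gen a f g)).im) 0 := by
  have h1 := χ.hasDerivAt_dil_mul_sub_dil_neg h
  have h2 := Complex.imCLM.hasFDerivAt.comp_hasDerivAt 0
    (((innerSL ℂ (χ.toCutoff.mul f)).restrictScalars ℝ).hasFDerivAt.comp_hasDerivAt 0 h1)
  have e : (fun s => (inner ℂ f (χ.comm s f)).im) = fun s => (inner ℂ (χ.toCutoff.mul f)
      (dil s (χ.toCutoff.mul f) - dil (-s) (χ.toCutoff.mul f))).im := by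
    ext1 s
    rw [RealCutoff.comm_apply, ← RealCutoff.inner_mul_left]
  rw [e]
  refine h2.congr_deriv ?_
  have e3 : ∀ z : ℂ, (2 * z).im = 2 * z.im := fun z => by simp
  simp only [ContinuousLinearMap.coe_restrictScalars', innerSL_apply_apply, inner_smul_right,
    Complex.imCLM_apply, e3]

/-- The virial identity. -/
theorem Duhamel.virial_identity (hd : 3 ≤ d) (ha : -(((d : ℝ) - 2) / 2) ^ 2 < a)
    (hU : IsSchrodingerGroup a U) (h : Duhamel U μ N u) (hg : Continuous g)
    (hug : ∀ t, (WithLp.toLp 2 (u t, g t) : WithLp 2 (L2 d × L2Vec d)) ∈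
      graphCl (jMap d) (dMap d a)) (χ : RealCutoff d) {T : ℝ} (hT : 0 ≤ T) :
    (inner ℂ (χ.toCutoff.mul (u T)) (χ.toCutoff.gen a (u T) (g T))).im -
      (inner ℂ (χ.toCutoff.mul (u 0)) (χ.toCutoff.gen a (u 0) (g 0))).im =
      2 * ∫ r in (0 : ℝ)..T, χ.virial a μ (u r) (g r) (N r) := by
  have hu := h.continuous hU
  obtain ⟨K, hK0, hK⟩ := χ.exists_rate_bound a μ
  obtain ⟨A, hA0, hA⟩ := exists_bound_Icc hu T
  obtain ⟨B, hB0, hB⟩ := exists_bound_Icc hg T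
  have hc0 : ∀ f, (inner ℂ f (χ.comm 0 f)).im = 0 := fun f => by
    simp [RealCutoff.comm_apply, dil_zero]
  have l1 := (tendsto_inv_mul_of_hasDerivAt (hasDerivAt_im_inner_comm χ (hug T)) (hc0 _)).sub
    (tendsto_inv_mul_of_hasDerivAt (hasDerivAt_im_inner_comm χ (hug 0)) (hc0 _))
  have hr0 : ∀ r, χ.rate μ 0 (u r) (g r) (N r) = 0 := fun r => by
    simp [RealCutoff.rate_eq, dil_zero]
  have hrm : ∀ s, IntervalIntegrable (fun r => χ.rate μ s (u r) (g r) (N r)) volume 0 T := fun s =>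
    ((Complex.continuous_re.comp ((χ.continuous_commGrad s hu hg).inner hg)).intervalIntegrable
      _ _).add ((h.intervalIntegrable_re_inner ((χ.comm s).continuous.comp hu) 0 T).const_mul μ)
  -- Dominated convergence in time, with majorant proportional to A + B + ‖N r‖.
  have l2 : Tendsto (fun s => ∫ r in (0 : ℝ)..T, s⁻¹ * χ.rate μ s (u r) (g r) (N r)) (𝓝[≠] 0)
      (𝓝 (∫ r in (0 : ℝ)..T, 2 * χ.virial a μ (u r) (g r) (N r))) := by
    refine intervalIntegral.tendsto_integral_filter_of_dominated_convergence
      (fun r => K * (A + B) * (A + B + ‖N r‖)) (Eventually.of_forall fun s => ?_) ?_ ?_ ?_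
    · exact (intervalIntegrable_iff.1 ((hrm s).const_mul s⁻¹)).aestronglyMeasurable
    · have : ∀ᶠ s in 𝓝[≠] (0 : ℝ), |s| ≤ 1 := by
        have h1 : ∀ᶠ s in 𝓝 (0 : ℝ), |s| < 1 :=
          (continuous_abs.tendsto' (0 : ℝ) 0 abs_zero).eventually_lt_const one_pos
        exact nhdsWithin_le_nhds (h1.mono fun s hs => hs.le)
      filter_upwards [this, self_mem_nhdsWithin] with s hs hs0
      refine Eventually.of_forall fun r hr => ?_
      rw [Set.uIoc_of_le hT] at hr
      have hrI : r ∈ Set.Icc 0 T := ⟨hr.1.le, hr.2⟩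
      have h1 := hK (u r) (g r) (N r) s (hug r) hs
      rw [norm_mul, norm_inv, Real.norm_eq_abs, Real.norm_eq_abs,
        inv_mul_le_iff₀ (abs_pos.2 hs0), mul_comm |s|]
      refine h1.trans (mul_le_mul_of_nonneg_right ?_ (abs_nonneg s))
      have h2 := hA r hrI
      have h3 := hB r hrI
      gcongr
    · exact (intervalIntegrable_const.add (h.intervalIntegrable 0 T).norm).const_mul _
    · exact Eventually.of_forall fun r _ =>
        tendsto_inv_mul_of_hasDerivAt (χ.hasDerivAt_rate a μ (hug r) (N r)) (hr0 r)
  have l3 := l2.const_mul 2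
  have e : ∀ s, s⁻¹ * (inner ℂ (u T) (χ.comm s (u T))).im - s⁻¹ * (inner ℂ (u 0) (χ.comm s (u 0))).im =
      2 * ∫ r in (0 : ℝ)..T, s⁻¹ * χ.rate μ s (u r) (g r) (N r) := by
    intro s
    rw [← mul_sub, h.quadratic hd ha hU hg hug (χ.comm s) (χ.inner_comm_left s)
      (χ.continuous_commGrad s hu hg) (fun t => χ.comm_mem a s (hug t)) hT,
      intervalIntegral.integral_const_mul]
    simp only [RealCutoff.rate]
    ring
  have l4 := tendsto_nhds_unique (l1.congr e) l3
  rw [intervalIntegral.integral_const_mul] at l4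
  linarith

end flow

/-! ### Error terms of the localized virial identity -/

section tails

variable {d : ℕ}

theorem norm_toLp_norm {X E : Type*} [MeasurableSpace X] {ν : Measure X} [NormedAddCommGroup E]
    (f : Lp E 2 ν) : ‖(Lp.memLp f).norm.toLp _‖ = ‖f‖ := by
  rw [Lp.norm_toLp, eLpNorm_norm, Lp.norm_def]

theorem norm_le_of_ae_le {X E F G : Type*} [MeasurableSpace X] {ν : Measure X}
    [NormedAddCommGroup E] [NormedAddCommGroup F] [NormedAddCommGroup G] {e : Lp E 2 ν}
    {f : Lp F 2 ν} {g : Lp G 2 ν} {A B : ℝ} (hA : 0 ≤ A) (hB : 0 ≤ B)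
    (h : ∀ᵐ x ∂ν, ‖e x‖ ≤ A * ‖f x‖ + B * ‖g x‖) : ‖e‖ ≤ A * ‖f‖ + B * ‖g‖ := by
  have hf := (Lp.memLp f).norm
  have hg := (Lp.memLp g).norm
  have h1 : ‖e‖ ≤ ‖A • hf.toLp _ + B • hg.toLp _‖ := by
    refine Lp.norm_le_norm_of_ae_le ?_
    filter_upwards [h, Lp.coeFn_add (A • hf.toLp _) (B • hg.toLp _), Lp.coeFn_smul A (hf.toLp _),
      Lp.coeFn_smul B (hg.toLp _), hf.coeFn_toLp, hg.coeFn_toLp] with x h1 h2 h3 h4 h5 h6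
    rw [h2, Pi.add_apply, h3, h4, Pi.smul_apply, Pi.smul_apply, h5, h6, smul_eq_mul, smul_eq_mul]
    exact h1.trans (le_abs_self _)
  refine h1.trans ((norm_add_le _ _).trans (le_of_eq ?_))
  rw [norm_smul, norm_smul, Real.norm_of_nonneg hA, Real.norm_of_nonneg hB,
    norm_toLp_norm, norm_toLp_norm]

theorem norm_indicator_one_le (R : ℝ) (x : Space d) :
    ‖{x : Space d | R ≤ ‖x‖}.indicator (fun _ => (1 : ℂ)) x‖ ≤ 1 :=
  (norm_indicator_le_norm_self _ _).trans (by simp)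

theorem aestronglyMeasurable_indicator_one (R : ℝ) :
    AEStronglyMeasurable ({x : Space d | R ≤ ‖x‖}.indicator fun _ => (1 : ℂ)) volume :=
  aestronglyMeasurable_const.indicator (measurableSet_le measurable_const measurable_norm)

/-- Restriction to the exterior of a ball. -/
def tailOp (E : Type*) [NormedAddCommGroup E] [NormedSpace ℂ E] (R : ℝ) :
    Lp E 2 (volume : Measure (Space d)) →L[ℂ] Lp E 2 (volume : Measure (Space d)) :=
  mulOp _ (aestronglyMeasurable_indicator_one R) 1 (norm_indicator_one_le R)

theorem tailOp_coeFn {E : Type*} [NormedAddCommGroup E] [NormedSpace ℂ E] (R : ℝ)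
    (f : Lp E 2 (volume : Measure (Space d))) :
    tailOp E R f =ᵐ[volume] {x : Space d | R ≤ ‖x‖}.indicator f := by
  filter_upwards [mulOp_coeFn (aestronglyMeasurable_indicator_one R) (norm_indicator_one_le R) f]
    with x hx
  rw [tailOp, hx]
  by_cases hx : x ∈ {x : Space d | R ≤ ‖x‖}
  · rw [Set.indicator_of_mem hx, Set.indicator_of_mem hx, one_smul]
  · rw [Set.indicator_of_notMem hx, Set.indicator_of_notMem hx, zero_smul]

theorem norm_tailOp_le {E : Type*} [NormedAddCommGroup E] [NormedSpace ℂ E] (R : ℝ)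
    (f : Lp E 2 (volume : Measure (Space d))) : ‖tailOp E R f‖ ≤ ‖f‖ := by
  refine Lp.norm_le_norm_of_ae_le ?_
  filter_upwards [tailOp_coeFn R f] with x hx
  rw [hx]
  exact norm_indicator_le_norm_self _ _

theorem grad_const_mul (c : ℂ) {φ : Space d → ℂ} {x : Space d} (h : DifferentiableAt ℝ φ x) :
    grad (fun x => c * φ x) x = c • grad φ x := by
  ext i
  simp [grad, pd, fderiv_const_mul h]

theorem norm_pd_le_grad (i : Fin d) (φ : Space d → ℂ) (x : Space d) : ‖pd i φ x‖ ≤ ‖grad φ x‖ :=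
  PiLp.norm_apply_le (grad φ x) i

theorem grad_cut_eq_zero {R : ℝ} (hR : 0 < R) {x : Space d} (hx : ‖x‖ < R) :
    grad (cut R⁻¹) x = 0 := by
  have h : cut R⁻¹ =ᶠ[𝓝 x] fun _ => (1 : ℂ) := by
    filter_upwards [(isOpen_lt continuous_norm continuous_const).mem_nhds hx] with y hy
    refine cut_eq_one ?_
    rw [norm_smul, norm_inv, Real.norm_of_nonneg hR.le, inv_mul_le_iff₀ hR, mul_one]
    exact le_of_lt hy
  ext i
  simp [grad, pd, h.fderiv_eq]

/-- By the chain rule ∇(φ(c·)) = c (∇φ)(c·); the second bound is the scale-invariant quantity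
|y||∇φ(y)| at y = cx. -/
theorem exists_bound_scaled {φ : Space d → ℂ} (hφ : ContDiff ℝ 1 φ) (hc : HasCompactSupport φ) :
    ∃ B, 0 ≤ B ∧ ∀ (c : ℝ) (x : Space d), 0 < c →
      ‖grad (fun x => φ (c • x)) x‖ ≤ B * c ∧ ‖x‖ * ‖grad (fun x => φ (c • x)) x‖ ≤ B := by
  obtain ⟨B₁, h1⟩ := (hasCompactSupport_grad hc).exists_bound_of_continuous (continuous_grad hφ)
  have hs : HasCompactSupport fun x : Space d => ‖x‖ * ‖grad φ x‖ :=
    (hasCompactSupport_grad hc).norm.mul_left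
  obtain ⟨B₂, h2⟩ := hs.exists_bound_of_continuous
    (continuous_norm.mul (continuous_grad hφ).norm)
  refine ⟨max B₁ B₂, (norm_nonneg _).trans ((h1 0).trans (le_max_left _ _)), fun c x hc0 => ?_⟩
  rw [grad_comp_smul, norm_smul, Complex.norm_real, Real.norm_of_nonneg hc0.le]
  constructor
  · rw [mul_comm]
    exact mul_le_mul_of_nonneg_right ((h1 _).trans (le_max_left _ _)) hc0.le
  · have h3 := h2 (c • x)
    rw [norm_mul, norm_norm, norm_norm, norm_smul, Real.norm_of_nonneg hc0.le] at h3
    rw [← mul_assoc, mul_comm ‖x‖]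
    exact h3.trans (le_max_right _ _)

theorem contDiff_pd_cut (i : Fin d) : ContDiff ℝ (⊤ : ℕ∞) (pd i (cut (d := d) 1)) :=
  ((contDiff_cut 1).fderiv_right (m := (⊤ : ℕ∞)) (by simp)).clm_apply contDiff_const

theorem pd_cut (i : Fin d) (c : ℝ) : pd i (cut (d := d) c) = fun x => (c : ℂ) * pd i (cut 1) (c • x) := by
  ext x
  have h := congrArg (fun v : CSpace d => v i) (grad_cut c x)
  simpa [grad] using h

/-- The scaling of the derivatives of the cutoff functions. -/
theorem exists_cut_bound (d : ℕ) : ∃ B, 0 ≤ B ∧ ∀ R : ℝ, 0 < R → ∀ x : Space d,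
    ‖grad (cut R⁻¹) x‖ ≤ B * R⁻¹ ∧ ‖x‖ * ‖grad (cut R⁻¹) x‖ ≤ B ∧
      ∀ i, ‖x‖ * ‖grad (pd i (cut R⁻¹)) x‖ ≤ B * R⁻¹ := by
  obtain ⟨B, hB0, hB⟩ := exists_bound_scaled (d := d) ((contDiff_cut 1).of_le (by exact_mod_cast le_top))
    (hasCompactSupport_cut one_pos)
  have hcp : ∀ i, HasCompactSupport (pd i (cut (d := d) 1)) := fun i =>
    (hasCompactSupport_cut one_pos).mono' ((subset_tsupport _).trans
      (tsupport_fderiv_apply_subset ℝ _))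
  choose C hC0 hC using fun i : Fin d => exists_bound_scaled
    ((contDiff_pd_cut i).of_le (by exact_mod_cast le_top)) (hcp i)
  have hsum : ∀ i, C i ≤ ∑ j, C j := fun i =>
    Finset.single_le_sum (fun j _ => hC0 j) (Finset.mem_univ i)
  have hS0 : 0 ≤ ∑ j, C j := Finset.sum_nonneg fun j _ => hC0 j
  refine ⟨B + ∑ j, C j, by positivity, fun R hR x => ?_⟩
  have hR' : 0 < R⁻¹ := inv_pos.2 hR
  have h1 := hB R⁻¹ x hR'
  rw [← cut_eq_cut_one] at h1
  refine ⟨h1.1.trans ?_, h1.2.trans ?_, fun i => ?_⟩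
  · gcongr
    linarith
  · linarith
  · have h2 := (hC i R⁻¹ x hR').2
    have h3 : DifferentiableAt ℝ (fun x : Space d => pd i (cut 1) (R⁻¹ • x)) x :=
      ((contDiff_pd_cut i).comp (contDiff_const_smul R⁻¹)).differentiable (by simp) x
    rw [pd_cut, grad_const_mul _ h3, norm_smul, Complex.norm_real, Real.norm_of_nonneg hR'.le,
      mul_left_comm, mul_comm]
    refine mul_le_mul_of_nonneg_right (h2.trans ?_) hR'.le
    linarith [hsum i]

/-- The bump function at scale `R`. -/
def bumpCutoff (d : ℕ) {R : ℝ} (hR : 0 < R) : RealCutoff d where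
  fn x := bumpFn d (R⁻¹ • x)
  smooth := (bumpFn d).contDiff.comp (contDiff_const_smul R⁻¹)
  compact := by
    have h := hasCompactSupport_cut (d := d) (inv_pos.2 hR)
    refine h.mono fun x hx => ?_
    simpa [cut] using hx
  nonneg x := (bumpFn d).nonneg

theorem bumpCutoff_toCutoff_fn {R : ℝ} (hR : 0 < R) :
    (bumpCutoff d hR).toCutoff.fn = cut R⁻¹ := rfl

end tails

/-! ### The localized virial identity up to small errors -/

section lower_bound

variable {d : ℕ}

theorem norm_embOp_le (i : Fin d) (f : L2 d) : ‖embOp i f‖ ≤ ‖f‖ := by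
  refine Lp.norm_le_norm_of_ae_le ?_
  filter_upwards [embOp_coeFn i f] with x hx
  rw [hx, norm_smul]
  simp

theorem Cutoff.norm_gen_apply_le (a : ℝ) (η : Cutoff d) (f : L2 d) (g : L2Vec d) :
    ∀ᵐ x, ‖η.gen a f g x‖ ≤ ‖x‖ * ‖η.fn x‖ * ‖g x‖ +
      (‖x‖ * ‖grad η.fn x‖ + ‖(d : ℂ) / 2 - rho d a‖ * ‖η.fn x‖) * ‖f x‖ := by
  filter_upwards [η.gen_coeFn a f g] with x hx
  rw [hx]
  refine (norm_add_le _ _).trans ?_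
  rw [norm_mul, norm_mul]
  have h1 : ∀ v : CSpace d, ‖inner ℂ (cvec x) v‖ ≤ ‖x‖ * ‖v‖ := fun v =>
    (norm_inner_le_norm _ _).trans (by rw [norm_cvec])
  have h2 : ‖inner ℂ (cvec x) (grad η.fn x) + ((d : ℂ) / 2 - rho d a) * η.fn x‖ ≤
      ‖x‖ * ‖grad η.fn x‖ + ‖(d : ℂ) / 2 - rho d a‖ * ‖η.fn x‖ :=
    (norm_add_le _ _).trans (add_le_add (h1 _) (norm_mul_le _ _))
  refine add_le_add ?_ (mul_le_mul_of_nonneg_right h2 (norm_nonneg _))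
  calc ‖η.fn x‖ * ‖inner ℂ (cvec x) (g x)‖ ≤ ‖η.fn x‖ * (‖x‖ * ‖g x‖) :=
        mul_le_mul_of_nonneg_left (h1 _) (norm_nonneg _)
    _ = _ := by ring

/-- The quantifiers over w and B stand inside the almost everywhere statement so that w may be a
weight depending on x. In the applications it comes from 1 - χ or a derivative of χ and vanishes for
|x| < R. -/
theorem mul_norm_le_tail {E : Type*} [NormedAddCommGroup E] [NormedSpace ℂ E] (R : ℝ)
    (g : Lp E 2 (volume : Measure (Space d))) :
    ∀ᵐ x, ∀ w B : ℝ, w ≤ B → 0 ≤ B → (‖x‖ < R → w = 0) → w * ‖g x‖ ≤ B * ‖tailOp E R g x‖ := by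
  filter_upwards [tailOp_coeFn R g] with x hx w B hw hB h0
  rw [hx]
  by_cases h : R ≤ ‖x‖
  · rw [Set.indicator_of_mem (show x ∈ {x : Space d | R ≤ ‖x‖} from h)]
    exact mul_le_mul_of_nonneg_right hw (norm_nonneg _)
  · rw [h0 (not_le.1 h), zero_mul]
    positivity

variable {R B : ℝ} (hR : 0 < R)

/-- D(χf) - Df = (χ - 1)Df + f∇χ. The first term lives outside the ball of radius R and the second
is of size 1/R. -/
theorem bumpCutoff_dmul_sub (hB0 : 0 ≤ B)
    (hB : ∀ x : Space d, ‖grad (cut R⁻¹) x‖ ≤ B * R⁻¹) (f : L2 d) (g : L2Vec d) :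
    ‖(bumpCutoff d hR).toCutoff.dmul f g - g‖ ≤ 1 * ‖tailOp _ R g‖ + B * R⁻¹ * ‖f‖ := by
  refine norm_le_of_ae_le zero_le_one (by positivity) ?_
  filter_upwards [Lp.coeFn_sub ((bumpCutoff d hR).toCutoff.dmul f g) g,
    Lp.coeFn_add ((bumpCutoff d hR).toCutoff.mul g) ((bumpCutoff d hR).toCutoff.gmul f),
    (bumpCutoff d hR).toCutoff.mul_coeFn g, (bumpCutoff d hR).toCutoff.gmul_coeFn f,
    mul_norm_le_tail R g] with x h1 h2 h3 h4 h5
  rw [h1, Pi.sub_apply, Cutoff.dmul, h2, Pi.add_apply, h3, h4, bumpCutoff_toCutoff_fn]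
  have e : cut R⁻¹ x • g x + f x • grad (cut R⁻¹) x - g x =
      (cut R⁻¹ x - 1) • g x + f x • grad (cut R⁻¹) x := by
    rw [sub_smul, one_smul]; abel
  rw [e]
  refine (norm_add_le _ _).trans (add_le_add ?_ ?_)
  · rw [norm_smul]
    refine h5 _ _ ?_ zero_le_one fun hx => ?_
    · rw [cut, ← Complex.ofReal_one, ← Complex.ofReal_sub, Complex.norm_real, Real.norm_eq_abs,
        abs_le]
      have h6 := (bumpFn d).nonneg (x := R⁻¹ • x)
      have h7 := (bumpFn d).le_one (x := R⁻¹ • x)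
      constructor <;> linarith
    · rw [cut_eq_one, sub_self, norm_zero]
      rw [norm_smul, norm_inv, Real.norm_of_nonneg hR.le, inv_mul_le_iff₀ hR, mul_one]
      exact hx.le
  · rw [norm_smul, mul_comm]
    exact mul_le_mul_of_nonneg_right (hB x) (norm_nonneg _)

theorem bumpCutoff_gmul (hB : ∀ x : Space d, ‖grad (cut R⁻¹) x‖ ≤ B * R⁻¹) (f : L2 d) :
    ‖(bumpCutoff d hR).toCutoff.gmul f‖ ≤ B * R⁻¹ * ‖f‖ := by
  refine Lp.norm_le_mul_norm_of_ae_le_mul ?_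
  filter_upwards [(bumpCutoff d hR).toCutoff.gmul_coeFn f] with x hx
  rw [hx, norm_smul, mul_comm, bumpCutoff_toCutoff_fn]
  exact mul_le_mul_of_nonneg_right (hB x) (norm_nonneg _)

/-- The coefficient of g is |x||∂ᵢχ|, which is bounded and vanishes in the ball, so only the tail of
g enters. The coefficients of f are |x||∇∂ᵢχ| and |∂ᵢχ|, both of size 1/R. -/
theorem bumpCutoff_gradGen (a : ℝ) (hB0 : 0 ≤ B)
    (hB : ∀ x : Space d, ‖grad (cut R⁻¹) x‖ ≤ B * R⁻¹ ∧ ‖x‖ * ‖grad (cut R⁻¹) x‖ ≤ B ∧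
      ∀ i, ‖x‖ * ‖grad (pd i (cut R⁻¹)) x‖ ≤ B * R⁻¹) (f : L2 d) (g : L2Vec d) :
    ‖(bumpCutoff d hR).toCutoff.gradGen a f g‖ ≤ d * (B * ‖tailOp _ R g‖ +
      (B * R⁻¹ + ‖(d : ℂ) / 2 - rho d a‖ * (B * R⁻¹)) * ‖f‖) := by
  refine (norm_sum_le_of_le (n := fun _ => B * ‖tailOp _ R g‖ +
    (B * R⁻¹ + ‖(d : ℂ) / 2 - rho d a‖ * (B * R⁻¹)) * ‖f‖) _ fun i _ => ?_).trans
      (by rw [Finset.sum_const, Finset.card_univ, Fintype.card_fin, nsmul_eq_mul])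
  refine (norm_embOp_le i _).trans (norm_le_of_ae_le hB0 (by positivity) ?_)
  filter_upwards [((bumpCutoff d hR).toCutoff.pderiv i).norm_gen_apply_le a f g,
    mul_norm_le_tail R g] with x h1 h2
  have e : ((bumpCutoff d hR).toCutoff.pderiv i).fn = pd i (cut R⁻¹) := rfl
  rw [e] at h1
  obtain ⟨b1, b2, b3⟩ := hB x
  have h3 := norm_pd_le_grad i (cut R⁻¹) x
  refine h1.trans (add_le_add (h2 _ _ ?_ hB0 fun hx => ?_)
    (mul_le_mul_of_nonneg_right ?_ (norm_nonneg _)))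
  · exact (mul_le_mul_of_nonneg_left h3 (norm_nonneg _)).trans b2
  · rw [grad_cut_eq_zero hR hx, norm_zero] at h3
    rw [le_antisymm h3 (norm_nonneg _), mul_zero]
  · have h4 := h3.trans b1
    have h5 := b3 i
    gcongr

/-- The additional factor ∇χ again vanishes in the ball. It compensates the growth |x|χ in front of
g and gives the factor 1/R in front of f. -/
theorem bumpCutoff_gmul_gen (a : ℝ) (hB0 : 0 ≤ B)
    (hB : ∀ x : Space d, ‖grad (cut R⁻¹) x‖ ≤ B * R⁻¹ ∧ ‖x‖ * ‖grad (cut R⁻¹) x‖ ≤ B)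
    (f : L2 d) (g : L2Vec d) :
    ‖(bumpCutoff d hR).toCutoff.gmul ((bumpCutoff d hR).toCutoff.gen a f g)‖ ≤
      B * ‖tailOp _ R g‖ + (B * R⁻¹) * (B + ‖(d : ℂ) / 2 - rho d a‖) * ‖f‖ := by
  refine norm_le_of_ae_le hB0 (by positivity) ?_
  filter_upwards [(bumpCutoff d hR).toCutoff.norm_gen_apply_le a f g, mul_norm_le_tail R g,
    (bumpCutoff d hR).toCutoff.gmul_coeFn ((bumpCutoff d hR).toCutoff.gen a f g)] with x h1 h2 h3
  rw [bumpCutoff_toCutoff_fn] at h1 h3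
  obtain ⟨b1, b2⟩ := hB x
  have hc := norm_cut_le R⁻¹ x
  rw [h3, norm_smul, mul_comm]
  refine (mul_le_mul_of_nonneg_left h1 (norm_nonneg _)).trans ?_
  rw [mul_add, ← mul_assoc, ← mul_assoc ‖grad (cut R⁻¹) x‖ _ ‖f x‖]
  refine add_le_add (h2 _ _ ?_ hB0 fun hx => ?_) (mul_le_mul_of_nonneg_right ?_ (norm_nonneg _))
  · calc ‖grad (cut R⁻¹) x‖ * (‖x‖ * ‖cut R⁻¹ x‖) = ‖x‖ * ‖grad (cut R⁻¹) x‖ * ‖cut R⁻¹ x‖ := by ring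
      _ ≤ B * 1 := mul_le_mul b2 hc (norm_nonneg _) hB0
      _ = B := mul_one B
  · rw [grad_cut_eq_zero hR hx, norm_zero, zero_mul]
  · have h4 : ‖(d : ℂ) / 2 - rho d a‖ * ‖cut R⁻¹ x‖ ≤ ‖(d : ℂ) / 2 - rho d a‖ :=
      mul_le_of_le_one_right (norm_nonneg _) hc
    gcongr

theorem fderiv_eq_of_bump {R : ℝ} (hR : 0 < R) {x : Space d} (hx : ‖x‖ < R) :
    (bumpCutoff d hR).fn x = 1 ∧ (bumpCutoff d hR).radial x = 0 := by
  have h1 : ∀ y : Space d, ‖y‖ < R → (bumpCutoff d hR).fn y = 1 := fun y hy => by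
    refine (bumpFn d).one_of_mem_closedBall ?_
    rw [mem_closedBall_zero_iff, norm_smul, norm_inv, Real.norm_of_nonneg hR.le,
      inv_mul_le_iff₀ hR]
    simpa [bumpFn] using hy.le
  refine ⟨h1 x hx, ?_⟩
  have h : (bumpCutoff d hR).fn =ᶠ[𝓝 x] fun _ => (1 : ℝ) := by
    filter_upwards [(isOpen_lt continuous_norm continuous_const).mem_nhds hx] with y hy
    exact h1 y hy
  simp [RealCutoff.radial, h.fderiv_eq]

theorem abs_radial_bump_le {R : ℝ} (hR : 0 < R) (x : Space d) :
    |(bumpCutoff d hR).radial x| ≤ ‖x‖ * ‖grad (cut R⁻¹) x‖ := by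
  have h1 : fderiv ℝ (cut R⁻¹) x x = ((bumpCutoff d hR).radial x : ℂ) := by
    have h2 := ((bumpCutoff d hR).smooth.differentiable (by simp) x).hasFDerivAt
    have h3 : HasFDerivAt (cut R⁻¹) (Complex.ofRealCLM ∘L fderiv ℝ (bumpCutoff d hR).fn x) x :=
      Complex.ofRealCLM.hasFDerivAt.comp x h2
    rw [h3.fderiv]
    rfl
  rw [← Real.norm_eq_abs, ← Complex.norm_real, ← h1, mul_comm]
  exact ((fderiv ℝ (cut R⁻¹) x).le_opNorm x).trans
    (mul_le_mul_of_nonneg_right (norm_fderiv_le_grad _ _) (norm_nonneg _))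

/-- By `RealCutoff.re_inner_gen` the pairing has density ((dα/2)χ² + αχ x·∇χ)|f|^{α+2}/(α + 2). This
is the full density where χ = 1, so the error is carried by the exterior of the ball. -/
theorem bumpCutoff_potential {a α : ℝ} (hα : 0 < α)
    (hB : ∀ x : Space d, ‖x‖ * ‖grad (cut R⁻¹) x‖ ≤ B) {f N : L2 d} {g : L2Vec d}
    (h : (WithLp.toLp 2 (f, g) : WithLp 2 (L2 d × L2Vec d)) ∈ graphCl (jMap d) (dMap d a))
    (hf : Integrable fun x => ‖f x‖ ^ (α + 2))
    (hN : N =ᵐ[volume] fun x => ((‖f x‖ ^ α : ℝ) : ℂ) * f x) :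
    |(inner ℂ ((bumpCutoff d hR).toCutoff.mul ((bumpCutoff d hR).toCutoff.gen a f g)) N).re -
      d * α / (2 * (α + 2)) * ∫ x, ‖f x‖ ^ (α + 2)| ≤
      (d * α / 2 + α * B) * ∫ x in {x : Space d | R ≤ ‖x‖}, ‖f x‖ ^ (α + 2) := by
  set χ := bumpCutoff d hR with hχ
  have h1 := χ.re_inner_gen hα h hf hN
  have e1 : (inner ℂ (χ.toCutoff.mul (χ.toCutoff.gen a f g)) N).re =
      (inner ℂ (χ.toCutoff.mul N) (χ.toCutoff.gen a f g)).re := by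
    rw [χ.inner_mul_left, ← inner_conj_symm, Complex.conj_re]
  have hm : MeasurableSet {x : Space d | R ≤ ‖x‖} := measurableSet_le measurable_const measurable_norm
  have hw : Continuous fun x => d * α / 2 * χ.fn x ^ 2 + α * (χ.fn x * χ.radial x) :=
    (continuous_const.mul (χ.smooth.continuous.pow 2)).add
      (continuous_const.mul (χ.smooth.continuous.mul χ.continuous_radial))
  have hp : 0 < α + 2 := by linarith
  obtain ⟨C, hC⟩ := HasCompactSupport.exists_bound_of_continuous (HasCompactSupport.intro χ.compact
      fun x hx => by simp [image_eq_zero_of_notMem_tsupport hx]) hw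
  have hi : Integrable fun x => (d * α / 2 * χ.fn x ^ 2 + α * (χ.fn x * χ.radial x)) *
      ‖f x‖ ^ (α + 2) := hf.bdd_mul hw.aestronglyMeasurable (Eventually.of_forall hC)
  have e2 : (inner ℂ (χ.toCutoff.mul N) (χ.toCutoff.gen a f g)).re -
      d * α / (2 * (α + 2)) * ∫ x, ‖f x‖ ^ (α + 2) =
      (α + 2)⁻¹ * ∫ x, ((d * α / 2 * χ.fn x ^ 2 + α * (χ.fn x * χ.radial x)) * ‖f x‖ ^ (α + 2) -
        d * α / 2 * ‖f x‖ ^ (α + 2)) := by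
    rw [integral_sub hi (hf.const_mul _), ← h1, integral_const_mul]
    field_simp
  rw [e1, e2, ← integral_indicator hm, ← integral_const_mul, ← integral_const_mul,
    ← Real.norm_eq_abs]
  refine norm_integral_le_of_norm_le ((hf.indicator hm).const_mul _) (Eventually.of_forall fun x => ?_)
  have hfx : 0 ≤ ‖f x‖ ^ (α + 2) := by positivity
  by_cases hx : R ≤ ‖x‖
  · rw [Set.indicator_of_mem (show x ∈ {x : Space d | R ≤ ‖x‖} from hx), ← sub_mul, norm_mul,
      norm_mul, norm_inv, Real.norm_of_nonneg hp.le, Real.norm_of_nonneg hfx, ← mul_assoc]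
    refine mul_le_mul_of_nonneg_right ?_ hfx
    have hr := (abs_radial_bump_le hR x).trans (hB x)
    rw [← hχ] at hr
    have q0 := χ.nonneg x
    have q1 : χ.fn x ≤ 1 := (bumpFn d).le_one
    have hq : |χ.fn x * χ.radial x| ≤ B := by
      rw [abs_mul, abs_of_nonneg q0]
      exact (mul_le_mul q1 hr (abs_nonneg _) zero_le_one).trans (one_mul B).le
    have hq2 : |χ.fn x ^ 2 - 1| ≤ 1 := by
      rw [abs_le]
      constructor <;> nlinarith
    have hd0 : 0 ≤ d * α / 2 := by positivity
    have h3 : ‖d * α / 2 * χ.fn x ^ 2 + α * (χ.fn x * χ.radial x) - d * α / 2‖ ≤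
        d * α / 2 + α * B := by
      have e3 : d * α / 2 * χ.fn x ^ 2 + α * (χ.fn x * χ.radial x) - d * α / 2 =
        d * α / 2 * (χ.fn x ^ 2 - 1) + α * (χ.fn x * χ.radial x) := by ring
      rw [e3, Real.norm_eq_abs]
      refine (abs_add_le _ _).trans (add_le_add ?_ ?_)
      · rw [abs_mul, abs_of_nonneg hd0]
        exact mul_le_of_le_one_right hd0 hq2
      · rw [abs_mul, abs_of_pos hα]
        exact mul_le_mul_of_nonneg_left hq hα.le
    refine (mul_le_of_le_one_left (norm_nonneg _) ?_).trans h3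
    exact inv_le_one_of_one_le₀ (by linarith)
  · obtain ⟨k1, k2⟩ := fderiv_eq_of_bump hR (not_le.1 hx)
    rw [Set.indicator_of_notMem (show x ∉ {x : Space d | R ≤ ‖x‖} from hx), hχ, k1, k2]
    simp

/-- The localized virial is bounded from below by the full one, up to small errors. -/
theorem exists_virial_lower_bound (d : ℕ) (a μ : ℝ) {α : ℝ} (hα : 0 < α) : ∃ C, 0 ≤ C ∧
    ∀ (R : ℝ) (hR : 0 < R), 1 ≤ R → ∀ (f N : L2 d) (g : L2Vec d),
    (WithLp.toLp 2 (f, g) : WithLp 2 (L2 d × L2Vec d)) ∈ graphCl (jMap d) (dMap d a) →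
    (Integrable fun x => ‖f x‖ ^ (α + 2)) →
    (N =ᵐ[volume] fun x => ((‖f x‖ ^ α : ℝ) : ℂ) * f x) →
    ‖g‖ ^ 2 + μ * (d * α / (2 * (α + 2)) * ∫ x, ‖f x‖ ^ (α + 2)) -
      C * ((‖f‖ + ‖g‖) * (‖tailOp _ R g‖ + R⁻¹ * ‖f‖) +
        ∫ x in {x : Space d | R ≤ ‖x‖}, ‖f x‖ ^ (α + 2)) ≤
      (bumpCutoff d hR).virial a μ f g N := by
  obtain ⟨B, hB0, hB⟩ := exists_cut_bound d
  set κ := ‖(d : ℂ) / 2 - rho d a‖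
  have hκ : 0 ≤ κ := norm_nonneg _
  -- The three summands bound the errors of ‖D(χf)‖², of the pairing of D(χf) with f∇χ and its
  -- dilation derivative, and of the term with ∇χ times the generator. The part with |μ| added below
  -- accounts for the potential energy.
  set C₁ := 2 * (1 + B) + (2 + B) * (B + d * (B * (1 + κ))) + B * (1 + B + κ) with hC₁
  refine ⟨C₁ + |μ| * (d * α / 2 + α * B), by positivity, fun R hR hR1 f N g h hf hN => ?_⟩
  have hRi : R⁻¹ ≤ 1 := inv_le_one_of_one_le₀ hR1
  have hRi0 : 0 ≤ R⁻¹ := by positivity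
  have hBx := hB R hR
  obtain ⟨S, hS⟩ : ∃ S, S = ‖f‖ + ‖g‖ := ⟨_, rfl⟩
  obtain ⟨e, he⟩ : ∃ e, e = ‖tailOp _ R g‖ + R⁻¹ * ‖f‖ := ⟨_, rfl⟩
  have ht0 : 0 ≤ ‖tailOp (CSpace d) R g‖ := norm_nonneg _
  have hf0 : 0 ≤ R⁻¹ * ‖f‖ := by positivity
  have he0 : 0 ≤ e := by rw [he]; positivity
  have heS : e ≤ S := by
    rw [he, hS, add_comm]
    exact add_le_add (mul_le_of_le_one_left (norm_nonneg _) hRi) (norm_tailOp_le R g)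
  have hgS : ‖g‖ ≤ S := by rw [hS]; linarith [norm_nonneg f]
  have hS0 : 0 ≤ S := (norm_nonneg g).trans hgS
  have b1 : ‖(bumpCutoff d hR).toCutoff.dmul f g - g‖ ≤ (1 + B) * e := by
    refine (bumpCutoff_dmul_sub hR hB0 (fun x => (hBx x).1) f g).trans ?_
    rw [he]
    nlinarith [mul_nonneg hB0 ht0]
  have b2 : ‖(bumpCutoff d hR).toCutoff.gmul f‖ ≤ B * e := by
    refine (bumpCutoff_gmul hR (fun x => (hBx x).1) f).trans ?_
    rw [he]
    nlinarith [mul_nonneg hB0 ht0]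
  have b3 : ‖(bumpCutoff d hR).toCutoff.gradGen a f g‖ ≤ d * (B * (1 + κ)) * e := by
    refine (bumpCutoff_gradGen hR a hB0 hBx f g).trans ?_
    rw [he, mul_assoc]
    refine mul_le_mul_of_nonneg_left ?_ (Nat.cast_nonneg d)
    nlinarith [mul_nonneg hB0 ht0, mul_nonneg (mul_nonneg hB0 hκ) ht0]
  have b4 : ‖(bumpCutoff d hR).toCutoff.gmul ((bumpCutoff d hR).toCutoff.gen a f g)‖ ≤
      B * (1 + B + κ) * e := by
    refine (bumpCutoff_gmul_gen hR a hB0 (fun x => ⟨(hBx x).1, (hBx x).2.1⟩) f g).trans ?_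
    rw [he]
    nlinarith [mul_nonneg hB0 ht0, mul_nonneg (mul_nonneg hB0 hκ) ht0,
      mul_nonneg (mul_nonneg hB0 hB0) ht0, mul_nonneg hB0 hf0]
  have b5 := bumpCutoff_potential hR hα (fun x => (hBx x).2.1) h hf hN
  rw [RealCutoff.virial, ← hS, ← he]
  generalize (bumpCutoff d hR).toCutoff.dmul f g = G at *
  generalize (bumpCutoff d hR).toCutoff.gmul f = Y at *
  generalize (bumpCutoff d hR).toCutoff.gradGen a f g = Z at *
  generalize (bumpCutoff d hR).toCutoff.gmul ((bumpCutoff d hR).toCutoff.gen a f g) = W at *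
  generalize (inner ℂ ((bumpCutoff d hR).toCutoff.mul ((bumpCutoff d hR).toCutoff.gen a f g)) N).re
    = n at *
  set I := ∫ x in {x : Space d | R ≤ ‖x‖}, ‖f x‖ ^ (α + 2)
  have hI0 : 0 ≤ I := integral_nonneg fun x => by positivity
  set J := ∫ x, ‖f x‖ ^ (α + 2)
  have hG : ‖G‖ ≤ (2 + B) * S := by
    have := norm_add_le (G - g) g
    rw [sub_add_cancel] at this
    nlinarith
  have c1 : ‖g‖ ^ 2 - 2 * (1 + B) * (S * e) ≤ ‖G‖ ^ 2 := by
    have h2 : ‖g‖ - (1 + B) * e ≤ ‖G‖ := by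
      have := norm_sub_norm_le g G
      rw [norm_sub_rev] at this
      linarith
    have h3 : 0 ≤ (1 + B) * e := by positivity
    have h4 : ‖g‖ * ((1 + B) * e) ≤ S * ((1 + B) * e) := mul_le_mul_of_nonneg_right hgS h3
    nlinarith [norm_nonneg G, norm_nonneg g, sq_nonneg (‖G‖ - ‖g‖)]
  have c2 : |(inner ℂ G (Y - Z)).re| ≤ (2 + B) * (B + d * (B * (1 + κ))) * (S * e) := by
    refine (Complex.abs_re_le_norm _).trans ((norm_inner_le_norm _ _).trans ?_)
    calc ‖G‖ * ‖Y - Z‖ ≤ ((2 + B) * S) * (B * e + d * (B * (1 + κ)) * e) :=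
          mul_le_mul hG ((norm_sub_le _ _).trans (add_le_add b2 b3)) (norm_nonneg _) (by positivity)
      _ = _ := by ring
  have c3 : |(inner ℂ W g).re| ≤ B * (1 + B + κ) * (S * e) := by
    refine (Complex.abs_re_le_norm _).trans ((norm_inner_le_norm _ _).trans ?_)
    calc ‖W‖ * ‖g‖ ≤ (B * (1 + B + κ) * e) * S := mul_le_mul b4 hgS (norm_nonneg _) (by positivity)
      _ = _ := by ring
  have c4 : |μ * n - μ * (d * α / (2 * (α + 2)) * J)| ≤ |μ| * ((d * α / 2 + α * B) * I) := by
    rw [← mul_sub, abs_mul]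
    exact mul_le_mul_of_nonneg_left b5 (abs_nonneg μ)
  have c5 : 0 ≤ |μ| * (d * α / 2 + α * B) * (S * e) := by positivity
  have c6 : 0 ≤ C₁ * I := by positivity
  have e5 : (C₁ + |μ| * (d * α / 2 + α * B)) * (S * e + I) = C₁ * (S * e) + C₁ * I +
      |μ| * (d * α / 2 + α * B) * (S * e) + |μ| * ((d * α / 2 + α * B) * I) := by ring
  have e6 : C₁ * (S * e) = 2 * (1 + B) * (S * e) + (2 + B) * (B + d * (B * (1 + κ))) * (S * e) +
      B * (1 + B + κ) * (S * e) := by rw [hC₁]; ring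
  rw [e5, e6]
  linarith [(abs_le.1 c2).2, (abs_le.1 c3).1, (abs_le.1 c4).1]

end lower_bound

/-! ### The form domain and `H¹` -/

section formGrad

variable {d : ℕ}

theorem MemH1.isWeakGrad {f : L2 d} (h : MemH1 f) : IsWeakGrad f (weakGrad f) := by
  rw [weakGrad, dif_pos h]
  exact h.choose_spec

theorem MemH1.mem_graphCl (hd : 3 ≤ d) {f : L2 d} (h : MemH1 f) :
    (WithLp.toLp 2 (f, weakGrad f) : WithLp 2 (L2 d × L2Vec d)) ∈ graphCl (jMap d) (dMap d 0) :=
  h.isWeakGrad.mem_closure hd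

open scoped Classical in
/-- The function `f/|x|`, if it is square integrable (and `0` otherwise). -/
def hardyFn (f : L2 d) : L2 d :=
  if h : ∃ η : L2 d, η =ᵐ[volume] fun x => ((‖x‖⁻¹ : ℝ) : ℂ) * f x then h.choose else 0

/-- The vector field `D f = ∇f + ρ x/|x|² f`. -/
def formGrad (a : ℝ) (f : L2 d) : L2Vec d := weakGrad f + (rho d a : ℂ) • radOp d (hardyFn f)

theorem hardyFn_eq {f η : L2 d} (h : η =ᵐ[volume] fun x => ((‖x‖⁻¹ : ℝ) : ℂ) * f x) :
    hardyFn f = η := by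
  have h1 : ∃ η : L2 d, η =ᵐ[volume] fun x => ((‖x‖⁻¹ : ℝ) : ℂ) * f x := ⟨η, h⟩
  rw [hardyFn, dif_pos h1]
  exact Lp.ext (h1.choose_spec.trans h.symm)

theorem MemH1.hardy (hd : 3 ≤ d) {a : ℝ} (ha : -(((d : ℝ) - 2) / 2) ^ 2 < a) {f : L2 d}
    (h : MemH1 f) : (hardyFn f =ᵐ[volume] fun x => ((‖x‖⁻¹ : ℝ) : ℂ) * f x) ∧
      (WithLp.toLp 2 (f, formGrad a f) : WithLp 2 (L2 d × L2Vec d)) ∈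
        graphCl (jMap d) (dMap d a) ∧
      ‖formGrad a f‖ ^ 2 = ‖weakGrad f‖ ^ 2 + a * ‖hardyFn f‖ ^ 2 ∧
      (((d : ℝ) - 2) / 2) ^ 2 * ‖hardyFn f‖ ^ 2 ≤ ‖weakGrad f‖ ^ 2 := by
  obtain ⟨η, h1, h2⟩ := exists_hardy hd ha (h.mem_graphCl hd)
  rw [formGrad, hardyFn_eq h1]
  exact ⟨h1, h2⟩

theorem MemH1.coercive (hd : 3 ≤ d) {a : ℝ} (ha : -(((d : ℝ) - 2) / 2) ^ 2 < a) {f : L2 d}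
    (h : MemH1 f) : coerConst d a * ‖weakGrad f‖ ^ 2 ≤ ‖formGrad a f‖ ^ 2 := by
  obtain ⟨_, _, h3, h4⟩ := h.hardy hd ha
  rw [h3]
  exact coercive_aux hd (sq_nonneg _) h4

theorem integral_hardy {f η : L2 d} (h : η =ᵐ[volume] fun x => ((‖x‖⁻¹ : ℝ) : ℂ) * f x) :
    (fun x => 1 / ‖x‖ ^ 2 * ‖f x‖ ^ 2) =ᵐ[volume] fun x => ‖η x‖ ^ 2 := by
  filter_upwards [h] with x hx
  rw [hx, norm_mul, Complex.norm_real, norm_inv, norm_norm, mul_pow, inv_pow, one_div]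

theorem MemH1.homNorm_eq (hd : 3 ≤ d) {a : ℝ} (ha : -(((d : ℝ) - 2) / 2) ^ 2 < a) {f : L2 d}
    (h : MemH1 f) : homNorm a f = ‖formGrad a f‖ := by
  obtain ⟨h1, _, h3, _⟩ := h.hardy hd ha
  have e : ∫ x, (‖weakGrad f x‖ ^ 2 + a / ‖x‖ ^ 2 * ‖f x‖ ^ 2) = ‖formGrad a f‖ ^ 2 := by
    rw [h3, norm_sq_eq_integral, norm_sq_eq_integral, ← integral_const_mul,
      ← integral_add (integrable_norm_sq _) ((integrable_norm_sq _).const_mul a)]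
    refine integral_congr_ae ?_
    filter_upwards [integral_hardy h1] with x hx
    rw [← hx]
    ring
  rw [homNorm, e, Real.sqrt_sq (norm_nonneg _)]

theorem MemH1.energy_eq (hd : 3 ≤ d) {a : ℝ} (ha : -(((d : ℝ) - 2) / 2) ^ 2 < a) {α μ : ℝ}
    {f : L2 d} (h : MemH1 f) (hf : Integrable fun x => ‖f x‖ ^ (α + 2)) :
    energy a α μ f = 1 / 2 * ‖formGrad a f‖ ^ 2 + μ / (α + 2) * ∫ x, ‖f x‖ ^ (α + 2) := by
  obtain ⟨h1, _, h3, _⟩ := h.hardy hd ha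
  have hi : Integrable fun x => 1 / 2 * (‖weakGrad f x‖ ^ 2 + a * ‖hardyFn f x‖ ^ 2) :=
    ((integrable_norm_sq _).add ((integrable_norm_sq _).const_mul a)).const_mul (1 / 2)
  rw [h3, norm_sq_eq_integral, norm_sq_eq_integral, ← integral_const_mul,
    ← integral_add (integrable_norm_sq _) ((integrable_norm_sq _).const_mul a),
    ← integral_const_mul, ← integral_const_mul, ← integral_add hi (hf.const_mul _), energy]
  refine integral_congr_ae ?_
  filter_upwards [integral_hardy h1] with x hx
  rw [← hx]
  ring

/-- The operator `D` is bounded by the gradient, also on differences of `H¹` functions. -/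
theorem exists_formGrad_sub_bound (hd : 3 ≤ d) (a : ℝ) : ∃ C, 0 ≤ C ∧ ∀ f f' : L2 d, MemH1 f → MemH1 f' →
    ‖formGrad a f - formGrad a f'‖ ≤ C * ‖weakGrad f - weakGrad f'‖ := by
  have hl := half_dim_pos hd
  have h0 : -(((d : ℝ) - 2) / 2) ^ 2 < 0 := by nlinarith
  refine ⟨1 + ‖(rho d a : ℂ)‖ * (‖radOp d‖ * (((d : ℝ) - 2) / 2)⁻¹), by positivity,
    fun f f' h h' => ?_⟩
  obtain ⟨h1, -⟩ := h.hardy hd h0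
  obtain ⟨h1', -⟩ := h'.hardy hd h0
  -- `weakGrad` is defined by choice, so its differences are handled in the closed graph, which is a
  -- subspace, and Hardy's inequality is applied to the difference there.
  have hm := Submodule.sub_mem _ (h.mem_graphCl hd) (h'.mem_graphCl hd)
  obtain ⟨η, h2, -, -, h3⟩ := exists_hardy hd h0
    (show (WithLp.toLp 2 (f - f', weakGrad f - weakGrad f') : WithLp 2 (L2 d × L2Vec d)) ∈ _ from hm)
  have h4 : hardyFn f - hardyFn f' = η := by
    refine Lp.ext ?_
    filter_upwards [h1, h1', h2, Lp.coeFn_sub (hardyFn f) (hardyFn f'), Lp.coeFn_sub f f']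
      with x k1 k2 k3 k4 k5
    rw [k4, Pi.sub_apply, k1, k2, k3, k5, Pi.sub_apply, mul_sub]
  have h5 : ‖η‖ ≤ (((d : ℝ) - 2) / 2)⁻¹ * ‖weakGrad f - weakGrad f'‖ := by
    rw [le_inv_mul_iff₀ hl]
    refine le_of_sq_le_sq ?_ (norm_nonneg _)
    rw [mul_pow]
    exact h3
  have e : formGrad a f - formGrad a f' =
      (weakGrad f - weakGrad f') + (rho d a : ℂ) • radOp d η := by
    rw [formGrad, formGrad, ← h4, map_sub, smul_sub]
    abel
  rw [e, add_mul, one_mul]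
  refine (norm_add_le _ _).trans (add_le_add le_rfl ?_)
  rw [norm_smul, mul_assoc, mul_assoc]
  refine mul_le_mul_of_nonneg_left ?_ (norm_nonneg _)
  exact ((radOp d).le_opNorm η).trans (mul_le_mul_of_nonneg_left h5 (norm_nonneg _))

/-- Along a precompact orbit, the weak gradient is continuous in time. -/
theorem PrecompactH1.continuous_weakGrad (hd : 3 ≤ d) {v : ℝ → L2 d} (hv : Continuous v)
    (h : PrecompactH1 (Set.range v)) : Continuous fun t => weakGrad (v t) := by
  have hl := half_dim_pos hd
  have h0 : -(((d : ℝ) - 2) / 2) ^ 2 < 0 := by nlinarith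
  set K := closure ((fun f => (f, weakGrad f)) '' Set.range v) with hK
  have hc : IsClosed {p : L2 d × L2Vec d | (WithLp.toLp 2 p : WithLp 2 (L2 d × L2Vec d)) ∈
      graphCl (jMap d) (dMap d 0)} :=
    (Submodule.isClosed_topologicalClosure _).preimage (WithLp.prod_continuous_toLp 2 _ _)
  have hKs : K ⊆ {p : L2 d × L2Vec d | (WithLp.toLp 2 p : WithLp 2 (L2 d × L2Vec d)) ∈
      graphCl (jMap d) (dMap d 0)} := by
    refine closure_minimal ?_ hc
    rintro _ ⟨f, hf, rfl⟩
    exact (h.1 f hf).mem_graphCl hd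
  have : CompactSpace K := isCompact_iff_compactSpace.1 h.2
  -- On the compact closure of the graph the projection to f is continuous, and injective by
  -- closability of the gradient. It is therefore an embedding, and continuity in L² lifts to
  -- continuity of the weak gradient.
  have hinj : Function.Injective fun p : K => (p : L2 d × L2Vec d).1 := by
    rintro ⟨p, hp⟩ ⟨q, hq⟩ hpq
    have h1 := eq_zero_of_mem_graphCl hd h0 (Submodule.sub_mem _ (hKs hp) (hKs hq))
      (sub_eq_zero.2 hpq)
    exact Subtype.ext ((WithLp.toLp_injective 2) (sub_eq_zero.1 h1))
  have hcont : Continuous fun p : K => (p : L2 d × L2Vec d).1 :=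
    continuous_fst.comp continuous_subtype_val
  have hemb := hcont.isClosedEmbedding hinj
  let w : ℝ → K := fun t => ⟨(v t, weakGrad (v t)), subset_closure ⟨v t, ⟨t, rfl⟩, rfl⟩⟩
  have hw : Continuous w := hemb.isInducing.continuous_iff.2 hv
  exact continuous_snd.comp (continuous_subtype_val.comp hw)

theorem PrecompactH1.exists_bound {v : ℝ → L2 d} (h : PrecompactH1 (Set.range v)) :
    ∃ B, 0 ≤ B ∧ ∀ t, ‖weakGrad (v t)‖ ≤ B := by
  obtain ⟨B, hB⟩ := h.2.isBounded.exists_norm_le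
  refine ⟨B, (norm_nonneg _).trans (hB _ (subset_closure ⟨v 0, ⟨0, rfl⟩, rfl⟩)), fun t => ?_⟩
  exact (norm_snd_le (v t, weakGrad (v t))).trans (hB _ (subset_closure ⟨v t, ⟨t, rfl⟩, rfl⟩))

/-- A precompact orbit has finite nets. -/
theorem PrecompactH1.exists_net {v : ℝ → L2 d} (h : PrecompactH1 (Set.range v)) {δ : ℝ} (hδ : 0 < δ) :
    ∃ s : Set ℝ, s.Finite ∧ ∀ t, ∃ r ∈ s, ‖v t - v r‖ ≤ δ ∧ ‖weakGrad (v t) - weakGrad (v r)‖ ≤ δ := by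
  have h1 : TotallyBounded (Set.range fun t => (v t, weakGrad (v t))) := by
    refine h.2.totallyBounded.subset (subset_closure.trans_eq' ?_)
    rw [← Set.range_comp]
    rfl
  obtain ⟨S, hS, hf, hc⟩ := Metric.finite_approx_of_totallyBounded h1 δ hδ
  have hS' : ∀ y, y ∈ S → ∃ t, (v t, weakGrad (v t)) = y := fun y hy => hS hy
  choose! τ hτ using hS'
  refine ⟨τ '' S, hf.image τ, fun t => ?_⟩
  obtain ⟨y, hy, hty⟩ := Set.mem_iUnion₂.1 (hc ⟨t, rfl⟩)
  have h2 : ‖(v t, weakGrad (v t)) - (v (τ y), weakGrad (v (τ y)))‖ ≤ δ := by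
    rw [← dist_eq_norm]
    rw [hτ y hy]
    exact (Metric.mem_ball.1 hty).le
  exact ⟨τ y, ⟨y, hy, rfl⟩, (norm_fst_le _).trans h2, (norm_snd_le _).trans h2⟩

theorem tendsto_norm_tailOp {E : Type*} [NormedAddCommGroup E] [NormedSpace ℂ E]
    (f : Lp E 2 (volume : Measure (Space d))) :
    Tendsto (fun R => ‖tailOp E R f‖) atTop (𝓝 0) := by
  refine tendsto_zero_iff_norm_tendsto_zero.1 (tendsto_Lp_of_dominated (fun R => tailOp_coeFn R f)
    (Lp.coeFn_zero E 2 volume) (Lp.memLp f).norm (Eventually.of_forall fun R =>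
      Eventually.of_forall fun x => ?_) (Eventually.of_forall fun x => ?_))
  · rw [Pi.zero_apply, sub_zero]
    exact norm_indicator_le_norm_self _ _
  · refine tendsto_const_nhds.congr' ?_
    filter_upwards [eventually_gt_atTop ‖x‖] with R hR
    rw [Set.indicator_of_notMem (by simpa using hR), Pi.zero_apply]

theorem tendsto_integral_tail {w : Space d → ℝ} (hw : Integrable w) :
    Tendsto (fun R => ∫ x in {x : Space d | R ≤ ‖x‖}, w x) atTop (𝓝 0) := by
  have hm : ∀ R, MeasurableSet {x : Space d | R ≤ ‖x‖} := fun R =>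
    measurableSet_le measurable_const measurable_norm
  have h1 : Tendsto (fun R => ∫ x, {x : Space d | R ≤ ‖x‖}.indicator w x) atTop
      (𝓝 (∫ _ : Space d, (0 : ℝ))) := by
    refine tendsto_integral_filter_of_dominated_convergence (fun x => ‖w x‖)
      (Eventually.of_forall fun R => (hw.indicator (hm R)).aestronglyMeasurable)
      (Eventually.of_forall fun R => Eventually.of_forall fun x => norm_indicator_le_norm_self _ _)
      hw.norm (Eventually.of_forall fun x => tendsto_const_nhds.congr' ?_)
    filter_upwards [eventually_gt_atTop ‖x‖] with R hR
    rw [Set.indicator_of_notMem (by simpa using hR)]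
  simp_rw [integral_indicator (hm _), integral_zero] at h1
  exact h1

theorem add_rpow_le_two_rpow_mul {x y p : ℝ} (hx : 0 ≤ x) (hy : 0 ≤ y) (hp : 0 ≤ p) :
    (x + y) ^ p ≤ 2 ^ p * (x ^ p + y ^ p) := by
  have h1 : x + y ≤ 2 * max x y := by linarith [le_max_left x y, le_max_right x y]
  refine (Real.rpow_le_rpow (by positivity) h1 hp).trans ?_
  rw [Real.mul_rpow two_pos.le (le_max_of_le_left hx)]
  refine mul_le_mul_of_nonneg_left ?_ (by positivity)
  have := Real.rpow_nonneg hx p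
  have := Real.rpow_nonneg hy p
  rcases max_choice x y with h | h <;> rw [h] <;> linarith

theorem setIntegral_rpow_le_of_sub {f f' : L2 d} {p : ℝ} (hp : 0 ≤ p) (s : Set (Space d))
    (h : Integrable fun x => ‖f x‖ ^ p) (h' : Integrable fun x => ‖f' x‖ ^ p)
    (hs : Integrable fun x => ‖(f - f') x‖ ^ p) :
    ∫ x in s, ‖f x‖ ^ p ≤ 2 ^ p * (∫ x in s, ‖f' x‖ ^ p) + 2 ^ p * ∫ x, ‖(f - f') x‖ ^ p := by
  have h1 : ∫ x in s, ‖f x‖ ^ p ≤ ∫ x in s, (2 ^ p * ‖f' x‖ ^ p + 2 ^ p * ‖(f - f') x‖ ^ p) := by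
    refine integral_mono_ae h.integrableOn
      ((h'.integrableOn.const_mul _).add (hs.integrableOn.const_mul _)) (ae_restrict_of_ae ?_)
    filter_upwards [Lp.coeFn_sub f f'] with x hx
    rw [hx, Pi.sub_apply, ← mul_add]
    refine le_trans ?_ (add_rpow_le_two_rpow_mul (norm_nonneg _) (norm_nonneg _) hp)
    refine Real.rpow_le_rpow (norm_nonneg _) ?_ hp
    have := norm_add_le (f' x) (f x - f' x)
    rwa [add_sub_cancel] at this
  refine h1.trans ?_
  rw [integral_add (h'.integrableOn.const_mul _) (hs.integrableOn.const_mul _),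
    integral_const_mul, integral_const_mul]
  refine add_le_add le_rfl (mul_le_mul_of_nonneg_left ?_ (by positivity))
  exact setIntegral_le_integral hs (Eventually.of_forall fun x => by positivity)

/-- Along a precompact orbit, the tails are uniformly small. -/
theorem PrecompactH1.exists_uniform_tail (hd : 3 ≤ d) (a : ℝ) {α : ℝ} (hα : 4 / (d : ℝ) < α)
    (hα' : α < 4 / ((d : ℝ) - 2)) {v : ℝ → L2 d} (h : PrecompactH1 (Set.range v)) {ε : ℝ}
    (hε : 0 < ε) : ∃ R, 1 ≤ R ∧ ε⁻¹ ≤ R ∧ ∀ t, ‖tailOp _ R (formGrad a (v t))‖ ≤ ε ∧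
      ∫ x in {x : Space d | R ≤ ‖x‖}, ‖v t x‖ ^ (α + 2) ≤ ε := by
  have h3 : (3 : ℝ) ≤ d := by exact_mod_cast hd
  have hα0 : 0 < α := lt_trans (by positivity) hα
  have hp : 0 ≤ α + 2 := by linarith
  have hm : ∀ t, MemH1 (v t) := fun t => h.1 _ ⟨t, rfl⟩
  obtain ⟨C, hC0, hC⟩ := exists_gagliardoNirenberg hd hα0 hα'
  obtain ⟨A, hA0, hA⟩ := exists_formGrad_sub_bound hd a
  have hi : ∀ t, Integrable fun x => ‖v t x‖ ^ (α + 2) := fun t =>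
    (hC _ _ ((hm t).mem_graphCl hd)).1
  -- The net size leaves ε/2 for the error in Dv (constant A) and ε/2 for the error in the potential
  -- tail (constant 2^{α+2}C); the other halves are used for the tails of the finitely many net
  -- points.
  set δ := min 1 (min (ε / (2 * (A + 1))) (ε / (2 * (2 ^ (α + 2) * (C + 1))))) with hδ
  have hδ0 : 0 < δ := by positivity
  have hδ1 : δ ≤ 1 := min_le_left _ _
  have hδA : A * δ ≤ ε / 2 := by
    have h1 : δ ≤ ε / (2 * (A + 1)) := (min_le_right _ _).trans (min_le_left _ _)
    rw [le_div_iff₀ (by positivity)] at h1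
    nlinarith
  have hδC : 2 ^ (α + 2) * (C * δ) ≤ ε / 2 := by
    have h1 : δ ≤ ε / (2 * (2 ^ (α + 2) * (C + 1))) := (min_le_right _ _).trans (min_le_right _ _)
    rw [le_div_iff₀ (by positivity)] at h1
    have h2 : 0 < (2 : ℝ) ^ (α + 2) := by positivity
    nlinarith [mul_pos h2 hδ0]
  obtain ⟨s, hs, hnet⟩ := h.exists_net hδ0
  have ev1 : ∀ r ∈ s, ∀ᶠ R in atTop, ‖tailOp _ R (formGrad a (v r))‖ ≤ ε / 2 ∧
      2 ^ (α + 2) * ∫ x in {x : Space d | R ≤ ‖x‖}, ‖v r x‖ ^ (α + 2) ≤ ε / 2 := by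
    intro r _
    have l1 := (tendsto_norm_tailOp (formGrad a (v r))).eventually_le_const (half_pos hε)
    have l2 := (tendsto_integral_tail (hi r)).const_mul ((2 : ℝ) ^ (α + 2))
    rw [mul_zero] at l2
    exact l1.and (l2.eventually_le_const (half_pos hε))
  obtain ⟨R, h1, h2, h4⟩ := ((eventually_ge_atTop 1).and ((eventually_ge_atTop ε⁻¹).and
    ((hs.eventually_all).2 ev1))).exists
  refine ⟨R, h1, h2, fun t => ?_⟩
  obtain ⟨r, hr, n1, n2⟩ := hnet t
  obtain ⟨k1, k2⟩ := h4 r hr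
  constructor
  · have e : tailOp _ R (formGrad a (v t)) = tailOp _ R (formGrad a (v r)) +
        tailOp _ R (formGrad a (v t) - formGrad a (v r)) := by
      rw [← map_add, add_sub_cancel]
    rw [e]
    have k3 := (norm_tailOp_le R (formGrad a (v t) - formGrad a (v r))).trans (hA _ _ (hm t) (hm r))
    have k4 := mul_le_mul_of_nonneg_left n2 hA0
    exact (norm_add_le _ _).trans (by linarith)
  · obtain ⟨i1, i2⟩ := hC _ _ (show (WithLp.toLp 2 (v t - v r, weakGrad (v t) - weakGrad (v r)) :
      WithLp 2 (L2 d × L2Vec d)) ∈ _ from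
        Submodule.sub_mem _ ((hm t).mem_graphCl hd) ((hm r).mem_graphCl hd))
    have hd2 : 0 < (d : ℝ) - 2 := by linarith
    have q1 : ‖v t - v r‖ ^ ((4 - ((d : ℝ) - 2) * α) / 2) ≤ 1 := by
      refine Real.rpow_le_one (norm_nonneg _) (n1.trans hδ1) ?_
      rw [lt_div_iff₀ hd2] at hα'
      linarith
    -- The exponent dα/2 exceeds 2 and the base is at most δ ≤ 1, so the power is at most δ itself.
    have q2 : ‖weakGrad (v t) - weakGrad (v r)‖ ^ (d * α / 2) ≤ δ := by
      rw [div_lt_iff₀ (by positivity)] at hα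
      have q3 : ‖weakGrad (v t) - weakGrad (v r)‖ ^ (d * α / 2) ≤
          ‖weakGrad (v t) - weakGrad (v r)‖ ^ (1 : ℝ) :=
        Real.rpow_le_rpow_of_exponent_ge' (norm_nonneg _) (n2.trans hδ1) zero_le_one (by linarith)
      rw [Real.rpow_one] at q3
      exact q3.trans n2
    have q4 : ∫ x, ‖(v t - v r) x‖ ^ (α + 2) ≤ C * δ := by
      refine i2.trans (mul_le_mul_of_nonneg_left ?_ hC0)
      exact (mul_le_mul q1 q2 (by positivity) zero_le_one).trans (one_mul δ).le
    have q5 := setIntegral_rpow_le_of_sub hp {x : Space d | R ≤ ‖x‖} (hi t) (hi r) i1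
    have q6 := mul_le_mul_of_nonneg_left q4 (show (0 : ℝ) ≤ 2 ^ (α + 2) by positivity)
    linarith

end formGrad

/-! ### Coercivity below the threshold -/

section coercivity

/-- A continuous trapping argument: below the threshold, the virial is bounded from below. -/
theorem exists_lower_bound_of_trapped {θ p C Ec y : ℝ} {q J : ℝ → ℝ} (hθ : 1 < θ) (hp : 0 < p)
    (hy0 : 0 < y) (hy : C * y ^ (θ - 1) = p / (2 * θ)) (hq : Continuous q) (hJ : ∀ t, 0 ≤ J t)
    (hE : ∀ t, q t / 2 - J t / p = Ec) (hEc : 0 < Ec) (hC : 0 ≤ C) (hGN : ∀ t, J t ≤ C * q t ^ θ)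
    (h0 : q 0 < y) (hEy : Ec < y * ((θ - 1) / (2 * θ))) :
    ∃ δ > 0, ∀ t, δ ≤ q t - 2 * θ / p * J t := by
  have hθ0 : 0 < θ := by linarith
  have hEy' : 2 * Ec + y / θ < y := by
    have e : y * ((θ - 1) / (2 * θ)) = (y - y / θ) / 2 := by field_simp
    rw [e] at hEy
    linarith
  have hq2 : ∀ t, 2 * Ec ≤ q t := fun t => by
    have := div_nonneg (hJ t) hp.le
    linarith [hE t]
  have hyθ : C * y ^ θ / p = y / (2 * θ) := by
    have e : y ^ θ = y ^ (θ - 1) * y := by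
      rw [← Real.rpow_add_one hy0.ne']
      congr 1
      ring
    rw [e, ← mul_assoc, hy]
    field_simp
  have hle : ∀ t, q t ≤ y → q t ≤ 2 * Ec + y / θ := by
    intro t ht
    have h1 : J t / p ≤ y / (2 * θ) := by
      rw [← hyθ]
      refine div_le_div_of_nonneg_right ((hGN t).trans ?_) hp.le
      exact mul_le_mul_of_nonneg_left
        (Real.rpow_le_rpow (by linarith [hq2 t]) ht hθ0.le) hC
    have e : y / (2 * θ) = y / θ / 2 := by field_simp
    linarith [hE t]
  -- By continuity q would have to attain the value y before exceeding it, which the improvement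
  -- just shown excludes.
  have hlt : ∀ t, q t ≤ y := by
    intro t
    by_contra! ht
    obtain ⟨r, hr⟩ := mem_range_of_exists_le_of_exists_ge hq ⟨0, h0.le⟩ ⟨t, ht.le⟩
    linarith [hle r hr.le]
  set y₁ := 2 * Ec + y / θ
  have hy₁ : 0 < y₁ := by positivity
  have hb : (y₁ / y) ^ (θ - 1) < 1 :=
    Real.rpow_lt_one (by positivity) ((div_lt_one hy0).2 hEy') (by linarith)
  -- Since C = p/(2θ) y^{1-θ}, the Gagliardo–Nirenberg bound reads 2θJ/p ≤ q(q/y)^{θ-1}. The gap is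
  -- then at least q(1 - (q/y)^{θ-1}), with q ≥ 2Ec in front and q ≤ y₁ < y inside.
  refine ⟨2 * Ec * (1 - (y₁ / y) ^ (θ - 1)), mul_pos (by linarith) (by linarith), fun t => ?_⟩
  have hqt : 0 < q t := by linarith [hq2 t]
  have h1 : 2 * θ / p * J t ≤ q t * (q t / y) ^ (θ - 1) := by
    have h2 := mul_le_mul_of_nonneg_left (hGN t) (show 0 ≤ 2 * θ / p by positivity)
    refine h2.trans (le_of_eq ?_)
    have e : q t ^ θ = q t ^ (θ - 1) * q t := by
      rw [← Real.rpow_add_one hqt.ne']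
      congr 1
      ring
    have hyp : 0 < y ^ (θ - 1) := by positivity
    have e2 : C = p / (2 * θ) / y ^ (θ - 1) := by
      rw [← hy]
      field_simp
    rw [e, Real.div_rpow hqt.le hy0.le, e2]
    field_simp
  have h3 : (q t / y) ^ (θ - 1) ≤ (y₁ / y) ^ (θ - 1) := by
    refine Real.rpow_le_rpow (by positivity) ?_ (by linarith)
    exact div_le_div_of_nonneg_right (hle t (hlt t)) hy0.le
  calc _ ≤ q t * (1 - (y₁ / y) ^ (θ - 1)) :=
        mul_le_mul_of_nonneg_right (hq2 t) (by linarith)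
    _ ≤ q t * (1 - (q t / y) ^ (θ - 1)) := mul_le_mul_of_nonneg_left (by linarith) hqt.le
    _ ≤ _ := by linarith

variable {d : ℕ} {a α : ℝ}

/-- `sharpGN` is a real supremum and gives an upper bound only once the set is known to be bounded.
This follows from the inequality with ‖∇f‖, because coercivity bounds ‖∇f‖ by ‖f‖ in Ḣ¹_a. -/
theorem bddAbove_gagliardoNirenberg (hd : 3 ≤ d) (ha : -(((d : ℝ) - 2) / 2) ^ 2 < a)
    (hα : 0 < α) (hα' : α < 4 / ((d : ℝ) - 2)) :
    BddAbove {c : ℝ | ∃ f : L2 d, MemH1 f ∧ f ≠ 0 ∧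
      c = (∫ x, ‖f x‖ ^ (α + 2)) /
        (‖f‖ ^ ((4 - ((d : ℝ) - 2) * α) / 2) * homNorm a f ^ (d * α / 2))} := by
  obtain ⟨C, hC0, hC⟩ := exists_gagliardoNirenberg hd hα hα'
  have hc := coerConst_pos hd ha
  refine ⟨C * √(coerConst d a)⁻¹ ^ (d * α / 2), ?_⟩
  rintro _ ⟨f, hf, -, rfl⟩
  rw [hf.homNorm_eq hd ha]
  have h1 : ‖weakGrad f‖ ≤ √(coerConst d a)⁻¹ * ‖formGrad a f‖ := by
    refine le_of_sq_le_sq ?_ (by positivity)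
    rw [mul_pow, Real.sq_sqrt (by positivity), le_inv_mul_iff₀ hc]
    exact hf.coercive hd ha
  refine div_le_of_le_mul₀ (by positivity) (by positivity) ?_
  refine ((hC _ _ (hf.mem_graphCl hd)).2).trans ?_
  have h2 : ‖weakGrad f‖ ^ (d * α / 2) ≤
      √(coerConst d a)⁻¹ ^ (d * α / 2) * ‖formGrad a f‖ ^ (d * α / 2) := by
    rw [← Real.mul_rpow (by positivity) (norm_nonneg _)]
    exact Real.rpow_le_rpow (norm_nonneg _) h1 (by positivity)
  calc _ ≤ C * (‖f‖ ^ ((4 - ((d : ℝ) - 2) * α) / 2) *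
        (√(coerConst d a)⁻¹ ^ (d * α / 2) * ‖formGrad a f‖ ^ (d * α / 2))) := by gcongr
    _ = _ := by ring

theorem MemH1.integral_le_sharpGN (hd : 3 ≤ d) (ha : -(((d : ℝ) - 2) / 2) ^ 2 < a)
    (hα : 0 < α) (hα' : α < 4 / ((d : ℝ) - 2)) {f : L2 d} (hf : MemH1 f) (h1 : ‖f‖ = 1)
    (h0 : 0 < ‖formGrad a f‖) :
    ∫ x, ‖f x‖ ^ (α + 2) ≤ sharpGN d a α * ‖formGrad a f‖ ^ (d * α / 2) := by
  have h2 : (∫ x, ‖f x‖ ^ (α + 2)) /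
      (‖f‖ ^ ((4 - ((d : ℝ) - 2) * α) / 2) * homNorm a f ^ (d * α / 2)) ≤ sharpGN d a α :=
    le_csSup (bddAbove_gagliardoNirenberg hd ha hα hα')
      ⟨f, hf, fun h => by simp [h] at h1, rfl⟩
  rwa [h1, Real.one_rpow, one_mul, hf.homNorm_eq hd ha, div_le_iff₀ (by positivity)] at h2

theorem integral_rpow_pos {f : L2 d} (hα : 0 < α) (hf : f ≠ 0)
    (hi : Integrable fun x => ‖f x‖ ^ (α + 2)) : 0 < ∫ x, ‖f x‖ ^ (α + 2) := by
  refine lt_of_le_of_ne (integral_nonneg fun x => by positivity) fun h => hf ?_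
  rw [Lp.eq_zero_iff_ae_eq_zero]
  filter_upwards [(integral_eq_zero_iff_of_nonneg (fun x => by positivity) hi).1 h.symm] with x hx
  rw [Pi.zero_apply] at hx ⊢
  rw [Real.rpow_eq_zero (norm_nonneg _) (by linarith)] at hx
  exact norm_eq_zero.1 hx

/-- With θ = dα/4 the right side is the solution y of C_a y^{θ-1} = (α+2)/(2θ), the critical point
that appears in `exists_lower_bound_of_trapped`. -/
theorem kineticThreshold_eq (hα : 0 < α) (hdα : 4 < d * α) (hC : 0 < sharpGN d a α) :
    kineticThreshold d a α ^ 2 =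
      ((α + 2) / (2 * (d * α / 4)) / sharpGN d a α) ^ (1 / (d * α / 4 - 1)) := by
  have hx : (d * α - 4) ≠ 0 := by linarith
  have hb : 0 ≤ 2 * (α + 2) / (α * d) := by positivity
  have e1 : 2 / (d * α - 4) * (2 : ℕ) = 1 / (d * α / 4 - 1) := by
    rw [div_mul_eq_mul_div, div_eq_div_iff hx (by linarith)]
    push_cast
    ring
  have e2 : 2 / (4 - d * α) * (2 : ℕ) = -(1 / (d * α / 4 - 1)) := by
    rw [← e1, ← neg_sub (d * α) 4, div_neg, neg_mul]
  have e3 : (α + 2) / (2 * (d * α / 4)) = 2 * (α + 2) / (α * d) := by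
    rw [div_eq_div_iff (by linarith) (by linarith)]
    ring
  rw [kineticThreshold, mul_pow, ← Real.rpow_mul_natCast hb, ← Real.rpow_mul_natCast hC.le, e1, e2,
    e3, Real.div_rpow hb hC.le, Real.rpow_neg hC.le, div_eq_mul_inv (_ ^ _)]

/-- The energy threshold is the value of y/2 - C_a y^θ/(α+2) at that critical point, namely
y(θ-1)/(2θ). -/
theorem energyThreshold_eq (hα : 0 < α) (hdα : 4 < d * α) (hC : 0 < sharpGN d a α) :
    energyThreshold d a α =
      ((α + 2) / (2 * (d * α / 4)) / sharpGN d a α) ^ (1 / (d * α / 4 - 1)) *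
        ((d * α / 4 - 1) / (2 * (d * α / 4))) := by
  have hx : 0 < d * α - 4 := by linarith
  have hb : 0 < 2 * (α + 2) := by linarith
  have hαd : 0 < α * d := by linarith
  have e1 : 4 / (4 - d * α) = -(1 / (d * α / 4 - 1)) := by
    rw [← neg_sub (d * α) 4, div_neg, neg_inj, div_eq_div_iff hx.ne' (by linarith)]
    ring
  have e2 : d * α / (4 - d * α) = -(1 / (d * α / 4 - 1)) - 1 := by
    rw [← e1, eq_sub_iff_add_eq, ← div_self (show 4 - d * α ≠ 0 by linarith), ← add_div]
    congr 1
    ring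
  have e3 : (α + 2) / (2 * (d * α / 4)) = 2 * (α + 2) / (α * d) := by
    rw [div_eq_div_iff (by linarith) (by linarith)]
    ring
  have e4 : (d * α / 4 - 1) / (2 * (d * α / 4)) = (α * d - 4) / (2 * (α * d)) := by
    rw [div_eq_div_iff (by linarith) (by linarith)]
    ring
  rw [energyThreshold, e1, e2, e3, e4, Real.rpow_sub_one hαd.ne', Real.rpow_neg hαd.le,
    Real.rpow_neg hb.le, Real.rpow_neg hC.le, Real.div_rpow (by positivity) hC.le,
    Real.div_rpow hb.le hαd.le]
  set e := 1 / (d * α / 4 - 1)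
  have h1 := Real.rpow_pos_of_pos hαd e
  have h2 := Real.rpow_pos_of_pos hb e
  have h3 := Real.rpow_pos_of_pos hC e
  generalize (α * d) ^ e = A at *
  generalize (2 * (α + 2)) ^ e = B at *
  generalize sharpGN d a α ^ e = S at *
  field_simp

/-- The full virial is bounded from below along the orbit. -/
theorem exists_coercive_bound (hd : 3 ≤ d) (ha : -(((d : ℝ) - 2) / 2) ^ 2 < a)
    (hα : 4 / (d : ℝ) < α) (hα' : α < 4 / ((d : ℝ) - 2)) {μ Ec : ℝ} (hμ : μ = 1 ∨ μ = -1)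
    (hEc : 0 < Ec) (hEc' : μ = -1 → Ec < energyThreshold d a α) {v : ℝ → L2 d}
    (hv : ∀ t, MemH1 (v t)) (hv1 : ∀ t, ‖v t‖ = 1) (hvE : ∀ t, energy a α μ (v t) = Ec)
    (hvc : Continuous fun t => formGrad a (v t))
    (hv0 : μ = -1 → homNorm a (v 0) < kineticThreshold d a α) :
    ∃ δ > 0, ∀ t, δ ≤ ‖formGrad a (v t)‖ ^ 2 +
      μ * (d * α / (2 * (α + 2)) * ∫ x, ‖v t x‖ ^ (α + 2)) := by
  have hd0 : (0 : ℝ) < d := by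
    have : 0 < d := by omega
    exact_mod_cast this
  have hα0 : 0 < α := lt_trans (by positivity) hα
  have hdα : 4 < d * α := by
    rw [div_lt_iff₀ hd0] at hα
    linarith
  obtain ⟨C, hC0, hC⟩ := exists_gagliardoNirenberg hd hα0 hα'
  have hi : ∀ t, Integrable fun x => ‖v t x‖ ^ (α + 2) := fun t =>
    (hC _ _ ((hv t).mem_graphCl hd)).1
  have hJ0 : ∀ t, 0 ≤ ∫ x, ‖v t x‖ ^ (α + 2) := fun t => integral_nonneg fun x => by positivity
  have hE : ∀ t, 1 / 2 * ‖formGrad a (v t)‖ ^ 2 + μ / (α + 2) * ∫ x, ‖v t x‖ ^ (α + 2) = Ec :=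
    fun t => by rw [← (hv t).energy_eq hd ha (hi t), hvE t]
  have hp : 0 < α + 2 := by linarith
  rcases hμ with rfl | rfl
  -- Defocusing case: dα > 4 makes the coefficient of the potential at least 2/(α+2), so the virial
  -- is at least twice the energy.
  · refine ⟨2 * Ec, by linarith, fun t => ?_⟩
    have h1 : 2 / (α + 2) * ∫ x, ‖v t x‖ ^ (α + 2) ≤
        d * α / (2 * (α + 2)) * ∫ x, ‖v t x‖ ^ (α + 2) := by
      refine mul_le_mul_of_nonneg_right ?_ (hJ0 t)
      rw [div_le_div_iff₀ hp (by positivity)]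
      nlinarith
    have h2 : 2 / (α + 2) * ∫ x, ‖v t x‖ ^ (α + 2) =
      2 * (1 / (α + 2) * ∫ x, ‖v t x‖ ^ (α + 2)) := by ring
    linarith [hE t]
  · have hE' : ∀ t, ‖formGrad a (v t)‖ ^ 2 / 2 - (∫ x, ‖v t x‖ ^ (α + 2)) / (α + 2) = Ec :=
      fun t => by
        rw [← hE t]
        ring
    have hq0 : ∀ t, 0 < ‖formGrad a (v t)‖ := by
      intro t
      have h1 := hE' t
      have h2 := div_nonneg (hJ0 t) hp.le
      refine (norm_nonneg _).lt_of_ne fun h => ?_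
      rw [← h] at h1
      norm_num at h1
      linarith
    have hGN := fun t => (hv t).integral_le_sharpGN hd ha hα0 hα' (hv1 t) (hq0 t)
    have hS : 0 < sharpGN d a α := by
      have h1 := (integral_rpow_pos hα0 (fun h => by simpa [h] using hv1 0) (hi 0)).trans_le (hGN 0)
      exact pos_of_mul_pos_left h1 (by have := hq0 0; positivity)
    -- Focusing case: at mass 1 the sharp inequality reads J ≤ C_a q^θ for q = ‖Dv‖², and the virial
    -- is q - (2θ/(α+2))J. Mass-supercriticality is exactly θ > 1.
    set θ := d * α / 4 with hθ
    have hθ1 : 1 < θ := by rw [hθ]; linarith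
    have hb : 0 < (α + 2) / (2 * θ) / sharpGN d a α := by positivity
    obtain ⟨δ, hδ, h1⟩ := exists_lower_bound_of_trapped (θ := θ) (p := α + 2) (C := sharpGN d a α)
      (Ec := Ec) (y := ((α + 2) / (2 * θ) / sharpGN d a α) ^ (1 / (θ - 1)))
      (q := fun t => ‖formGrad a (v t)‖ ^ 2) (J := fun t => ∫ x, ‖v t x‖ ^ (α + 2)) hθ1 hp
      (by positivity) (by
        rw [← Real.rpow_mul hb.le, one_div, inv_mul_cancel₀ (by linarith), Real.rpow_one]
        field_simp) (hvc.norm.pow 2) hJ0 hE' hEc hS.le (fun t => by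
        refine (hGN t).trans (le_of_eq ?_)
        rw [← Real.rpow_natCast, ← Real.rpow_mul (norm_nonneg _), hθ]
        congr 2
        push_cast
        ring) (by
        rw [← kineticThreshold_eq hα0 hdα hS, ← (hv 0).homNorm_eq hd ha]
        exact pow_lt_pow_left₀ (hv0 rfl) (Real.sqrt_nonneg _) two_ne_zero) (by
        rw [← energyThreshold_eq hα0 hdα hS]
        exact hEc' rfl)
    refine ⟨δ, hδ, fun t => (h1 t).trans (le_of_eq ?_)⟩
    simp only [hθ]
    field_simp
    ring

end coercivity


/-! ### Nonexistence of minimal blowup solutions -/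

section conclusion

variable {d : ℕ} {a α μ : ℝ}

/-- In both alternatives the power is mass-supercritical and energy-subcritical and a lies strictly
above the Hardy constant. For d = 3 the upper bound 2 is below 4/(d-2) = 4. -/
theorem AdmissibleParams.bounds (h : AdmissibleParams d a α) :
    3 ≤ d ∧ -(((d : ℝ) - 2) / 2) ^ 2 < a ∧ 4 / (d : ℝ) < α ∧ α < 4 / ((d : ℝ) - 2) := by
  rcases h with ⟨rfl, h1, h2, h3⟩ | ⟨hd, -, h1, h2, h3⟩
  · refine ⟨le_rfl, h3, by exact_mod_cast h1, lt_of_le_of_lt h2 (by norm_num)⟩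
  · exact ⟨hd, lt_of_le_of_lt (le_add_of_nonneg_right (sq_nonneg _)) h3,
      lt_of_le_of_lt (le_max_right _ _) h1, h2⟩

theorem isSchrodingerGroup_propagator (hd : 1 ≤ d) (ha : -(((d : ℝ) - 2) / 2) ^ 2 < a) :
    IsSchrodingerGroup a (propagator d a) := by
  have h := exists_schrodingerGroup hd ha.le
  rw [propagator, dif_pos h]
  exact h.choose_spec

theorem IsSolution.exists_duhamel {v : ℝ → L2 d} (h : IsSolution a α μ Set.univ 0 (v 0) v) :
    ∃ N : ℝ → L2 d, (∀ᵐ s, N s =ᵐ[volume] fun x => ((‖v s x‖ ^ α : ℝ) : ℂ) * v s x) ∧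
      Duhamel (propagator d a) μ N v := by
  obtain ⟨N, h1, h2⟩ := h.duhamel
  refine ⟨N, by simpa using h1, fun t => ?_⟩
  simpa using h2 t (Set.mem_univ t)

/-- An orbit with a precompact range and a coercive virial cannot exist. -/
theorem PrecompactH1.not_coercive (hd : 3 ≤ d) (ha : -(((d : ℝ) - 2) / 2) ^ 2 < a)
    (hα : 4 / (d : ℝ) < α) (hα' : α < 4 / ((d : ℝ) - 2)) {U : ℝ → L2 d →L[ℂ] L2 d}
    (hU : IsSchrodingerGroup a U) {N v : ℝ → L2 d} (h : Duhamel U μ N v)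
    (hN : ∀ᵐ s, N s =ᵐ[volume] fun x => ((‖v s x‖ ^ α : ℝ) : ℂ) * v s x)
    (hv : PrecompactH1 (Set.range v)) (hv1 : ∀ t, ‖v t‖ = 1)
    (hg : Continuous fun t => formGrad a (v t)) {δ : ℝ} (hδ : 0 < δ)
    (hc : ∀ t, δ ≤ ‖formGrad a (v t)‖ ^ 2 +
      μ * (d * α / (2 * (α + 2)) * ∫ x, ‖v t x‖ ^ (α + 2))) : False := by
  have hα0 : 0 < α := lt_of_le_of_lt (by positivity) hα
  have hm : ∀ t, MemH1 (v t) := fun t => hv.1 _ ⟨t, rfl⟩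
  obtain ⟨B, hB0, hB⟩ := hv.exists_bound
  obtain ⟨C₁, hC₁, hsub⟩ := exists_formGrad_sub_bound hd a
  obtain ⟨G, hG0, hG⟩ : ∃ G, 0 ≤ G ∧ ∀ t, ‖formGrad a (v t)‖ ≤ G := by
    refine ⟨‖formGrad a (v 0)‖ + C₁ * (B + B), by positivity, fun t => ?_⟩
    have h1 := norm_le_norm_add_norm_sub (formGrad a (v 0)) (formGrad a (v t))
    have h2 := hsub _ _ (hm 0) (hm t)
    have h3 : ‖weakGrad (v 0) - weakGrad (v t)‖ ≤ B + B :=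
      (norm_sub_le _ _).trans (add_le_add (hB 0) (hB t))
    linarith [mul_le_mul_of_nonneg_left h3 hC₁]
  obtain ⟨C, hC0, hC⟩ := exists_virial_lower_bound d a μ hα0
  obtain ⟨D, hD0, hD⟩ := exists_gagliardoNirenberg hd hα0 hα'
  -- Chosen so that C((1+G)(ε+ε)+ε) ≤ δ/2, where 1 + G bounds ‖v‖ + ‖Dv‖. One ε covers the tail of
  -- Dv, the tail of the potential, and 1/R.
  set ε := δ / (2 * (C * ((1 + G) * 2 + 1) + 1)) with hε
  have hε0 : 0 < ε := by positivity
  obtain ⟨R, hR1, hRε, hR⟩ := hv.exists_uniform_tail hd a hα hα' hε0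
  have hR0 : 0 < R := lt_of_lt_of_le one_pos hR1
  have hRε' : R⁻¹ ≤ ε := inv_le_of_inv_le₀ hε0 hRε
  have hCε : C * ((1 + G) * (ε + ε * 1) + ε) ≤ δ / 2 := by
    have : ε * (2 * (C * ((1 + G) * 2 + 1) + 1)) = δ := div_mul_cancel₀ _ (by positivity)
    nlinarith
  have hgr : ∀ t, (WithLp.toLp 2 (v t, formGrad a (v t)) : WithLp 2 (L2 d × L2Vec d)) ∈
      graphCl (jMap d) (dMap d a) := fun t => ((hm t).hardy hd ha).2.1
  set χ := bumpCutoff d hR0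
  have hvir : ∀ᵐ t, δ / 2 ≤ χ.virial a μ (v t) (formGrad a (v t)) (N t) := by
    filter_upwards [hN] with t ht
    refine le_trans ?_ (hC R hR0 hR1 _ _ _ (hgr t) (hD _ _ ((hm t).mem_graphCl hd)).1 ht)
    have h1 : C * ((‖v t‖ + ‖formGrad a (v t)‖) * (‖tailOp _ R (formGrad a (v t))‖ + R⁻¹ * ‖v t‖) +
        ∫ x in {x : Space d | R ≤ ‖x‖}, ‖v t x‖ ^ (α + 2)) ≤ C * ((1 + G) * (ε + ε * 1) + ε) := by
      rw [hv1 t]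
      gcongr
      exacts [hG t, (hR t).1, (hR t).2]
    linarith [hc t]
  obtain ⟨A, hA0, hA⟩ := Cutoff.exists_gen_bound a χ.toCutoff
  have hM : ∀ t, |(inner ℂ (χ.toCutoff.mul (v t)) (χ.toCutoff.gen a (v t) (formGrad a (v t)))).im| ≤
      ‖(χ.toCutoff.mul : L2 d →L[ℂ] L2 d)‖ * (A * (1 + G)) := by
    intro t
    refine (Complex.abs_im_le_norm _).trans ((norm_inner_le_norm _ _).trans ?_)
    refine mul_le_mul ?_ ?_ (norm_nonneg _) (norm_nonneg _)
    · simpa [hv1 t] using (χ.toCutoff.mul : L2 d →L[ℂ] L2 d).le_opNorm (v t)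
    · refine (hA _ _).trans ?_
      rw [hv1 t]
      gcongr
      exact hG t
  set K := ‖(χ.toCutoff.mul : L2 d →L[ℂ] L2 d)‖ * (A * (1 + G))
  have hK : 0 ≤ K := (abs_nonneg _).trans (hM 0)
  -- The virial identity forces an increment of at least 2·T·δ/2 = 2K + 1, while the localized
  -- momentum stays in [-K, K].
  set T := (2 * K + 1) / δ with hT
  have hT0 : 0 ≤ T := by positivity
  have hid := h.virial_identity hd ha hU hg hgr χ hT0
  have hint : T * (δ / 2) ≤ ∫ r in (0 : ℝ)..T, χ.virial a μ (v r) (formGrad a (v r)) (N r) := by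
    have := intervalIntegral.integral_mono_ae hT0 (intervalIntegrable_const (c := δ / 2))
      (h.intervalIntegrable_virial hU hg χ 0 T) hvir
    simpa [mul_div_assoc] using this
  have hTδ : T * δ = 2 * K + 1 := div_mul_cancel₀ _ hδ.ne'
  linarith [(abs_le.1 (hM T)).2, (abs_le.1 (hM 0)).1]

theorem not_isMinimalBlowupSolution {Ec : ℝ} (hp : AdmissibleParams d a α)
    (hμ : μ = 1 ∨ μ = -1) (hEc : 0 < Ec) (hEc' : μ = -1 → Ec < energyThreshold d a α)
    (v : ℝ → L2 d) : ¬ IsMinimalBlowupSolution a α μ Ec v := by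
  intro hv
  obtain ⟨hd, ha, hα, hα'⟩ := hp.bounds
  have hU := isSchrodingerGroup_propagator (by omega) ha
  obtain ⟨N, hN, h⟩ := hv.solution.exists_duhamel
  have hm : ∀ t, MemH1 (v t) := fun t => hv.precompact.1 _ ⟨t, rfl⟩
  have hv1 : ∀ t, ‖v t‖ = 1 := by
    intro t
    have h1 := hv.mass_eq t
    rw [mass, ← norm_sq_eq_integral] at h1
    exact (pow_eq_one_iff_of_nonneg (norm_nonneg _) two_ne_zero).1 h1
  have hw := hv.precompact.continuous_weakGrad hd (h.continuous hU)
  obtain ⟨C, hC0, hC⟩ := exists_formGrad_sub_bound hd a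
  have hg : Continuous fun t => formGrad a (v t) := by
    refine continuous_iff_continuousAt.2 fun t => tendsto_iff_norm_sub_tendsto_zero.2 ?_
    refine squeeze_zero (fun s => norm_nonneg _) (fun s => hC _ _ (hm s) (hm t)) ?_
    simpa using (tendsto_iff_norm_sub_tendsto_zero.1 (hw.tendsto t)).const_mul C
  obtain ⟨δ, hδ, hc⟩ := exists_coercive_bound hd ha hα hα' hμ hEc hEc' hm hv1 hv.energy_eq hg
    hv.subthreshold
  exact hv.precompact.not_coercive hd ha hα hα' hU h hN hv1 hg hδ hc

end conclusion

end NLSInvSq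

end

theorem theorem5p1 (d : ℕ) (a α μ Ec : ℝ)
    (hparams : NLSInvSq.AdmissibleParams d a α)
    (hμ : μ = 1 ∨ μ = -1)
    (hEc : 0 < Ec)
    (hEc_focusing : μ = -1 → Ec < NLSInvSq.energyThreshold d a α) :
    ¬ ∃ v : ℝ → NLSInvSq.L2 d, NLSInvSq.IsMinimalBlowupSolution a α μ Ec v := by
  rintro ⟨v, hv⟩
  exact NLSInvSq.not_isMinimalBlowupSolution hparams hμ hEc hEc_focusing v hv
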